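/- **Setting (no label noise).** Let $d,n,m\in\mathbb N$, $\boldsymbol\mu\in\mathbb R^d$, $\sigma_\xi,\sigma_0,\eta>0$. The training set is $\mathbf x_i=[y_i\boldsymbol\mu,\boldsymbol\xi_i]$, $i\in[n]$, with labels $y_i\in\{\pm1\}$ and independent noise patches $\boldsymbol\xi_i\sim\mathcal N(0,\sigma_\xi^2\mathbf I_d)$; the observed labels are the true labels $y_i$. The labels are either (a) independent Rademacher variables, independent of the $\boldsymbol\xi_i$, or (b) any given balanced labels (both classes of the same size). The network is $f(\mathbf W,\mathbf x)=F_{+1}(\mathbf W,\mathbf x)-F_{-1}(\mathbf W,\mathbf x)$ with $F_j(\mathbf W,[\mathbf x^{(1)},\mathbf x^{(2)}])=\frac1m\sum_{r=1}^m\big(\sigma(\langle\mathbf w_{j,r},\mathbf x^{(1)}\rangle)+\sigma(\langle\mathbf w_{j,r},\mathbf x^{(2)}\rangle)\big)$ and $\sigma(z)=\max\{0,z\}$. The initial weights $\mathbf w^{(0)}_{j,r}\sim\mathcal N(0,\sigma_0^2\mathbf I_d)$, $j=\pm1$, $r\in[m]$, are independent of each other and of the data. $\mathbf W^{(t)}$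 are the iterates of full-batch gradient descent with step size $\eta$ on $L_S(\mathbf W)=\frac1n\sum_{i=1}^n\log\big(1+\exp(-y_if(\mathbf W,\mathbf x_i))\big)$, that is, $$\mathbf w_{j,r}^{(t+1)}=\mathbf w_{j,r}^{(t)}-\frac{\eta}{nm}\sum_{i=1}^n\ell_i'^{(t)}\sigma'(\langle\mathbf w_{j,r}^{(t)},\boldsymbol\xi_i\rangle)\,j\,y_i\boldsymbol\xi_i-\frac{\eta}{nm}\sum_{i=1}^n\ell_i'^{(t)}\sigma'(\langle\mathbf w_{j,r}^{(t)},y_i\boldsymbol\mu\rangle)\,j\,\boldsymbol\mu,\qquad \ell_i'^{(t)}=\frac{-1}{1+\exp(y_if(\mathbf W^{(t)},\mathbf x_i))},$$ with $\sigma'(z)=\mathbb 1(z\ge0)$. The test error is $L_D^{0-1}(\mathbf W)=\mathbb P(yf(\mathbf W,[y\boldsymbol\mu,\boldsymbol\xi+\boldsymbol\zeta])<0)$, where $y$ is Rademacher, $\boldsymbol\xi$ is uniform on the training noise patches $\boldsymbol\xi_1,\dots,\boldsymbol\xi_n$ and $\boldsymbol\zeta\sim\mathcal N(0,\sigma_\xi^2\mathbf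 I_d)$, all independent. Put $\mathrm{SNR}=\|\boldsymbol\mu\|_2/(\sigma_\xi\sqrt d)$ and $R=\eta^{-1}nm\sigma_\xi^{-2}d^{-1}$. **Condition.** For constants $C,c_1,c_2$, a tolerance $0<\epsilon\le1$, a failure probability $0<\delta<1$, $n\ge2$ and a maximal number of iterations $T^*\in\mathbb N$: 1. $c_1\le n\cdot\mathrm{SNR}^2\le c_2$; 2. $d\ge C\max\{n^2\log(nm/\delta)\log(T^*)^2,\ n\|\boldsymbol\mu\|_2\sigma_\xi^{-1}\sqrt{\log(n/\delta)}\}$; 3. $m\ge C\log(n/\delta)$ and $n\ge C\log(m/\delta)$; 4. $\|\boldsymbol\mu\|_2^2\ge C\sigma_\xi^2\log(n/\delta)$; 5. $\sigma_0\le C^{-1}\min\{\sqrt n\,\sigma_\xi^{-1}d^{-1},\ \|\boldsymbol\mu\|_2^{-1}\log(m/\delta)^{-1/2}\}$; 6. $\eta\le C^{-1}\min\{\sigma_\xi^{-2}d^{-3/2}n^2m\sqrt{\log(n/\delta)},\ \sigma_\xi^{-2}d^{-1}n\}$; 7. $T^*\ge C\epsilon^{-1}R$. **Theorem.** There is an absolute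 constant $K>0$ such that for all $0<c_1\le c_2$ there are constants $C,C_D,a,b>0$, with $C_D\le Kc_2$, depending only on $c_1,c_2$, for which the following holds. Whenever the Condition is satisfied, there are integers $T_1\le T_1'\le T^*$ with $aR\le T_1\le bR$ and $a\epsilon^{-1}R\le T_1'\le b\epsilon^{-1}R$ such that, in either of the cases (a), (b), with probability at least $1-\delta$ over the training set and the initialization: * $y_if(\mathbf W^{(t)},\mathbf x_i)\ge0$ for all $i\in[n]$ and all $T_1\le t\le T^*$; * there is a time $t^*\in[T_1',T^*]$ with $L_S(\mathbf W^{(t^*)})\le\epsilon$, with $y_if(\mathbf W^{(t^*)},\mathbf x_i)\ge0$ for all $i\in[n]$, and with $$L_D^{0-1}(\mathbf W^{(t^*)})\le\exp\left(\frac dn-\frac{n\|\boldsymbol\mu\|_2^4}{C_D\sigma_\xi^4d}\right).$$ -/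

import Mathlib

open MeasureTheory ProbabilityTheory

noncomputable section

namespace FeatureLearning

/-- `ℝ^d` with the Euclidean norm. -/
abbrev Vec (d : ℕ) : Type := EuclideanSpace ℝ (Fin d)

/-- A label (or the sign `j = ±1` of a branch of the network) is a Boolean:
`true` is `+1` and `false` is `-1`; `sgn` is the corresponding real number. -/
def sgn (b : Bool) : ℝ := if b then 1 else -1

/-- First-layer weights `w_{j,r}`, for `j = ±1` and `r ∈ [m]`. -/
abbrev Weights (d m : ℕ) : Type := Bool → Fin m → Vec d

/-! ### The network -/

/-- ReLU. -/
def relu (z : ℝ) : ℝ := max 0 z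

/-- The derivative of ReLU, with the convention `σ'(0) = 1`. -/
def reluDeriv (z : ℝ) : ℝ := if 0 ≤ z then 1 else 0

/-- The two-patch data point `[y μ, ξ]`.  (The network below is symmetric in the two patches, so
the order in which they appear is irrelevant.) -/
def dataPoint {d : ℕ} (μ : Vec d) (y : Bool) (ξ : Vec d) : Vec d × Vec d := (sgn y • μ, ξ)

/-- `F_j(W_j, x)`. -/
def branch {d m : ℕ} (W : Weights d m) (j : Bool) (x : Vec d × Vec d) : ℝ :=
  (1 / (m : ℝ)) * ∑ r : Fin m, (relu (inner ℝ (W j r) x.1) + relu (inner ℝ (W j r) x.2))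

/-- `f(W, x) = F_{+1}(W_{+1}, x) - F_{-1}(W_{-1}, x)`. -/
def network {d m : ℕ} (W : Weights d m) (x : Vec d × Vec d) : ℝ :=
  branch W true x - branch W false x

/-! ### Loss and gradient descent (no label noise: observed label = true label) -/

/-- Logistic loss of the output `f` at the label `y`. -/
def logisticLoss (f : ℝ) (y : Bool) : ℝ := Real.log (1 + Real.exp (-(f * sgn y)))

/-- The loss derivative `ℓ' = -1 / (1 + exp(y f))`. -/
def lossDeriv (f : ℝ) (y : Bool) : ℝ := -1 / (1 + Real.exp (sgn y * f))

/-- The training loss `L_S(W)` of the training set `x_i = [y_i μ, ξ_i]`. -/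
def trainLoss {d m n : ℕ} (μ : Vec d) (y : Fin n → Bool) (ξ : Fin n → Vec d)
    (W : Weights d m) : ℝ :=
  (1 / (n : ℝ)) * ∑ i : Fin n, logisticLoss (network W (dataPoint μ (y i) (ξ i))) (y i)

/-- One step of full-batch gradient descent on the training loss with step size `η`. -/
def gdStep {d m n : ℕ} (μ : Vec d) (η : ℝ) (y : Fin n → Bool) (ξ : Fin n → Vec d)
    (W : Weights d m) : Weights d m := fun j r =>
  W j r
    - (η / ((n : ℝ) * m)) • ∑ i : Fin n,
        (lossDeriv (network W (dataPoint μ (y i) (ξ i))) (y i)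
          * reluDeriv (inner ℝ (W j r) (ξ i)) * (sgn j * sgn (y i))) • ξ i
    - (η / ((n : ℝ) * m)) • ∑ i : Fin n,
        (lossDeriv (network W (dataPoint μ (y i) (ξ i))) (y i)
          * reluDeriv (inner ℝ (W j r) (sgn (y i) • μ)) * (sgn j * sgn (y i) * sgn (y i))) • μ

/-- The iterate `W^{(t)}` of gradient descent started at `W₀`. -/
def gd {d m n : ℕ} (μ : Vec d) (η : ℝ) (y : Fin n → Bool) (ξ : Fin n → Vec d)
    (W₀ : Weights d m) : ℕ → Weights d m
  | 0 => W₀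
  | t + 1 => gdStep μ η y ξ (gd μ η y ξ W₀ t)

/-! ### Probability laws -/

/-- `N(0, σ² I_d)`. -/
def gaussianVec (d : ℕ) (σ : ℝ) : Measure (Vec d) :=
  (stdGaussian (Vec d)).map (fun x => σ • x)

/-- The Rademacher law of a label. -/
def rademacher : Measure Bool := uniformOn Set.univ

/-- `n` independent Rademacher labels. -/
def labelLaw (n : ℕ) : Measure (Fin n → Bool) := Measure.pi fun _ => rademacher

/-- `n` independent noise patches `ξ_i ∼ N(0, σ² I_d)`. -/
def noiseLaw (d n : ℕ) (σ : ℝ) : Measure (Fin n → Vec d) :=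
  Measure.pi fun _ => gaussianVec d σ

/-- Independent initial weights `w_{j,r} ∼ N(0, σ₀² I_d)`. -/
def initLaw (d m : ℕ) (σ₀ : ℝ) : Measure (Weights d m) :=
  Measure.pi fun _ => Measure.pi fun _ => gaussianVec d σ₀

/-- The training set is balanced: both classes have the same size. -/
def Balanced {n : ℕ} (y : Fin n → Bool) : Prop :=
  (Finset.univ.filter fun i => y i = true).card = (Finset.univ.filter fun i => y i = false).card

/-- The test 0-1 error `P(y f(W, x) < 0)`, where `x = [y μ, ξ + ζ]` with `y` Rademacher, `ξ`
uniform on the training noise patches `ξ_1, …, ξ_n` and `ζ ∼ N(0, σ² I_d)`, all independent. -/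
def testError {d m n : ℕ} (μ : Vec d) (σ : ℝ) (ξ : Fin n → Vec d) (W : Weights d m) : ENNReal :=
  (rademacher.prod ((uniformOn (Set.univ : Set (Fin n))).prod (gaussianVec d σ)))
    {p | sgn p.1 * network W (dataPoint μ p.1 (ξ p.2.1 + p.2.2)) < 0}

/-! ### The standing condition -/

/-- Signal-to-noise ratio `‖μ‖ / (σ_ξ √d)`. -/
def SNR {d : ℕ} (μ : Vec d) (σξ : ℝ) : ℝ := ‖μ‖ / (σξ * √(d : ℝ))

/-- The basic time scale `η⁻¹ n m σ_ξ⁻² d⁻¹`. -/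
def timeScale (d n m : ℕ) (σξ η : ℝ) : ℝ := η⁻¹ * n * m * (σξ ^ 2)⁻¹ * (d : ℝ)⁻¹

/-- The standing condition with constant `C`, where `n · SNR² = Θ(1)` means
`c₁ ≤ n · SNR² ≤ c₂`.  The maximal number of iterations `Tstar` is any integer that is at least `C`
times `ε⁻¹ η⁻¹ n m σ_ξ⁻² d⁻¹`. -/
structure Condition (C c₁ c₂ : ℝ) (d n m Tstar : ℕ) (μ : Vec d) (σξ σ₀ η ε δ : ℝ) : Prop where
  two_le_n : 2 ≤ n
  σξ_pos : 0 < σξ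
  σ₀_pos : 0 < σ₀
  η_pos : 0 < η
  ε_pos : 0 < ε
  ε_le_one : ε ≤ 1
  δ_pos : 0 < δ
  δ_lt_one : δ < 1
  Tstar_ge : C * (ε⁻¹ * timeScale d n m σξ η) ≤ Tstar
  snr_ge : c₁ ≤ n * SNR μ σξ ^ 2
  snr_le : n * SNR μ σξ ^ 2 ≤ c₂
  d_ge : C * max ((n : ℝ) ^ 2 * Real.log (n * m / δ) * Real.log Tstar ^ 2)
      (n * ‖μ‖ * σξ⁻¹ * √(Real.log (n / δ))) ≤ d
  m_ge : C * Real.log (n / δ) ≤ m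
  n_ge : C * Real.log (m / δ) ≤ n
  μ_ge : C * σξ ^ 2 * Real.log (n / δ) ≤ ‖μ‖ ^ 2
  σ₀_le : σ₀ ≤ C⁻¹ * min (√(n : ℝ) * σξ⁻¹ * (d : ℝ)⁻¹) (‖μ‖⁻¹ * (√(Real.log (m / δ)))⁻¹)
  η_le : η ≤ C⁻¹ * min
      ((σξ ^ 2)⁻¹ * (d : ℝ) ^ (-(3 / 2) : ℝ) * (n : ℝ) ^ 2 * m * √(Real.log (n / δ)))
      ((σξ ^ 2)⁻¹ * (d : ℝ)⁻¹ * n)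

/-! ### The training outcome -/

/-- The outcome for one realization of the labels `y`, the noise patches `ξ` and the initialization
`W₀`: every training point is classified correctly during `[T₁, Tstar]`, and at some time in
`[T₁', Tstar]` the training loss is at most `ε`, every training point is classified correctly, and
the test error is at most `exp(d/n - n‖μ‖⁴/(C_D σ_ξ⁴ d))`. -/
def Outcome {d m n : ℕ} (μ : Vec d) (σξ η ε C_D : ℝ) (T₁ T₁' Tstar : ℕ)
    (y : Fin n → Bool) (ξ : Fin n → Vec d) (W₀ : Weights d m) : Prop :=
  (∀ t : ℕ, T₁ ≤ t → t ≤ Tstar → ∀ i : Fin n,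
      0 ≤ sgn (y i) * network (gd μ η y ξ W₀ t) (dataPoint μ (y i) (ξ i))) ∧
  ∃ t : ℕ, T₁' ≤ t ∧ t ≤ Tstar ∧
    trainLoss μ y ξ (gd μ η y ξ W₀ t) ≤ ε ∧
    (∀ i : Fin n, 0 ≤ sgn (y i) * network (gd μ η y ξ W₀ t) (dataPoint μ (y i) (ξ i))) ∧
    testError μ σξ ξ (gd μ η y ξ W₀ t) ≤
      ENNReal.ofReal (Real.exp ((d : ℝ) / n - n * ‖μ‖ ^ 4 / (C_D * σξ ^ 4 * d)))

end FeatureLearning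

end

open FeatureLearning

noncomputable section

namespace FeatureLearning

/-! ### Elementary facts -/

/-! Training is read off from the correlations P = j⟨w, μ⟩ and q_i = ⟨w, ξ_i⟩. On a likely event
(`Typical`) the patches are nearly orthogonal, the initialization is negligible, and at least a
quarter of the neurons of each branch is active on each noise patch. There gradient descent is a
nearly decoupled system (`Typical.regular`) with normalized step s = ησ²d/(nm), the inverse of the
time scale, and signal strength κ = n·SNR². With gradient weights g_i = -ℓ'_i, an active q_i moves
by s g_i up to sign and constants, and P moves up by s κ times an average of the g_i over active
points, with errors of order τ s times the mean gradient weight.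

The correlations P never decrease, and after a short burn-in all are positive. From then on the
signal margin of a class is driven by that class alone, so a margin grows at a rate comparable to s
g_i. As g_i = 1/(1 + exp(margin)), the exponential of each margin lies between two linear functions
of s t (`Invariant.step`, `Regular.invariant`). Two facts close this bootstrap. The linear bounds
make all gradient weights comparable up to 96b, so the interactions stay negligible against each
g_i. Within a class the signal margins coincide and the noise margins balance themselves, so the
exponentials agree up to the fixed factor 400 (`Invariant.ratio_step`); this bounds the class
gradient by g_i without involving b. The linear lower bound yields correct classification once s t ≥
100 and loss at most ε once s t ≥ 48/ε.

For the test error, the claimed bound is at least 1 if κ² ≤ 10¹² c₂. Otherwise κ ≤ c₂ forces κ >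
10¹², a strong signal. Put L = log(s t). At a late time P ≥ L/8, while the memorized noise is at
most of order L/κ plus τ (`Regular.late_bounds`) and σ‖w‖ is at most of order √(n/d) L/√κ
(`Typical.norm_gd_le`). A fresh perturbation must therefore exceed L/16 in the direction of some
neuron to cause an error (`testError_le`). The factor L cancels in the Gaussian exponent, which is
of order κd/n; the union bound over 2m ≤ exp(d/n) neurons costs d/n, and κ ≥ κ²/c₂ gives the stated
form with C_D a multiple of c₂.

The typical event concerns only the noise and the initialization. Labels enter only through both
classes having at least n/4 points, so both label models are covered by one argument. -/

lemma sgn_mul_self (b : Bool) : sgn b * sgn b = 1 := by cases b <;> simp [sgn]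

lemma sgn_not (b : Bool) : sgn (!b) = -sgn b := by cases b <;> simp [sgn]

lemma abs_sgn (b : Bool) : |sgn b| = 1 := by cases b <;> simp [sgn]

lemma relu_nonneg (z : ℝ) : 0 ≤ relu z := le_max_left _ _

lemma le_relu (z : ℝ) : z ≤ relu z := le_max_right _ _

lemma relu_of_nonneg {z : ℝ} (h : 0 ≤ z) : relu z = z := max_eq_right h

lemma relu_of_nonpos {z : ℝ} (h : z ≤ 0) : relu z = 0 := max_eq_left h

lemma relu_mono {a b : ℝ} (h : a ≤ b) : relu a ≤ relu b := max_le_max le_rfl h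

lemma relu_le_abs (z : ℝ) : relu z ≤ |z| := max_le (abs_nonneg z) (le_abs_self z)

lemma relu_add_le (a b : ℝ) : relu (a + b) ≤ relu a + relu b :=
  max_le (add_nonneg (relu_nonneg a) (relu_nonneg b)) (add_le_add (le_relu a) (le_relu b))

lemma relu_sub_le {a b c : ℝ} (hc : 0 ≤ c) (h : a - b ≤ c) : relu a - relu b ≤ c := by
  have h1 := relu_add_le b (a - b)
  have h2 : relu (a - b) ≤ c := max_le hc h
  rw [add_sub_cancel] at h1
  linarith

lemma reluDeriv_of_nonneg {z : ℝ} (h : 0 ≤ z) : reluDeriv z = 1 := if_pos h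

lemma reluDeriv_of_neg {z : ℝ} (h : z < 0) : reluDeriv z = 0 := if_neg (not_le.2 h)

lemma reluDeriv_nonneg (z : ℝ) : 0 ≤ reluDeriv z := by unfold reluDeriv; split_ifs <;> norm_num

lemma reluDeriv_le_one (z : ℝ) : reluDeriv z ≤ 1 := by unfold reluDeriv; split_ifs <;> norm_num

lemma exp_le_one_add_two_mul {x : ℝ} (h0 : 0 ≤ x) (h1 : x ≤ 1) : Real.exp x ≤ 1 + 2 * x := by
  have := Real.abs_exp_sub_one_le (x := x) (by rwa [abs_of_nonneg h0])
  rw [abs_of_nonneg h0] at this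
  linarith [le_abs_self (Real.exp x - 1)]

/-! ### The dynamics of the correlations -/

/-- The quantities that drive training: the labels, the oriented signal correlations
`P t j r = j ⟨w_{j,r}, μ⟩` and the noise correlations `q t j r i = ⟨w_{j,r}, ξ_i⟩` at time `t`. -/
structure Correlations (n m : ℕ) where
  y : Fin n → Bool
  P : ℕ → Bool → Fin m → ℝ
  q : ℕ → Bool → Fin m → Fin n → ℝ

namespace Correlations

variable {n m : ℕ} (D : Correlations n m)

/-- The part of the margin of a class `j` that is due to the signal patch. -/
def signalMargin (t : ℕ) (j : Bool) : ℝ :=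
  (1 / (m : ℝ)) * ∑ r, (relu (D.P t j r) - relu (-D.P t (!j) r))

/-- The part of the margin of a training point that is due to its noise patch. -/
def noiseMargin (t : ℕ) (i : Fin n) : ℝ :=
  (1 / (m : ℝ)) * ∑ r, (relu (D.q t (D.y i) r i) - relu (D.q t (!D.y i) r i))

/-- The margin `y_i f(W, x_i)`. -/
def margin (t : ℕ) (i : Fin n) : ℝ := D.signalMargin t (D.y i) + D.noiseMargin t i

/-- The gradient weight `-ℓ'_i` of a training point. -/
def grad (t : ℕ) (i : Fin n) : ℝ := 1 / (1 + Real.exp (D.margin t i))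

/-- The mean gradient weight. -/
def meanGrad (t : ℕ) : ℝ := (1 / (n : ℝ)) * ∑ i, D.grad t i

/-- The contribution of the class `j` to the mean gradient weight. -/
def classGrad (t : ℕ) (j : Bool) : ℝ := (1 / (n : ℝ)) * ∑ i, if D.y i = j then D.grad t i else 0

/-- The correlations follow gradient descent with normalized step size `s` and signal strength
`κ`, up to interactions between different patches of relative size `τ`, from a small
initialization for which a quarter of the neurons is active on each noise patch. -/
structure Regular (s κ τ : ℝ) (N : Fin n → ℝ) : Prop where
  n_pos : 0 < n
  m_pos : 0 < m
  s_pos : 0 < s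
  τ_pos : 0 < τ
  N_ge : ∀ i, 1 / 2 ≤ N i
  N_le : ∀ i, N i ≤ 2
  q_step : ∀ t j r i, |D.q (t + 1) j r i - D.q t j r i
      - s * (sgn j * sgn (D.y i) * D.grad t i * reluDeriv (D.q t j r i) * N i)|
        ≤ s * (2 * τ * D.meanGrad t)
  P_step : ∀ t j r, |D.P (t + 1) j r - D.P t j r
      - s * (κ * ((1 / (n : ℝ)) * ∑ i, D.grad t i * reluDeriv (sgn (D.y i) * sgn j * D.P t j r)))|
        ≤ s * (τ * D.meanGrad t)
  P_init : ∀ j r, |D.P 0 j r| ≤ τ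
  q_init : ∀ j r i, |D.q 0 j r i| ≤ τ
  active : ∀ i, (m : ℝ) / 4 ≤ (Finset.univ.filter fun r => 0 ≤ D.q 0 (D.y i) r i).card
  class_ge : ∀ j, (n : ℝ) / 4 ≤ (Finset.univ.filter fun i => D.y i = j).card

variable {D} {s κ τ : ℝ} {N : Fin n → ℝ}

lemma grad_pos (t : ℕ) (i : Fin n) : 0 < D.grad t i := by unfold grad; positivity

lemma grad_le_one (t : ℕ) (i : Fin n) : D.grad t i ≤ 1 := by
  unfold grad
  rw [div_le_one (by positivity)]
  linarith [Real.exp_pos (D.margin t i)]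

lemma meanGrad_nonneg (t : ℕ) : 0 ≤ D.meanGrad t :=
  mul_nonneg (by positivity) (Finset.sum_nonneg fun i _ => (grad_pos t i).le)

lemma meanGrad_le (hn : 0 < n) {t : ℕ} {c : ℝ} (h : ∀ i, D.grad t i ≤ c) : D.meanGrad t ≤ c := by
  have hn' : (0 : ℝ) < n := by exact_mod_cast hn
  have : ∑ i, D.grad t i ≤ n * c := by
    simpa using Finset.sum_le_sum (s := Finset.univ) fun i _ => h i
  unfold meanGrad
  rw [one_div, inv_mul_le_iff₀ hn']
  exact this

lemma meanGrad_le_one (hn : 0 < n) (t : ℕ) : D.meanGrad t ≤ 1 := meanGrad_le hn (grad_le_one t)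

lemma classGrad_nonneg (t : ℕ) (j : Bool) : 0 ≤ D.classGrad t j :=
  mul_nonneg (by positivity) (Finset.sum_nonneg fun i _ => by
    split_ifs
    exacts [(grad_pos t i).le, le_rfl])

lemma classGrad_le_meanGrad (t : ℕ) (j : Bool) : D.classGrad t j ≤ D.meanGrad t :=
  mul_le_mul_of_nonneg_left (Finset.sum_le_sum fun i _ => by
    split_ifs
    exacts [le_rfl, (grad_pos t i).le]) (by positivity)

namespace Regular

/-- The average is over all n points, of which the class holds at least a quarter; hence the factor
4. -/
lemma le_classGrad (h : D.Regular s κ τ N) {t : ℕ} {j : Bool} {c : ℝ} (hc0 : 0 ≤ c)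
    (hc : ∀ i, D.y i = j → c ≤ D.grad t i) : c / 4 ≤ D.classGrad t j := by
  have hn' : (0 : ℝ) < n := by exact_mod_cast h.n_pos
  have h1 : ((Finset.univ.filter fun i => D.y i = j).card : ℝ) * c
      ≤ ∑ i, if D.y i = j then D.grad t i else 0 := by
    rw [← Finset.sum_filter, ← nsmul_eq_mul]
    exact Finset.card_nsmul_le_sum _ _ _ fun i hi => hc i (Finset.mem_filter.1 hi).2
  have h2 := mul_le_mul_of_nonneg_right (h.class_ge j) hc0
  unfold classGrad
  rw [one_div, le_inv_mul_iff₀ hn']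
  linarith

lemma classGrad_le (h : D.Regular s κ τ N) {t : ℕ} {j : Bool} {c : ℝ} (hc0 : 0 ≤ c)
    (hc : ∀ i, D.y i = j → D.grad t i ≤ c) : D.classGrad t j ≤ c := by
  have hn' : (0 : ℝ) < n := by exact_mod_cast h.n_pos
  have h1 : (∑ i, if D.y i = j then D.grad t i else 0) ≤ ∑ _i : Fin n, c :=
    Finset.sum_le_sum fun i _ => by
      split_ifs with hi
      exacts [hc i hi, hc0]
  simp only [Finset.sum_const, Finset.card_univ, Fintype.card_fin, nsmul_eq_mul] at h1
  unfold classGrad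
  rw [one_div, inv_mul_le_iff₀ hn']
  exact h1

/-! #### One step of the noise correlations -/

section NoiseStep

variable {M : ℝ} {t : ℕ}

lemma interaction_le (h : D.Regular s κ τ N) (hx : 2 * τ * M ≤ 1 / 20)
    {i : Fin n} (hM : D.meanGrad t ≤ M * D.grad t i) :
    2 * τ * D.meanGrad t ≤ D.grad t i / 20 := by
  have h1 := mul_le_mul_of_nonneg_left hM (mul_nonneg zero_le_two h.τ_pos.le)
  have h2 := mul_le_mul_of_nonneg_right hx (grad_pos (D := D) t i).le
  linarith

/-- An active neuron of the point's own branch drifts upward by s g N with N in [1/2, 2], and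
interactions shift this by at most s g / 20: hence 9/20 and 41/20. The positive net drift keeps
active neurons active. -/
lemma own_step (h : D.Regular s κ τ N) {i : Fin n}
    (hs : 2 * τ * D.meanGrad t ≤ D.grad t i / 20) (r : Fin m) :
    (if 0 ≤ D.q t (D.y i) r i then s * D.grad t i * (9 / 20) else 0)
        ≤ relu (D.q (t + 1) (D.y i) r i) - relu (D.q t (D.y i) r i) ∧
      relu (D.q (t + 1) (D.y i) r i) - relu (D.q t (D.y i) r i) ≤ s * D.grad t i * (41 / 20) ∧
      (0 ≤ D.q t (D.y i) r i → 0 ≤ D.q (t + 1) (D.y i) r i) := by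
  have hg := grad_pos (D := D) t i
  have hsg := mul_pos h.s_pos hg
  have hstep := abs_le.1 (h.q_step t (D.y i) r i)
  have h2 := mul_le_mul_of_nonneg_left hs h.s_pos.le
  have hN1 := mul_le_mul_of_nonneg_left (h.N_ge i) hsg.le
  have hN2 := mul_le_mul_of_nonneg_left (h.N_le i) hsg.le
  rw [sgn_mul_self] at hstep
  split_ifs with hq
  · rw [reluDeriv_of_nonneg hq] at hstep
    have hq1 : 0 ≤ D.q (t + 1) (D.y i) r i := by nlinarith
    rw [relu_of_nonneg hq, relu_of_nonneg hq1]
    refine ⟨by nlinarith, by nlinarith, fun _ => hq1⟩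
  · rw [reluDeriv_of_neg (not_le.1 hq)] at hstep
    rw [relu_of_nonpos (not_le.1 hq).le, sub_zero]
    refine ⟨relu_nonneg _, max_le (by positivity) ?_, fun hq' => absurd hq' hq⟩
    nlinarith [not_le.1 hq]

/-- In the opposite branch the drift of an active neuron is downward, so only interactions can raise
its response. The possible decrease is bounded as well, because it increases the margin. -/
lemma other_step (h : D.Regular s κ τ N) {i : Fin n}
    (hs : 2 * τ * D.meanGrad t ≤ D.grad t i / 20) (r : Fin m) :
    relu (D.q (t + 1) (!D.y i) r i) - relu (D.q t (!D.y i) r i) ≤ s * D.grad t i * (1 / 20) ∧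
      relu (D.q t (!D.y i) r i) - relu (D.q (t + 1) (!D.y i) r i)
        ≤ s * D.grad t i * (41 / 20) := by
  have hg := grad_pos (D := D) t i
  have hsg := mul_pos h.s_pos hg
  have hstep := abs_le.1 (h.q_step t (!D.y i) r i)
  have h2 := mul_le_mul_of_nonneg_left hs h.s_pos.le
  have hN1 := mul_le_mul_of_nonneg_left (h.N_ge i) hsg.le
  have hN2 := mul_le_mul_of_nonneg_left (h.N_le i) hsg.le
  rw [sgn_not, neg_mul, sgn_mul_self] at hstep
  rcases le_or_gt 0 (D.q t (!D.y i) r i) with hq | hq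
  · rw [reluDeriv_of_nonneg hq] at hstep
    exact ⟨relu_sub_le (by positivity) (by nlinarith), relu_sub_le (by positivity) (by nlinarith)⟩
  · rw [reluDeriv_of_neg hq] at hstep
    exact ⟨relu_sub_le (by positivity) (by nlinarith), relu_sub_le (by positivity) (by nlinarith)⟩

lemma q_step_le (h : D.Regular s κ τ N) {i : Fin n}
    (hs : 2 * τ * D.meanGrad t ≤ D.grad t i / 20) (j : Bool) (r : Fin m) :
    D.q (t + 1) j r i ≤ D.q t j r i + 3 * (s * D.grad t i) := by
  have hg := grad_pos (D := D) t i
  have hsg := mul_pos h.s_pos hg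
  have hstep := (abs_le.1 (h.q_step t j r i)).2
  have h2 := mul_le_mul_of_nonneg_left hs h.s_pos.le
  have h3 : sgn j * sgn (D.y i) * D.grad t i * reluDeriv (D.q t j r i) * N i
      ≤ D.grad t i * 2 := by
    have hN : 0 ≤ N i := by linarith [h.N_ge i]
    calc sgn j * sgn (D.y i) * D.grad t i * reluDeriv (D.q t j r i) * N i
        ≤ |sgn j * sgn (D.y i) * D.grad t i * reluDeriv (D.q t j r i) * N i| := le_abs_self _
      _ = D.grad t i * reluDeriv (D.q t j r i) * N i := by
          rw [abs_mul, abs_mul, abs_mul, abs_mul, abs_sgn, abs_sgn, abs_of_pos hg,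
            abs_of_nonneg (reluDeriv_nonneg _), abs_of_nonneg hN]
          ring
      _ ≤ D.grad t i * 1 * 2 := by
          gcongr
          exacts [reluDeriv_le_one _, h.N_le i]
      _ = _ := by ring
  have h4 := mul_le_mul_of_nonneg_left h3 h.s_pos.le
  linarith

/-- In units of s g, a quarter of the own neurons gains 9/20 each while every opposite neuron takes
back at most 1/20, leaving 9/80 - 1/20 = 1/16. From above, each branch contributes at most 41/20. -/
lemma noiseMargin_step (h : D.Regular s κ τ N) {i : Fin n}
    (hs : 2 * τ * D.meanGrad t ≤ D.grad t i / 20)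
    (hact : ∀ r, 0 ≤ D.q 0 (D.y i) r i → 0 ≤ D.q t (D.y i) r i) :
    D.noiseMargin t i + s * D.grad t i / 16 ≤ D.noiseMargin (t + 1) i ∧
      D.noiseMargin (t + 1) i ≤ D.noiseMargin t i + 5 * (s * D.grad t i) := by
  have hg := grad_pos (D := D) t i
  have hsg := mul_pos h.s_pos hg
  have hm : (0 : ℝ) < m := by exact_mod_cast h.m_pos
  have hdiff : D.noiseMargin (t + 1) i - D.noiseMargin t i = (1 / (m : ℝ)) * ∑ r,
      ((relu (D.q (t + 1) (D.y i) r i) - relu (D.q t (D.y i) r i))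
        - (relu (D.q (t + 1) (!D.y i) r i) - relu (D.q t (!D.y i) r i))) := by
    unfold noiseMargin
    rw [← mul_sub, ← Finset.sum_sub_distrib]
    congr 1
    exact Finset.sum_congr rfl fun r _ => by ring
  have hlow : ∑ r, ((if 0 ≤ D.q 0 (D.y i) r i then s * D.grad t i * (9 / 20) else 0)
      - s * D.grad t i * (1 / 20)) ≤ ∑ r,
      ((relu (D.q (t + 1) (D.y i) r i) - relu (D.q t (D.y i) r i))
        - (relu (D.q (t + 1) (!D.y i) r i) - relu (D.q t (!D.y i) r i))) := by
    refine Finset.sum_le_sum fun r _ => ?_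
    have h1 := (h.own_step hs r).1
    have h2 := (h.other_step hs r).1
    have h3 : (if 0 ≤ D.q 0 (D.y i) r i then s * D.grad t i * (9 / 20) else 0)
        ≤ (if 0 ≤ D.q t (D.y i) r i then s * D.grad t i * (9 / 20) else 0) := by
      split_ifs with ha hb hb
      · exact le_rfl
      · exact absurd (hact r ha) hb
      · positivity
      · exact le_rfl
    linarith
  have hup : ∑ r, ((relu (D.q (t + 1) (D.y i) r i) - relu (D.q t (D.y i) r i))
        - (relu (D.q (t + 1) (!D.y i) r i) - relu (D.q t (!D.y i) r i)))
        ≤ ∑ _r : Fin m, 5 * (s * D.grad t i) := by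
    refine Finset.sum_le_sum fun r _ => ?_
    have h1 := (h.own_step hs r).2.1
    have h2 := (h.other_step hs r).2
    linarith
  rw [Finset.sum_sub_distrib, ← Finset.sum_filter, Finset.sum_const, Finset.sum_const,
    nsmul_eq_mul, nsmul_eq_mul, Finset.card_univ, Fintype.card_fin] at hlow
  rw [Finset.sum_const, nsmul_eq_mul, Finset.card_univ, Fintype.card_fin] at hup
  have hc := mul_le_mul_of_nonneg_right (h.active i)
    (show 0 ≤ s * D.grad t i * (9 / 20) by positivity)
  constructor
  · have : s * D.grad t i / 16 ≤ D.noiseMargin (t + 1) i - D.noiseMargin t i := by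
      rw [hdiff, one_div, le_inv_mul_iff₀ hm]
      linarith
    linarith
  · have : D.noiseMargin (t + 1) i - D.noiseMargin t i ≤ 5 * (s * D.grad t i) := by
      rw [hdiff, one_div, inv_mul_le_iff₀ hm]
      exact hup
    linarith

end NoiseStep

/-! #### One step of the signal correlations -/

section SignalStep

variable {t : ℕ}

/-- Whatever the sign of P, one entire class activates the neuron on the signal patch: class j if P
≥ 0, the opposite class if P < 0. Both push w in the direction j μ, since the label enters squared.
-/
lemma P_step_ge (h : D.Regular s κ τ N) (hκ : 0 ≤ κ) {c : ℝ} (hc0 : 0 ≤ c)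
    (hc : ∀ i, c ≤ D.grad t i) (j : Bool) (r : Fin m) :
    D.P t j r + s * (κ * (c / 4) - τ * D.meanGrad t) ≤ D.P (t + 1) j r := by
  have hstep := (abs_le.1 (h.P_step t j r)).1
  have key : c / 4 ≤ (1 / (n : ℝ)) *
      ∑ i, D.grad t i * reluDeriv (sgn (D.y i) * sgn j * D.P t j r) := by
    have aux : ∀ j', (∀ i, D.y i = j' → 0 ≤ sgn (D.y i) * sgn j * D.P t j r) → c / 4 ≤
        (1 / (n : ℝ)) * ∑ i, D.grad t i * reluDeriv (sgn (D.y i) * sgn j * D.P t j r) := by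
      intro j' hj'
      refine (h.le_classGrad (j := j') hc0 fun i _ => hc i).trans ?_
      refine mul_le_mul_of_nonneg_left (Finset.sum_le_sum fun i _ => ?_) (by positivity)
      split_ifs with hi
      · rw [reluDeriv_of_nonneg (hj' i hi), mul_one]
      · exact mul_nonneg (grad_pos t i).le (reluDeriv_nonneg _)
    rcases le_or_gt 0 (D.P t j r) with hP | hP
    · refine aux j fun i hi => ?_
      rw [hi, sgn_mul_self, one_mul]
      exact hP
    · refine aux (!j) fun i hi => ?_
      rw [hi, sgn_not, neg_mul, sgn_mul_self]
      linarith
  have := mul_le_mul_of_nonneg_left (mul_le_mul_of_nonneg_left key hκ) h.s_pos.le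
  linarith

lemma P_step_le (h : D.Regular s κ τ N) (hκ : 0 ≤ κ) (j : Bool) (r : Fin m) :
    D.P (t + 1) j r - D.P t j r ≤ s * ((κ + τ) * D.meanGrad t) := by
  have hstep := (abs_le.1 (h.P_step t j r)).2
  have key : (1 / (n : ℝ)) * ∑ i, D.grad t i * reluDeriv (sgn (D.y i) * sgn j * D.P t j r)
      ≤ D.meanGrad t := by
    refine mul_le_mul_of_nonneg_left (Finset.sum_le_sum fun i _ => ?_) (by positivity)
    exact mul_le_of_le_one_right (grad_pos t i).le (reluDeriv_le_one _)
  have := mul_le_mul_of_nonneg_left (mul_le_mul_of_nonneg_left key hκ) h.s_pos.le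
  linarith

/-- For P > 0 the neuron is silent on the signal patch of the opposite class, so the two classes
decouple. -/
lemma P_step_of_pos (h : D.Regular s κ τ N) {j : Bool} {r : Fin m} (hP : 0 < D.P t j r) :
    |D.P (t + 1) j r - D.P t j r - s * (κ * D.classGrad t j)| ≤ s * (τ * D.meanGrad t) := by
  have key : (1 / (n : ℝ)) * ∑ i, D.grad t i * reluDeriv (sgn (D.y i) * sgn j * D.P t j r)
      = D.classGrad t j := by
    unfold classGrad
    congr 1
    refine Finset.sum_congr rfl fun i _ => ?_
    split_ifs with hi
    · rw [hi, sgn_mul_self, one_mul, reluDeriv_of_nonneg hP.le, mul_one]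
    · rw [show D.y i = !j from Bool.eq_not.2 hi, sgn_not, neg_mul, sgn_mul_self,
        reluDeriv_of_neg (by linarith), mul_zero]
  rw [← key]
  exact h.P_step t j r

lemma signalMargin_sub (j : Bool) (t : ℕ) :
    D.signalMargin (t + 1) j - D.signalMargin t j = (1 / (m : ℝ)) * ∑ r,
      ((relu (D.P (t + 1) j r) - relu (D.P t j r))
        + (relu (-D.P t (!j) r) - relu (-D.P (t + 1) (!j) r))) := by
  unfold signalMargin
  rw [← mul_sub, ← Finset.sum_sub_distrib]
  congr 1
  exact Finset.sum_congr rfl fun r _ => by ring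

lemma signalMargin_mono {t : ℕ} (hP : ∀ j r, D.P t j r ≤ D.P (t + 1) j r) (j : Bool) :
    D.signalMargin t j ≤ D.signalMargin (t + 1) j := by
  rw [← sub_nonneg, signalMargin_sub]
  refine mul_nonneg (by positivity) (Finset.sum_nonneg fun r _ => ?_)
  exact add_nonneg (sub_nonneg.2 (relu_mono (hP j r)))
    (sub_nonneg.2 (relu_mono (neg_le_neg (hP (!j) r))))

/-- A crude bound without sign information: both branches may be driven by points of either class,
hence the factor 2 and the mean gradient. It is used only during the burn-in. -/
lemma signalMargin_step_le (h : D.Regular s κ τ N) (hκ : 0 ≤ κ) (j : Bool) :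
    D.signalMargin (t + 1) j ≤ D.signalMargin t j + 2 * (s * ((κ + τ) * D.meanGrad t)) := by
  have hm : (0 : ℝ) < m := by exact_mod_cast h.m_pos
  have h0 : 0 ≤ s * ((κ + τ) * D.meanGrad t) :=
    mul_nonneg h.s_pos.le (mul_nonneg (add_nonneg hκ h.τ_pos.le) (meanGrad_nonneg t))
  rw [← sub_le_iff_le_add', signalMargin_sub, one_div, inv_mul_le_iff₀ hm]
  have : ∑ r, ((relu (D.P (t + 1) j r) - relu (D.P t j r))
        + (relu (-D.P t (!j) r) - relu (-D.P (t + 1) (!j) r)))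
        ≤ ∑ _r : Fin m, 2 * (s * ((κ + τ) * D.meanGrad t)) := by
    refine Finset.sum_le_sum fun r _ => ?_
    have h1 := relu_sub_le h0 (h.P_step_le (t := t) hκ j r)
    have h2 := h.P_step_le (t := t) hκ (!j) r
    have h3 : relu (-D.P t (!j) r) - relu (-D.P (t + 1) (!j) r) ≤ s * ((κ + τ) * D.meanGrad t) :=
      relu_sub_le h0 (by linarith)
    linarith
  simpa using this

lemma signalMargin_of_pos (hP : ∀ j r, 0 < D.P t j r) (j : Bool) :
    D.signalMargin t j = (1 / (m : ℝ)) * ∑ r, D.P t j r := by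
  unfold signalMargin
  congr 1
  refine Finset.sum_congr rfl fun r _ => ?_
  rw [relu_of_nonneg (hP j r).le, relu_of_nonpos (by linarith [hP (!j) r]), sub_zero]

lemma signalMargin_step_le_of_pos (h : D.Regular s κ τ N) (hP : ∀ j r, 0 < D.P t j r)
    (hP' : ∀ j r, 0 < D.P (t + 1) j r) (j : Bool) :
    D.signalMargin (t + 1) j
      ≤ D.signalMargin t j + s * (κ * D.classGrad t j + τ * D.meanGrad t) := by
  have hm : (0 : ℝ) < m := by exact_mod_cast h.m_pos
  rw [signalMargin_of_pos hP, signalMargin_of_pos hP', ← sub_le_iff_le_add', ← mul_sub,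
    ← Finset.sum_sub_distrib, one_div, inv_mul_le_iff₀ hm]
  have : ∑ r, (D.P (t + 1) j r - D.P t j r)
      ≤ ∑ _r : Fin m, s * (κ * D.classGrad t j + τ * D.meanGrad t) := by
    refine Finset.sum_le_sum fun r _ => ?_
    have := (abs_le.1 (h.P_step_of_pos (hP j r))).2
    linarith
  simpa using this

end SignalStep

end Regular

/-! ### Bootstrapping two-sided bounds on the margins -/

variable {c₁ b : ℝ}

/-- The step size and the interactions are small compared with the bounds `c₁`, `b` on the signal
strength. -/
structure Small (c₁ b s κ τ : ℝ) : Prop where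
  c₁_pos : 0 < c₁
  κ_ge : c₁ ≤ κ
  κ_le : 400 * κ + 6 ≤ b
  τ_le : 2 * τ * (96 * b) ≤ 1 / 20
  τ_le' : 8 * τ * (96 * b) ≤ c₁
  burnIn_le : b * (48 * τ / c₁ + s) + 4 * τ ≤ 1 / 10

/-- A time after which all oriented signal correlations are positive. -/
def burnIn (s κ τ : ℝ) : ℕ := ⌈48 * τ / (κ * s)⌉₊

lemma Small.κ_pos (hs : Small c₁ b s κ τ) : 0 < κ := hs.c₁_pos.trans_le hs.κ_ge

lemma Small.b_ge (hs : Small c₁ b s κ τ) : 6 ≤ b := by linarith [hs.κ_pos, hs.κ_le]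

/-- During the burn-in P starts above -τ and rises by at least s κ / 24 per step; a rise of 2τ makes
it positive. -/
lemma Small.le_burnIn (hs : Small c₁ b s κ τ) (hs0 : 0 < s) :
    2 * τ ≤ s * κ / 24 * burnIn s κ τ := by
  have h1 : 48 * τ / (κ * s) ≤ burnIn s κ τ := Nat.le_ceil _
  rw [div_le_iff₀ (mul_pos hs.κ_pos hs0)] at h1
  linarith

/-- The burn-in is so short that even growth at the crude rate s b per step leaves all margins below
1/10. The extra s in `burnIn_le` pays for rounding up. -/
lemma Small.mul_burnIn_le (hs : Small c₁ b s κ τ) (hs0 : 0 < s) (hτ : 0 < τ) :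
    b * (s * burnIn s κ τ) + 4 * τ ≤ 1 / 10 := by
  have hκ := hs.κ_pos
  have h1 : (burnIn s κ τ : ℝ) < 48 * τ / (κ * s) + 1 := Nat.ceil_lt_add_one (by positivity)
  have h2 : s * burnIn s κ τ ≤ 48 * τ / c₁ + s := by
    calc s * burnIn s κ τ ≤ s * (48 * τ / (κ * s) + 1) := by gcongr
      _ = 48 * τ / κ + s := by field_simp
      _ ≤ 48 * τ / c₁ + s := by
          have := hs.c₁_pos
          have := hs.κ_ge
          gcongr
  have h3 := mul_le_mul_of_nonneg_left h2 (show 0 ≤ b by linarith [hs.b_ge])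
  linarith [hs.burnIn_le]

/-- The invariant of the training dynamics. -/
structure Invariant (D : Correlations n m) (b s κ τ : ℝ) (t : ℕ) : Prop where
  lower : ∀ i, 1 / 2 + s * t / 48 ≤ Real.exp (D.margin t i)
  upper : ∀ i, Real.exp (D.margin t i) ≤ 2 + 2 * s * b * t
  ratio : ∀ i k, D.y i = D.y k → Real.exp (D.margin t i) ≤ 400 * Real.exp (D.margin t k)
  active : ∀ i r, 0 ≤ D.q 0 (D.y i) r i → 0 ≤ D.q t (D.y i) r i
  early : t ≤ burnIn s κ τ → ∀ i, D.margin t i ≤ 4 * τ + s * b * t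
  signal : ∀ j r, -τ + s * κ / 24 * min (t : ℝ) (burnIn s κ τ) ≤ D.P t j r

namespace Invariant

variable {t : ℕ}

lemma exp_ge (hI : D.Invariant b s κ τ t) (hs0 : 0 < s) (i : Fin n) :
    1 / 2 ≤ Real.exp (D.margin t i) := by
  have := hI.lower i
  have : 0 ≤ s * t / 48 := by positivity
  linarith

/-- Here x / (1 + x) ≥ 1/3 for x ≥ 1/2. This turns margin growth proportional to g into linear
growth of exp(margin). -/
lemma exp_mul_grad_ge (hI : D.Invariant b s κ τ t) (hs0 : 0 < s) (i : Fin n) :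
    1 / 3 ≤ Real.exp (D.margin t i) * D.grad t i := by
  have h1 := hI.exp_ge hs0 i
  unfold grad
  rw [mul_one_div, le_div_iff₀ (by positivity)]
  linarith

/-- The linear bounds on exp(margin) have slopes 2 s b and s / 48, whose ratio is 96 b. Hence
gradient weights are comparable even across classes, uniformly in time. -/
lemma meanGrad_le_mul (hI : D.Invariant b s κ τ t) (h : D.Regular s κ τ N)
    (hs : Small c₁ b s κ τ) (i : Fin n) : D.meanGrad t ≤ 96 * b * D.grad t i := by
  refine meanGrad_le h.n_pos fun k => ?_
  have hb := hs.b_ge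
  have h1 := hI.lower k
  have h2 := hI.upper i
  unfold grad
  rw [mul_one_div, div_le_div_iff₀ (by positivity) (by positivity)]
  have h3 : 0 ≤ b * (Real.exp (D.margin t k) - (1 / 2 + s * t / 48)) :=
    mul_nonneg (by linarith) (by linarith)
  linarith

lemma grad_le_mul (hI : D.Invariant b s κ τ t) {i k : Fin n} (hik : D.y i = D.y k) :
    D.grad t i ≤ 400 * D.grad t k := by
  have h1 := hI.ratio k i hik.symm
  unfold grad
  rw [mul_one_div, div_le_div_iff₀ (by positivity) (by positivity)]
  linarith

lemma interaction_le (hI : D.Invariant b s κ τ t) (h : D.Regular s κ τ N)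
    (hs : Small c₁ b s κ τ) (i : Fin n) : 2 * τ * D.meanGrad t ≤ D.grad t i / 20 :=
  h.interaction_le hs.τ_le (hI.meanGrad_le_mul h hs i)

/-- Every gradient weight is at least the mean divided by 96 b, so the upward drift of P beats the
interactions. -/
lemma P_step_mono (hI : D.Invariant b s κ τ t) (h : D.Regular s κ τ N)
    (hs : Small c₁ b s κ τ) (j : Bool) (r : Fin m) : D.P t j r ≤ D.P (t + 1) j r := by
  have hb := hs.b_ge
  have hκ := hs.κ_pos
  have hM := meanGrad_nonneg (D := D) t
  have h1 := h.P_step_ge (t := t) hκ.le (c := D.meanGrad t / (96 * b)) (by positivity)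
    (fun i => by
      rw [div_le_iff₀ (by positivity), mul_comm]
      exact hI.meanGrad_le_mul h hs i) j r
  have h2 : τ * D.meanGrad t ≤ κ * (D.meanGrad t / (96 * b) / 4) := by
    have h3 : τ ≤ κ / (96 * b * 4) := by
      rw [le_div_iff₀ (by positivity)]
      nlinarith [hs.τ_le', hs.κ_ge, h.τ_pos]
    calc τ * D.meanGrad t ≤ κ / (96 * b * 4) * D.meanGrad t := by gcongr
      _ = _ := by field_simp
  have h3 := mul_nonneg h.s_pos.le (sub_nonneg.2 h2)
  linarith

/-- The interactions are dominated by the contribution of either class. -/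
lemma interaction_le_classGrad (hI : D.Invariant b s κ τ t) (h : D.Regular s κ τ N)
    (hs : Small c₁ b s κ τ) (j : Bool) : τ * D.meanGrad t ≤ κ / 2 * D.classGrad t j := by
  have hb := hs.b_ge
  have hκ := hs.κ_pos
  have hM := meanGrad_nonneg (D := D) t
  have h1 := h.le_classGrad (t := t) (j := j) (c := D.meanGrad t / (96 * b)) (by positivity)
    (fun i _ => by
      rw [div_le_iff₀ (by positivity), mul_comm]
      exact hI.meanGrad_le_mul h hs i)
  have h3 : τ ≤ κ / 2 / (96 * b * 4) := by
    rw [le_div_iff₀ (by positivity)]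
    linarith [hs.τ_le', hs.κ_ge]
  calc τ * D.meanGrad t ≤ κ / 2 / (96 * b * 4) * D.meanGrad t := by gcongr
    _ = κ / 2 * (D.meanGrad t / (96 * b) / 4) := by field_simp
    _ ≤ _ := by gcongr

lemma P_pos (hI : D.Invariant b s κ τ t) (h : D.Regular s κ τ N) (hs : Small c₁ b s κ τ)
    (ht : burnIn s κ τ ≤ t) (j : Bool) (r : Fin m) : 0 < D.P t j r := by
  have h1 := hI.signal j r
  rw [min_eq_right (by exact_mod_cast ht)] at h1
  linarith [hs.le_burnIn h.s_pos, h.τ_pos]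

lemma margin_step_ge (hI : D.Invariant b s κ τ t) (h : D.Regular s κ τ N)
    (hs : Small c₁ b s κ τ) (i : Fin n) :
    D.margin t i + s * D.grad t i / 16 ≤ D.margin (t + 1) i := by
  have h1 := (h.noiseMargin_step (hI.interaction_le h hs i) (hI.active i)).1
  have h2 := Regular.signalMargin_mono (hI.P_step_mono h hs) (D.y i)
  unfold margin
  linarith

/-- One step multiplies exp(margin) by at least 1 + s g / 16, and exp(margin) g ≥ 1/3. -/
lemma exp_step_ge (hI : D.Invariant b s κ τ t) (h : D.Regular s κ τ N)
    (hs : Small c₁ b s κ τ) (i : Fin n) :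
    Real.exp (D.margin t i) + s / 48 ≤ Real.exp (D.margin (t + 1) i) := by
  have h1 := Real.exp_le_exp.2 (hI.margin_step_ge h hs i)
  rw [Real.exp_add] at h1
  have h2 := Real.add_one_le_exp (s * D.grad t i / 16)
  have h3 := mul_le_mul_of_nonneg_left h2 (Real.exp_pos (D.margin t i)).le
  have h4 := mul_le_mul_of_nonneg_left (hI.exp_mul_grad_ge h.s_pos i) h.s_pos.le
  linarith

/-- Growth of the margins during the burn-in. -/
lemma margin_step_le_early (hI : D.Invariant b s κ τ t) (h : D.Regular s κ τ N)
    (hs : Small c₁ b s κ τ) (i : Fin n) : D.margin (t + 1) i ≤ D.margin t i + s * b := by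
  have h1 := (h.noiseMargin_step (hI.interaction_le h hs i) (hI.active i)).2
  have h2 := h.signalMargin_step_le (t := t) hs.κ_pos.le (D.y i)
  have h3 : (κ + τ) * D.meanGrad t ≤ (κ + τ) * 1 :=
    mul_le_mul_of_nonneg_left (meanGrad_le_one h.n_pos t) (by linarith [hs.κ_pos, h.τ_pos])
  have hτ : τ ≤ 1 / 40 := by nlinarith [hs.τ_le, hs.b_ge, h.τ_pos]
  have h4 : 2 * ((κ + τ) * D.meanGrad t) + 5 * D.grad t i ≤ b := by
    linarith [grad_le_one (D := D) t i, hs.κ_le, hs.κ_pos]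
  have h5 := mul_le_mul_of_nonneg_left h4 h.s_pos.le
  unfold margin
  linarith

/-- Growth of the margins after the burn-in. -/
lemma margin_step_le_late (hI : D.Invariant b s κ τ t) (h : D.Regular s κ τ N)
    (hs : Small c₁ b s κ τ) (ht : burnIn s κ τ ≤ t) (i : Fin n) :
    D.margin (t + 1) i ≤ D.margin t i + s * b * D.grad t i := by
  have h1 := (h.noiseMargin_step (hI.interaction_le h hs i) (hI.active i)).2
  have hP := hI.P_pos h hs ht
  have h2 := h.signalMargin_step_le_of_pos hP
    (fun j r => (hP j r).trans_le (hI.P_step_mono h hs j r)) (D.y i)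
  have h3 := h.classGrad_le (t := t) (j := D.y i) (c := 400 * D.grad t i)
    (mul_nonneg (by norm_num) (grad_pos t i).le) (fun k hk => hI.grad_le_mul hk)
  have h4 := mul_le_mul_of_nonneg_left h3 hs.κ_pos.le
  have h5 := hI.interaction_le h hs i
  have h6 := mul_le_mul_of_nonneg_right hs.κ_le (grad_pos (D := D) t i).le
  have h7 : κ * D.classGrad t (D.y i) + τ * D.meanGrad t + 5 * D.grad t i ≤ b * D.grad t i := by
    linarith [grad_pos (D := D) t i]
  have h8 := mul_le_mul_of_nonneg_left h7 h.s_pos.le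
  unfold margin
  linarith

/-- Points of one class share their signal margin, so only noise margins can separate them. If the
ratio is at most 240, one step multiplies it by at most 6/5. If it exceeds 240, the point k that
lags behind has a gradient weight at least 80 times larger, so its guaranteed gain g_k / 16 is at
least the largest gain 5 g_i of the other, and the ratio does not grow. -/
lemma ratio_step (hI : D.Invariant b s κ τ t) (h : D.Regular s κ τ N)
    (hs : Small c₁ b s κ τ) {i k : Fin n} (hik : D.y i = D.y k) :
    Real.exp (D.margin (t + 1) i) ≤ 400 * Real.exp (D.margin (t + 1) k) := by
  have hi := (h.noiseMargin_step (hI.interaction_le h hs i) (hI.active i)).2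
  have hk := (h.noiseMargin_step (hI.interaction_le h hs k) (hI.active k)).1
  have hstep : D.margin (t + 1) i - D.margin (t + 1) k
      ≤ D.margin t i - D.margin t k + s * (5 * D.grad t i - D.grad t k / 16) := by
    unfold margin
    rw [hik]
    linarith
  have hexp : Real.exp (D.margin (t + 1) i) ≤ Real.exp (D.margin (t + 1) k) *
      (Real.exp (D.margin t i) / Real.exp (D.margin t k)
        * Real.exp (s * (5 * D.grad t i - D.grad t k / 16))) := by
    rw [← Real.exp_sub, ← Real.exp_add, ← Real.exp_add]
    exact Real.exp_le_exp.2 (by linarith)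
  have hEk := Real.exp_pos (D.margin t k)
  have hEi := Real.exp_pos (D.margin t i)
  have hEk' := Real.exp_pos (D.margin (t + 1) k)
  rcases le_or_gt (Real.exp (D.margin t i)) (240 * Real.exp (D.margin t k)) with hc | hc
  · have h1 : Real.exp (D.margin t i) / Real.exp (D.margin t k) ≤ 240 := by
      rwa [div_le_iff₀ hEk]
    have hsb : s ≤ 1 / 60 := by
      have := hs.burnIn_le
      have hb := hs.b_ge
      have h0 : 0 ≤ 48 * τ / c₁ := div_nonneg (by linarith [h.τ_pos]) hs.c₁_pos.le
      nlinarith [h.s_pos, h.τ_pos]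
    have h2 : Real.exp (s * (5 * D.grad t i - D.grad t k / 16)) ≤ 1 + 2 * (1 / 10) := by
      refine le_trans (Real.exp_le_exp.2 ?_) (exp_le_one_add_two_mul (by norm_num) (by norm_num))
      have := mul_le_mul_of_nonneg_left (grad_le_one (D := D) t i) h.s_pos.le
      have := mul_pos h.s_pos (grad_pos (D := D) t k)
      linarith
    calc _ ≤ _ := hexp
      _ ≤ Real.exp (D.margin (t + 1) k) * (240 * (1 + 2 * (1 / 10))) := by gcongr
      _ ≤ _ := by linarith
  · have h1 : Real.exp (D.margin t i) / Real.exp (D.margin t k) ≤ 400 := by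
      rw [div_le_iff₀ hEk]
      exact hI.ratio i k hik
    -- With exp(margin) ≥ 1/2 at k, the number 240 exp(margin) is at least 80 (1 + exp(margin)).
    have h2 : 80 * D.grad t i ≤ D.grad t k := by
      have := hI.exp_ge h.s_pos k
      unfold grad
      rw [mul_one_div, div_le_div_iff₀ (by positivity) (by positivity)]
      linarith
    have h3 : Real.exp (s * (5 * D.grad t i - D.grad t k / 16)) ≤ 1 :=
      Real.exp_le_one_iff.2 (mul_nonpos_of_nonneg_of_nonpos h.s_pos.le (by linarith))
    calc _ ≤ _ := hexp
      _ ≤ Real.exp (D.margin (t + 1) k) * (400 * 1) := by gcongr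
      _ = _ := by ring

/-- Up to the end of the burn-in the crude rate keeps exp(margin) ≤ 6/5, so all gradient weights are
at least 1/3 and drive P upward. Afterwards a step multiplies exp(margin) by at most 1 + 2 s b g,
and exp(margin) g ≤ 1 makes the upper bound linear. -/
lemma step (hI : D.Invariant b s κ τ t) (h : D.Regular s κ τ N) (hs : Small c₁ b s κ τ) :
    D.Invariant b s κ τ (t + 1) := by
  have hb := hs.b_ge
  have hs0 := h.s_pos
  have hκ := hs.κ_pos
  have hτ := h.τ_pos
  have hbi := hs.mul_burnIn_le hs0 hτ
  have hearly : t + 1 ≤ burnIn s κ τ → ∀ i, D.margin (t + 1) i ≤ 4 * τ + s * b * (t + 1 : ℕ) := by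
    intro ht i
    have h1 := hI.early (by omega) i
    have h2 := hI.margin_step_le_early h hs i
    push_cast
    linarith
  refine ⟨fun i => ?_, fun i => ?_, fun i k => hI.ratio_step h hs, fun i r hr => ?_, hearly,
    fun j r => ?_⟩
  · have := hI.exp_step_ge h hs i
    have := hI.lower i
    push_cast
    linarith
  · rcases lt_or_ge t (burnIn s κ τ) with ht | ht
    · have h1 := hearly ht i
      have h2 : ((t + 1 : ℕ) : ℝ) ≤ burnIn s κ τ := by exact_mod_cast ht
      have h3 := mul_le_mul_of_nonneg_left h2 (show 0 ≤ s * b by positivity)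
      have h4 : Real.exp (D.margin (t + 1) i) ≤ 1 + 2 * (1 / 10) :=
        le_trans (Real.exp_le_exp.2 (by linarith))
          (exp_le_one_add_two_mul (by norm_num) (by norm_num))
      have h5 : 0 ≤ 2 * s * b * (t + 1 : ℕ) := by positivity
      linarith
    · have h1 := Real.exp_le_exp.2 (hI.margin_step_le_late h hs ht i)
      have hg := grad_pos (D := D) t i
      have hsb : s * b ≤ 1 := by
        have := hs.burnIn_le
        have h0 : 0 ≤ b * (48 * τ / c₁) :=
          mul_nonneg (by linarith) (div_nonneg (by linarith) hs.c₁_pos.le)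
        linarith
      have h2 := exp_le_one_add_two_mul (x := s * b * D.grad t i) (by positivity)
        (mul_le_one₀ hsb hg.le (grad_le_one t i))
      have h3 : Real.exp (D.margin t i) * D.grad t i ≤ 1 := by
        unfold grad
        rw [mul_one_div, div_le_one (by positivity)]
        linarith
      rw [Real.exp_add] at h1
      have h4 := mul_le_mul_of_nonneg_left h2 (Real.exp_pos (D.margin t i)).le
      have h5 := mul_le_mul_of_nonneg_left h3 (show 0 ≤ 2 * s * b by positivity)
      have h6 := hI.upper i
      push_cast
      linarith
  · exact (h.own_step (hI.interaction_le h hs i) r).2.2 (hI.active i r hr)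
  · rcases lt_or_ge t (burnIn s κ τ) with ht | ht
    · have h0 := hI.signal j r
      have ht' : ((t : ℝ) + 1) ≤ burnIn s κ τ := by exact_mod_cast ht
      rw [min_eq_left (by linarith)] at h0
      push_cast
      rw [min_eq_left ht']
      have h1 : ∀ i, (1 : ℝ) / 3 ≤ D.grad t i := by
        intro i
        have h2 := hI.early ht.le i
        have h3 := mul_le_mul_of_nonneg_left (show (t : ℝ) ≤ burnIn s κ τ by linarith)
          (show 0 ≤ s * b by positivity)
        have h4 : Real.exp (D.margin t i) ≤ 1 + 2 * (1 / 10) :=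
          le_trans (Real.exp_le_exp.2 (by linarith))
            (exp_le_one_add_two_mul (by norm_num) (by norm_num))
        unfold grad
        rw [div_le_div_iff₀ (by norm_num) (by positivity)]
        linarith
      have h5 := h.P_step_ge hκ.le (by norm_num) h1 j r
      -- Gradient weights of at least 1/3 give a drift of κ / 12, of which interactions take at most
      -- half.
      have h6 : τ * D.meanGrad t ≤ κ / 24 := by
        have h7 : τ ≤ κ / 24 := by nlinarith [hs.τ_le', hs.κ_ge]
        calc τ * D.meanGrad t ≤ τ * 1 := by
              gcongr
              exact meanGrad_le_one h.n_pos t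
          _ ≤ _ := by linarith
      have h8 := mul_le_mul_of_nonneg_left h6 hs0.le
      linarith
    · have h0 := hI.signal j r
      rw [min_eq_right (by exact_mod_cast ht)] at h0
      rw [min_eq_right (by exact_mod_cast ht.trans t.le_succ)]
      exact h0.trans (hI.P_step_mono h hs j r)

end Invariant

/-! ### The invariant at initialization and at all times -/

lemma abs_mean_le {m : ℕ} (hm : 0 < m) {x : Fin m → ℝ} {c : ℝ} (hx : ∀ r, |x r| ≤ c) :
    |(1 / (m : ℝ)) * ∑ r, x r| ≤ c := by
  have hm' : (0 : ℝ) < m := by exact_mod_cast hm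
  rw [abs_mul, abs_of_pos (by positivity), one_div, inv_mul_le_iff₀ hm']
  refine (Finset.abs_sum_le_sum_abs _ _).trans ?_
  simpa using Finset.sum_le_sum (s := Finset.univ) fun r _ => hx r

lemma abs_relu_sub_relu_le {a a' c : ℝ} (ha : |a| ≤ c) (ha' : |a'| ≤ c) :
    |relu a - relu a'| ≤ 2 * c := by
  have h1 := relu_le_abs a
  have h2 := relu_le_abs a'
  have h3 := relu_nonneg a
  have h4 := relu_nonneg a'
  rw [abs_le]
  constructor <;> linarith

namespace Regular

lemma abs_signalMargin_zero (h : D.Regular s κ τ N) (j : Bool) :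
    |D.signalMargin 0 j| ≤ 2 * τ :=
  abs_mean_le h.m_pos fun r => abs_relu_sub_relu_le (h.P_init j r)
    (by rw [abs_neg]; exact h.P_init _ r)

lemma abs_noiseMargin_zero (h : D.Regular s κ τ N) (i : Fin n) :
    |D.noiseMargin 0 i| ≤ 2 * τ :=
  abs_mean_le h.m_pos fun r => abs_relu_sub_relu_le (h.q_init _ r i) (h.q_init _ r i)

theorem invariant (h : D.Regular s κ τ N) (hs : Small c₁ b s κ τ) (t : ℕ) :
    D.Invariant b s κ τ t := by
  induction t with
  | succ t ih => exact ih.step h hs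
  | zero =>
    have hb := hs.b_ge
    have hτ := h.τ_pos
    have hτ' : 4 * τ ≤ 1 / 10 := by
      have h0 : 0 ≤ b * (48 * τ / c₁ + s) :=
        mul_nonneg (by linarith)
          (add_nonneg (div_nonneg (by linarith) hs.c₁_pos.le) h.s_pos.le)
      linarith [hs.burnIn_le]
    have hm : ∀ i, |D.margin 0 i| ≤ 4 * τ := fun i => by
      have h1 := h.abs_signalMargin_zero (D.y i)
      have h2 := h.abs_noiseMargin_zero i
      exact (abs_add_le _ _).trans (by linarith)
    have hup : ∀ i, Real.exp (D.margin 0 i) ≤ 1 + 2 * (1 / 10) := fun i =>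
      le_trans (Real.exp_le_exp.2 ((le_abs_self _).trans ((hm i).trans hτ')))
        (exp_le_one_add_two_mul (by norm_num) (by norm_num))
    have hlow : ∀ i, 9 / 10 ≤ Real.exp (D.margin 0 i) := fun i => by
      have := Real.add_one_le_exp (D.margin 0 i)
      have := (abs_le.1 (hm i)).1
      linarith
    refine ⟨fun i => ?_, fun i => ?_, fun i k _ => ?_, fun i r hr => hr, fun _ i => ?_,
      fun j r => ?_⟩
    · simpa using (show (1 : ℝ) / 2 ≤ 9 / 10 by norm_num).trans (hlow i)
    · simpa using (hup i).trans (by norm_num)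
    · linarith [hup i, hlow k]
    · simpa using (le_abs_self _).trans (hm i)
    · simpa using (abs_le.1 (h.P_init j r)).1

end Regular

/-! #### Accumulated gradients -/

/-- The accumulated gradient weight of a training point. -/
def accGrad (D : Correlations n m) (s : ℝ) (t : ℕ) (i : Fin n) : ℝ :=
  ∑ u ∈ Finset.range t, s * D.grad u i

/-- The accumulated gradient weight of a class. -/
def accClassGrad (D : Correlations n m) (s : ℝ) (t : ℕ) (j : Bool) : ℝ :=
  ∑ u ∈ Finset.range t, s * D.classGrad u j

lemma accGrad_succ (t : ℕ) (i : Fin n) :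
    D.accGrad s (t + 1) i = D.accGrad s t i + s * D.grad t i := Finset.sum_range_succ _ _

lemma accClassGrad_succ (t : ℕ) (j : Bool) :
    D.accClassGrad s (t + 1) j = D.accClassGrad s t j + s * D.classGrad t j :=
  Finset.sum_range_succ _ _

namespace Regular

lemma q_le_accGrad (h : D.Regular s κ τ N) (hs : Small c₁ b s κ τ) (t : ℕ) (j : Bool) (r : Fin m)
    (i : Fin n) : D.q t j r i ≤ τ + 3 * D.accGrad s t i := by
  induction t with
  | zero => simpa [accGrad] using (abs_le.1 (h.q_init j r i)).2
  | succ t ih =>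
    have := h.q_step_le ((h.invariant hs t).interaction_le h hs i) j r
    rw [accGrad_succ]
    linarith

/-- Within a class gradient weights agree up to 400, and the class holds a quarter of the points:
1600 = 4 · 400. Memorization of one point is thus controlled by what drives the signal. -/
lemma accGrad_le (h : D.Regular s κ τ N) (hs : Small c₁ b s κ τ) (t : ℕ) (i : Fin n) :
    D.accGrad s t i ≤ 1600 * D.accClassGrad s t (D.y i) := by
  unfold accGrad accClassGrad
  rw [Finset.mul_sum]
  refine Finset.sum_le_sum fun u _ => ?_
  have h1 := h.le_classGrad (t := u) (j := D.y i) (c := D.grad u i / 400)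
    (div_nonneg (grad_pos u i).le (by norm_num)) (fun k hk => by
      have := (h.invariant hs u).grad_le_mul hk.symm
      linarith)
  have := mul_le_mul_of_nonneg_left h1 h.s_pos.le
  linarith

lemma noiseMargin_le_accGrad (h : D.Regular s κ τ N) (hs : Small c₁ b s κ τ) (t : ℕ)
    (i : Fin n) : D.noiseMargin t i ≤ 2 * τ + 5 * D.accGrad s t i := by
  induction t with
  | zero => simpa [accGrad] using (abs_le.1 (h.abs_noiseMargin_zero i)).2
  | succ t ih =>
    have hI := h.invariant hs t
    have := (h.noiseMargin_step (hI.interaction_le h hs i) (hI.active i)).2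
    rw [accGrad_succ]
    linarith

lemma noiseMargin_ge (h : D.Regular s κ τ N) (hs : Small c₁ b s κ τ) (t : ℕ)
    (i : Fin n) : -(2 * τ) ≤ D.noiseMargin t i := by
  induction t with
  | zero => exact (abs_le.1 (h.abs_noiseMargin_zero i)).1
  | succ t ih =>
    have hI := h.invariant hs t
    have := (h.noiseMargin_step (hI.interaction_le h hs i) (hI.active i)).1
    have := mul_pos h.s_pos (grad_pos (D := D) t i)
    linarith

/-- The burn-in is charged at the crude rate b; afterwards the interactions are at most half of the
drift, hence 3/2. -/
lemma signalMargin_le (h : D.Regular s κ τ N) (hs : Small c₁ b s κ τ) (t : ℕ) (j : Bool) :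
    D.signalMargin t j
      ≤ 2 * τ + b * (s * min (t : ℝ) (burnIn s κ τ)) + 3 / 2 * κ * D.accClassGrad s t j := by
  induction t with
  | zero => simpa [accClassGrad] using (abs_le.1 (h.abs_signalMargin_zero j)).2
  | succ t ih =>
    have hI := h.invariant hs t
    have hcg := mul_nonneg h.s_pos.le (classGrad_nonneg (D := D) t j)
    have hκ := hs.κ_pos
    rw [accClassGrad_succ]
    rcases lt_or_ge t (burnIn s κ τ) with ht | ht
    · have ht' : ((t : ℝ) + 1) ≤ burnIn s κ τ := by exact_mod_cast ht
      rw [min_eq_left (by linarith)] at ih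
      push_cast
      rw [min_eq_left ht']
      have h2 := h.signalMargin_step_le (t := t) hs.κ_pos.le j
      have h3 : (κ + τ) * D.meanGrad t ≤ (κ + τ) * 1 :=
        mul_le_mul_of_nonneg_left (meanGrad_le_one h.n_pos t) (by linarith [h.τ_pos])
      have hτ : τ ≤ 1 / 40 := by nlinarith [hs.τ_le, hs.b_ge, h.τ_pos]
      have h4 : 2 * ((κ + τ) * D.meanGrad t) ≤ b := by linarith [hs.κ_le]
      have h5 := mul_le_mul_of_nonneg_left h4 h.s_pos.le
      have h6 := mul_nonneg hκ.le hcg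
      linarith
    · rw [min_eq_right (by exact_mod_cast ht)] at ih
      rw [min_eq_right (by exact_mod_cast ht.trans t.le_succ)]
      have hP := hI.P_pos h hs ht
      have h2 := h.signalMargin_step_le_of_pos hP
        (fun j r => (hP j r).trans_le (hI.P_step_mono h hs j r)) j
      have h3 := mul_le_mul_of_nonneg_left (hI.interaction_le_classGrad h hs j) h.s_pos.le
      linarith

/-- After the burn-in at least half of the drift survives the interactions. During it only
monotonicity of P is used, and the subtracted time cancels the class gradient, which is at most 1.
-/
lemma P_ge (h : D.Regular s κ τ N) (hs : Small c₁ b s κ τ) (t : ℕ) (j : Bool) (r : Fin m) :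
    -τ + κ / 2 * (D.accClassGrad s t j - s * min (t : ℝ) (burnIn s κ τ)) ≤ D.P t j r := by
  induction t with
  | zero => simpa [accClassGrad] using (abs_le.1 (h.P_init j r)).1
  | succ t ih =>
    have hI := h.invariant hs t
    have hκ := hs.κ_pos
    rw [accClassGrad_succ]
    rcases lt_or_ge t (burnIn s κ τ) with ht | ht
    · have ht' : ((t : ℝ) + 1) ≤ burnIn s κ τ := by exact_mod_cast ht
      rw [min_eq_left (by linarith)] at ih
      push_cast
      rw [min_eq_left ht']
      have h1 := hI.P_step_mono h hs j r
      have h2 := mul_le_mul_of_nonneg_left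
        ((classGrad_le_meanGrad (D := D) t j).trans (meanGrad_le_one h.n_pos t)) h.s_pos.le
      have h3 := mul_le_mul_of_nonneg_left h2 (show 0 ≤ κ / 2 by positivity)
      linarith
    · rw [min_eq_right (by exact_mod_cast ht)] at ih
      rw [min_eq_right (by exact_mod_cast ht.trans t.le_succ)]
      have h2 := (abs_le.1 (h.P_step_of_pos (hI.P_pos h hs ht j r))).1
      have h3 := mul_le_mul_of_nonneg_left (hI.interaction_le_classGrad h hs j) h.s_pos.le
      linarith

/-- For a strong signal, at a late time the signal correlations dominate the memorized noise. -/
theorem late_bounds (h : D.Regular s κ τ N) (hs : Small c₁ b s κ τ) (hκ : 16000 ≤ κ) {t : ℕ}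
    (hX : 2 * b + 2 ≤ s * t) (hL : 40 ≤ Real.log (s * t)) :
    (∀ j r, Real.log (s * t) / 8 ≤ D.P t j r) ∧
      ∀ i, D.accGrad s t i ≤ 10000 * Real.log (s * t) / κ := by
  have hb := hs.b_ge
  have hτ := h.τ_pos
  have hκ0 : 0 < κ := by linarith
  have hI := h.invariant hs t
  have hX0 : 0 < s * t := by linarith
  have hbi := hs.mul_burnIn_le h.s_pos hτ
  have hbi0 : 0 ≤ s * (burnIn s κ τ : ℝ) := mul_nonneg h.s_pos.le (Nat.cast_nonneg _)
  have hmin : min (t : ℝ) (burnIn s κ τ) ≤ burnIn s κ τ := min_le_right _ _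
  have hsmin := mul_le_mul_of_nonneg_left hmin h.s_pos.le
  have hτ1 : τ ≤ 1 / 40 := by nlinarith [mul_nonneg (by linarith : 0 ≤ b) hbi0]
  have hκb : κ / 2 * (s * burnIn s κ τ) ≤ 1 / 10 := by nlinarith [hs.κ_le]
  have hbi' := mul_le_mul_of_nonneg_left hsmin (show 0 ≤ b by linarith)
  have hκmin := mul_le_mul_of_nonneg_left hsmin (show 0 ≤ κ / 2 by linarith)
  have hP1 : ∀ j r, κ / 2 * D.accClassGrad s t j - 1 / 5 ≤ D.P t j r := fun j r => by
    linarith [h.P_ge hs t j r]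
  have hlogE : ∀ i, Real.log (s * t) - 4 ≤ D.margin t i := fun i => by
    have h1 := hI.lower i
    have h2 : s * t / 48 ≤ Real.exp (D.margin t i) := by linarith
    have h3 := Real.log_le_log (by positivity) h2
    rw [Real.log_exp, Real.log_div hX0.ne' (by norm_num)] at h3
    have h4 : Real.log 48 ≤ 4 := by
      rw [Real.log_le_iff_le_exp (by norm_num)]
      have h27 : (2.7 : ℝ) ≤ Real.exp 1 := by linarith [Real.exp_one_gt_d9]
      calc (48 : ℝ) ≤ 2.7 ^ 4 := by norm_num
        _ ≤ Real.exp 1 ^ 4 := by gcongr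
        _ = Real.exp 4 := by rw [← Real.exp_nat_mul]; norm_num
    linarith
  have hlogE' : ∀ i, D.margin t i ≤ 2 * Real.log (s * t) := fun i => by
    have h1 := hI.upper i
    -- By `hX`, (s t)² ≥ (2b + 2) s t ≥ 2 + 2 b s t.
    have h2 : Real.exp (D.margin t i) ≤ (s * t) ^ 2 := by nlinarith
    have h3 := Real.log_le_log (Real.exp_pos _) h2
    rwa [Real.log_exp, Real.log_pow] at h3
  have hcl : ∀ j, ∃ i, D.y i = j := fun j => by
    have h1 := h.class_ge j
    have hn : (0 : ℝ) < n := by exact_mod_cast h.n_pos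
    have h2 : 0 < (Finset.univ.filter fun i => D.y i = j).card := by
      have : (0 : ℝ) < (Finset.univ.filter fun i => D.y i = j).card := by linarith
      exact_mod_cast this
    obtain ⟨i, hi⟩ := Finset.card_pos.1 h2
    exact ⟨i, (Finset.mem_filter.1 hi).2⟩
  have hG0 : ∀ j, 0 ≤ D.accClassGrad s t j := fun j =>
    Finset.sum_nonneg fun u _ => mul_nonneg h.s_pos.le (classGrad_nonneg u j)
  refine ⟨fun j r => ?_, fun i => ?_⟩
  -- Let G be the accumulated class gradient. The noise part of the margin is at most 5 · 1600 G ≤ κ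
  -- G / 2 up to a constant, so the whole margin is at most 2 κ G up to constants. As the margin is
  -- at least log(s t) - 4, the bound P ≥ κ G / 2 - 1/5 exceeds log(s t) / 8, the constants being
  -- absorbed by 40 ≤ log(s t).
  · obtain ⟨i, rfl⟩ := hcl j
    have h1 := h.signalMargin_le hs t (D.y i)
    have h2 := h.noiseMargin_le_accGrad hs t i
    have h3 := h.accGrad_le hs t i
    have h4 := hlogE i
    have h5 := hP1 (D.y i) r
    have h6 := mul_nonneg (sub_nonneg.2 hκ) (hG0 (D.y i))
    unfold margin at h4
    linarith
  -- Conversely the noise margin is almost nonnegative, so κ G / 2 is at most 2 log(s t) up to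
  -- constants; multiplying G by 1600 stays below 10000 log(s t) / κ.
  · have hge : burnIn s κ τ ≤ t := by
      have h1 : b * (s * burnIn s κ τ) ≤ b * (s * t) := by nlinarith
      have h2 := le_of_mul_le_mul_left h1 (by linarith)
      exact_mod_cast le_of_mul_le_mul_left h2 h.s_pos
    have hm : (0 : ℝ) < m := by exact_mod_cast h.m_pos
    have h1 : κ / 2 * D.accClassGrad s t (D.y i) - 1 / 5 ≤ D.signalMargin t (D.y i) := by
      rw [signalMargin_of_pos (hI.P_pos h hs hge), one_div (m : ℝ), le_inv_mul_iff₀ hm]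
      have := Finset.card_nsmul_le_sum Finset.univ _ _ fun r _ => hP1 (D.y i) r
      rwa [Finset.card_univ, Fintype.card_fin, nsmul_eq_mul] at this
    have h2 := h.noiseMargin_ge hs t i
    have h3 := h.accGrad_le hs t i
    have h4 := hlogE' i
    unfold margin at h4
    rw [le_div_iff₀ hκ0]
    have h5 := mul_le_mul_of_nonneg_right h3 hκ0.le
    linarith

end Regular

end Correlations

open Correlations

variable {d n m : ℕ}

/-! ### Gradient descent on typical data -/

/-- The correlations of the iterates of gradient descent with the signal and the noise patches. -/
def correlations (μ : Vec d) (η : ℝ) (y : Fin n → Bool) (ξ : Fin n → Vec d) (W₀ : Weights d m) :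
    Correlations n m where
  y := y
  P t j r := sgn j * inner ℝ (gd μ η y ξ W₀ t j r) μ
  q t j r i := inner ℝ (gd μ η y ξ W₀ t j r) (ξ i)

/-- Typical noise patches and initial weights. -/
structure Typical (μ : Vec d) (σ τ : ℝ) (ξ : Fin n → Vec d) (W₀ : Weights d m) : Prop where
  norm_ge : ∀ i, σ ^ 2 * d / 2 ≤ ‖ξ i‖ ^ 2
  norm_le : ∀ i, ‖ξ i‖ ^ 2 ≤ 2 * (σ ^ 2 * d)
  inner_noise : ∀ i k, i ≠ k → n * |inner ℝ (ξ i) (ξ k)| ≤ τ * (σ ^ 2 * d)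
  inner_signal : ∀ i, n * |inner ℝ μ (ξ i)| ≤ τ * (σ ^ 2 * d)
  init_noise : ∀ j r i, |inner ℝ (W₀ j r) (ξ i)| ≤ τ
  init_signal : ∀ j r, |inner ℝ (W₀ j r) μ| ≤ τ
  init_norm : ∀ j r, σ * ‖W₀ j r‖ ≤ τ * √((n : ℝ) / d)
  active : ∀ j i, (m : ℝ) / 4 ≤ (Finset.univ.filter fun r => 0 ≤ inner ℝ (W₀ j r) (ξ i)).card

section

variable {μ : Vec d} {η : ℝ} {y : Fin n → Bool} {ξ : Fin n → Vec d} {W₀ : Weights d m}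

lemma margin_correlations (t : ℕ) (i : Fin n) :
    (correlations μ η y ξ W₀).margin t i
      = sgn (y i) * network (gd μ η y ξ W₀ t) (dataPoint μ (y i) (ξ i)) := by
  unfold Correlations.margin signalMargin noiseMargin network branch dataPoint
  rw [← mul_add, ← Finset.sum_add_distrib, ← mul_sub, ← Finset.sum_sub_distrib, mul_left_comm,
    Finset.mul_sum (a := sgn (y i))]
  congr 1
  refine Finset.sum_congr rfl fun r _ => ?_
  simp only [correlations]
  cases hy : y i <;> simp [sgn] <;> ring

lemma lossDeriv_eq (t : ℕ) (i : Fin n) :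
    lossDeriv (network (gd μ η y ξ W₀ t) (dataPoint μ (y i) (ξ i))) (y i)
      = -(correlations μ η y ξ W₀).grad t i := by
  unfold lossDeriv Correlations.grad
  rw [margin_correlations, neg_div]

lemma gd_succ (t : ℕ) (j : Bool) (r : Fin m) :
    gd μ η y ξ W₀ (t + 1) j r = gd μ η y ξ W₀ t j r
      + (η / ((n : ℝ) * m)) • ∑ k, ((correlations μ η y ξ W₀).grad t k
          * reluDeriv ((correlations μ η y ξ W₀).q t j r k) * (sgn j * sgn (y k))) • ξ k
      + (η / ((n : ℝ) * m)) • (∑ k, (correlations μ η y ξ W₀).grad t k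
          * reluDeriv (sgn (y k) * sgn j * (correlations μ η y ξ W₀).P t j r) * sgn j) • μ := by
  conv_lhs => rw [gd]
  unfold gdStep
  simp only [lossDeriv_eq]
  rw [sub_eq_add_neg, sub_eq_add_neg, ← smul_neg, ← smul_neg, ← Finset.sum_neg_distrib,
    ← Finset.sum_neg_distrib, Finset.sum_smul]
  congr 2
  · congr 1
    refine Finset.sum_congr rfl fun k _ => ?_
    rw [← neg_smul]
    congr 1
    simp only [correlations]
    ring
  · refine Finset.sum_congr rfl fun k _ => ?_
    rw [← neg_smul]
    congr 1
    have h1 : inner ℝ (gd μ η y ξ W₀ t j r) (sgn (y k) • μ)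
        = sgn (y k) * sgn j * (correlations μ η y ξ W₀).P t j r := by
      simp only [correlations]
      rw [inner_smul_right, mul_assoc, ← mul_assoc (sgn j), sgn_mul_self, one_mul]
    rw [h1, mul_assoc (sgn j), sgn_mul_self]
    ring

lemma abs_sum_mul_le {ι : Type*} (S : Finset ι) {a x g : ι → ℝ} {c : ℝ}
    (ha : ∀ k ∈ S, |a k| ≤ g k) (hx : ∀ k ∈ S, |x k| ≤ c) :
    |∑ k ∈ S, a k * x k| ≤ (∑ k ∈ S, g k) * c := by
  refine (Finset.abs_sum_le_sum_abs _ _).trans ?_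
  rw [Finset.sum_mul]
  refine Finset.sum_le_sum fun k hk => ?_
  rw [abs_mul]
  exact mul_le_mul (ha k hk) (hx k hk) (abs_nonneg _) ((abs_nonneg _).trans (ha k hk))

lemma abs_noise_coeff_le (t : ℕ) (j : Bool) (r : Fin m) (k : Fin n) :
    |(correlations μ η y ξ W₀).grad t k
        * reluDeriv ((correlations μ η y ξ W₀).q t j r k) * (sgn j * sgn (y k))|
      ≤ (correlations μ η y ξ W₀).grad t k := by
  have hg := grad_pos (D := correlations μ η y ξ W₀) t k
  rw [abs_mul, abs_mul, abs_mul, abs_sgn, abs_sgn, mul_one, mul_one, abs_of_pos hg,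
    abs_of_nonneg (reluDeriv_nonneg _)]
  exact mul_le_of_le_one_right hg.le (reluDeriv_le_one _)

lemma abs_signal_coeff_le (t : ℕ) (j : Bool) (r : Fin m) (k : Fin n) :
    |(correlations μ η y ξ W₀).grad t k
        * reluDeriv (sgn (y k) * sgn j * (correlations μ η y ξ W₀).P t j r) * sgn j|
      ≤ (correlations μ η y ξ W₀).grad t k := by
  have hg := grad_pos (D := correlations μ η y ξ W₀) t k
  rw [abs_mul, abs_mul, abs_sgn, mul_one, abs_of_pos hg, abs_of_nonneg (reluDeriv_nonneg _)]
  exact mul_le_of_le_one_right hg.le (reluDeriv_le_one _)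

variable {σ τ : ℝ}

/-- On typical data the correlations follow the normalized dynamics. -/
theorem Typical.regular (h : Typical μ σ τ ξ W₀) (hn : 0 < n) (hm : 0 < m) (hd : 0 < d)
    (hσ : 0 < σ) (hη : 0 < η) (hτ : 0 < τ)
    (hy : ∀ j, (n : ℝ) / 4 ≤ (Finset.univ.filter fun i => y i = j).card) :
    (correlations μ η y ξ W₀).Regular (η * (σ ^ 2 * d) / (n * m)) (n * ‖μ‖ ^ 2 / (σ ^ 2 * d)) τ
      (fun i => ‖ξ i‖ ^ 2 / (σ ^ 2 * d)) := by
  have hn' : (0 : ℝ) < n := by exact_mod_cast hn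
  have hm' : (0 : ℝ) < m := by exact_mod_cast hm
  have hd' : (0 : ℝ) < d := by exact_mod_cast hd
  have hV : 0 < σ ^ 2 * (d : ℝ) := by positivity
  set V := σ ^ 2 * (d : ℝ) with hVdef
  set D := correlations μ η y ξ W₀ with hD
  have hsum : ∀ t, ∑ k, D.grad t k = n * D.meanGrad t := fun t => by
    unfold meanGrad
    field_simp
  have hcross : ∀ {x : ℝ}, n * |x| ≤ τ * V → |x| ≤ τ * V / n := fun hx => by
    rw [le_div_iff₀ hn']
    linarith
  refine ⟨hn, hm, by positivity, hτ, fun i => ?_, fun i => ?_, fun t j r i => ?_,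
    fun t j r => ?_, fun j r => ?_, fun j r i => ?_, fun i => h.active (y i) i, hy⟩
  · rw [le_div_iff₀ hV]
    linarith [h.norm_ge i]
  · rw [div_le_iff₀ hV]
    exact h.norm_le i
  · set a : Fin n → ℝ := fun k => D.grad t k * reluDeriv (D.q t j r k) * (sgn j * sgn (y k))
    set c : Fin n → ℝ := fun k => D.grad t k * reluDeriv (sgn (y k) * sgn j * D.P t j r) * sgn j
    have hstep : D.q (t + 1) j r i - D.q t j r i
        - η * V / (n * m) * (sgn j * sgn (D.y i) * D.grad t i * reluDeriv (D.q t j r i)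
          * (‖ξ i‖ ^ 2 / V))
        = η / (n * m) * (∑ k ∈ Finset.univ.erase i, a k * inner ℝ (ξ k) (ξ i)
          + ∑ k, c k * inner ℝ μ (ξ i)) := by
      have h1 : D.q (t + 1) j r i = D.q t j r i + η / (n * m) * ∑ k, a k * inner ℝ (ξ k) (ξ i)
          + η / (n * m) * ((∑ k, c k) * inner ℝ μ (ξ i)) := by
        show inner ℝ (gd μ η y ξ W₀ (t + 1) j r) (ξ i) = _
        rw [gd_succ, inner_add_left, inner_add_left, real_inner_smul_left, real_inner_smul_left,
          real_inner_smul_left, sum_inner]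
        simp only [real_inner_smul_left]
        rfl
      have h2 : ∑ k, a k * inner ℝ (ξ k) (ξ i)
          = a i * ‖ξ i‖ ^ 2 + ∑ k ∈ Finset.univ.erase i, a k * inner ℝ (ξ k) (ξ i) := by
        rw [← Finset.add_sum_erase _ _ (Finset.mem_univ i), real_inner_self_eq_norm_sq]
      have h3 : η * V / (n * m) * (sgn j * sgn (D.y i) * D.grad t i * reluDeriv (D.q t j r i)
          * (‖ξ i‖ ^ 2 / V)) = η / (n * m) * (a i * ‖ξ i‖ ^ 2) := by
        show _ = η / (n * m) * (D.grad t i * reluDeriv (D.q t j r i) * (sgn j * sgn (D.y i))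
          * ‖ξ i‖ ^ 2)
        field_simp
      rw [h1, h2, h3, Finset.sum_mul]
      ring
    -- The other noise patches and the signal each contribute at most τ times the mean gradient in
    -- normalized units; together they give the 2 τ of `q_step`.
    have hA : |∑ k ∈ Finset.univ.erase i, a k * inner ℝ (ξ k) (ξ i)|
        ≤ (n * D.meanGrad t) * (τ * V / n) := by
      refine (abs_sum_mul_le _ (fun k _ => abs_noise_coeff_le t j r k) fun k hk =>
        hcross (h.inner_noise k i (Finset.ne_of_mem_erase hk))).trans ?_
      rw [← hsum]
      refine mul_le_mul_of_nonneg_right ?_ (by positivity)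
      exact Finset.sum_le_sum_of_subset_of_nonneg (Finset.erase_subset _ _)
        fun k _ _ => (grad_pos t k).le
    have hC : |∑ k, c k * inner ℝ μ (ξ i)| ≤ (n * D.meanGrad t) * (τ * V / n) := by
      refine (abs_sum_mul_le _ (fun k _ => abs_signal_coeff_le t j r k) fun k _ =>
        hcross (h.inner_signal i)).trans ?_
      rw [← hsum]
    rw [hstep, abs_mul, abs_of_pos (by positivity)]
    calc _ ≤ η / (n * m) * ((n * D.meanGrad t) * (τ * V / n)
          + (n * D.meanGrad t) * (τ * V / n)) := by
          gcongr
          exact (abs_add_le _ _).trans (add_le_add hA hC)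
      _ = _ := by field_simp; ring
  · set a : Fin n → ℝ := fun k => D.grad t k * reluDeriv (D.q t j r k) * (sgn j * sgn (y k))
    set c : Fin n → ℝ := fun k => D.grad t k * reluDeriv (sgn (y k) * sgn j * D.P t j r) * sgn j
    have hstep : D.P (t + 1) j r - D.P t j r
        - η * V / (n * m) * (n * ‖μ‖ ^ 2 / V * ((1 / (n : ℝ)) * ∑ i, D.grad t i
          * reluDeriv (sgn (D.y i) * sgn j * D.P t j r)))
        = η / (n * m) * (sgn j * ∑ k, a k * inner ℝ (ξ k) μ) := by
      have h1 : D.P (t + 1) j r = D.P t j r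
          + η / (n * m) * (sgn j * ∑ k, a k * inner ℝ (ξ k) μ)
          + η / (n * m) * (sgn j * ((∑ k, c k) * ‖μ‖ ^ 2)) := by
        show sgn j * inner ℝ (gd μ η y ξ W₀ (t + 1) j r) μ = _
        rw [gd_succ, inner_add_left, inner_add_left, real_inner_smul_left, real_inner_smul_left,
          real_inner_smul_left, sum_inner, real_inner_self_eq_norm_sq]
        simp only [real_inner_smul_left]
        show sgn j * (_ + η / (n * m) * ∑ k, a k * inner ℝ (ξ k) μ
          + η / (n * m) * ((∑ k, c k) * ‖μ‖ ^ 2)) = sgn j * _ + _ + _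
        ring
      have h2 : sgn j * ∑ k, c k = ∑ k, D.grad t k * reluDeriv (sgn (D.y k) * sgn j * D.P t j r)
          := by
        rw [Finset.mul_sum]
        refine Finset.sum_congr rfl fun k _ => ?_
        show sgn j * (D.grad t k * reluDeriv (sgn (D.y k) * sgn j * D.P t j r) * sgn j) = _
        rw [mul_left_comm, sgn_mul_self, mul_one]
      rw [h1, ← h2]
      field_simp
      ring
    have hA : |∑ k, a k * inner ℝ (ξ k) μ| ≤ (n * D.meanGrad t) * (τ * V / n) := by
      refine (abs_sum_mul_le _ (fun k _ => abs_noise_coeff_le t j r k) fun k _ =>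
        hcross (x := inner ℝ (ξ k) μ) ?_).trans ?_
      · rw [real_inner_comm]
        exact h.inner_signal k
      · rw [← hsum]
    rw [hstep, abs_mul, abs_of_pos (by positivity), abs_mul, abs_sgn, one_mul]
    calc _ ≤ η / (n * m) * ((n * D.meanGrad t) * (τ * V / n)) := by gcongr
      _ = _ := by field_simp
  · show |sgn j * inner ℝ (W₀ j r) μ| ≤ τ
    rw [abs_mul, abs_sgn, one_mul]
    exact h.init_signal j r
  · exact h.init_noise j r i

/-- The iterates stay in the affine space spanned by the patches, with coefficients bounded by the
accumulated gradients. -/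
lemma gd_eq_sum (hn : 0 < n) (hm : 0 < m) (hη : 0 < η) {V : ℝ} (hV : 0 < V) (t : ℕ) (j : Bool)
    (r : Fin m) :
    ∃ (a : Fin n → ℝ) (c : ℝ), gd μ η y ξ W₀ t j r = W₀ j r + ∑ k, a k • ξ k + c • μ ∧
      (∀ k, V * |a k| ≤ (correlations μ η y ξ W₀).accGrad (η * V / (n * m)) t k) ∧
      V * |c| ≤ ∑ k, (correlations μ η y ξ W₀).accGrad (η * V / (n * m)) t k := by
  have hn' : (0 : ℝ) < n := by exact_mod_cast hn
  have hm' : (0 : ℝ) < m := by exact_mod_cast hm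
  have hη' : 0 < η / ((n : ℝ) * m) := by positivity
  induction t with
  | zero => exact ⟨0, 0, by simp [gd], by simp [accGrad], by simp [accGrad]⟩
  | succ t ih =>
    obtain ⟨a, c, h1, h2, h3⟩ := ih
    set D := correlations μ η y ξ W₀
    refine ⟨fun k => a k + η / (n * m) *
        (D.grad t k * reluDeriv (D.q t j r k) * (sgn j * sgn (y k))),
      c + η / (n * m) *
        ∑ k, D.grad t k * reluDeriv (sgn (y k) * sgn j * D.P t j r) * sgn j, ?_, fun k => ?_, ?_⟩
    · rw [gd_succ, h1]
      simp only [add_smul, Finset.sum_add_distrib, mul_smul, ← Finset.smul_sum]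
      abel
    · rw [accGrad_succ]
      calc _ ≤ V * (|a k| + η / (n * m) * D.grad t k) := by
            refine mul_le_mul_of_nonneg_left ((abs_add_le _ _).trans ?_) hV.le
            rw [abs_mul (η / (n * m)), abs_of_pos hη']
            gcongr
            exact abs_noise_coeff_le t j r k
        _ = V * |a k| + η * V / (n * m) * D.grad t k := by ring
        _ ≤ _ := by linarith [h2 k]
    · simp only [accGrad_succ]
      rw [Finset.sum_add_distrib, ← Finset.mul_sum]
      calc _ ≤ V * (|c| + η / (n * m) * ∑ k, D.grad t k) := by
            refine mul_le_mul_of_nonneg_left ((abs_add_le _ _).trans ?_) hV.le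
            rw [abs_mul (η / (n * m)), abs_of_pos hη']
            gcongr
            refine (Finset.abs_sum_le_sum_abs _ _).trans (Finset.sum_le_sum fun k _ => ?_)
            exact abs_signal_coeff_le t j r k
        _ = V * |c| + η * V / (n * m) * ∑ k, D.grad t k := by ring
        _ ≤ _ := by linarith

/-- The norm of the weights is controlled by the accumulated gradients. -/
lemma Typical.norm_gd_le (h : Typical μ σ τ ξ W₀) (hn : 0 < n) (hm : 0 < m) (hd : 0 < d)
    (hσ : 0 < σ) (hη : 0 < η) (hτ : τ ≤ 1) {t : ℕ} {Γ : ℝ} (hΓ0 : 0 ≤ Γ)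
    (hΓ : ∀ k, (correlations μ η y ξ W₀).accGrad (η * (σ ^ 2 * d) / (n * m)) t k ≤ Γ)
    (j : Bool) (r : Fin m) :
    σ * ‖gd μ η y ξ W₀ t j r‖
      ≤ √((n : ℝ) / d) * (τ + (2 + √(n * ‖μ‖ ^ 2 / (σ ^ 2 * d))) * Γ) := by
  have hn' : (0 : ℝ) < n := by exact_mod_cast hn
  have hd' : (0 : ℝ) < d := by exact_mod_cast hd
  have hV : 0 < σ ^ 2 * (d : ℝ) := by positivity
  obtain ⟨a, c, h1, h2, h3⟩ := gd_eq_sum (μ := μ) (y := y) (ξ := ξ) (W₀ := W₀) hn hm hη hV t j r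
  set V := σ ^ 2 * (d : ℝ) with hVdef
  have ha : ∀ k, |a k| ≤ Γ / V := fun k => by
    rw [le_div_iff₀ hV]
    linarith [h2 k, hΓ k]
  have hc : |c| ≤ n * Γ / V := by
    rw [le_div_iff₀ hV]
    have : ∑ k, (correlations μ η y ξ W₀).accGrad (η * V / (n * m)) t k ≤ n * Γ := by
      simpa using Finset.sum_le_sum (s := Finset.univ) fun k _ => hΓ k
    linarith
  -- In the Gram matrix the diagonal contributes at most 2 n V and all remaining entries together at
  -- most n τ V. The squared norm thus scales like n, not n².
  have hsq : ‖∑ k, a k • ξ k‖ ^ 2 ≤ 4 * (n * Γ ^ 2 / V) := by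
    have hentry : ∀ k l, a k * a l * inner ℝ (ξ k) (ξ l)
        ≤ (Γ / V) ^ 2 * ((if k = l then 2 * V else 0) + τ * V / n) := fun k l => by
      have hτV : 0 ≤ τ * V / n := by
        have := (abs_nonneg _).trans (h.init_signal j r)
        positivity
      have h4 : |inner ℝ (ξ k) (ξ l)| ≤ (if k = l then 2 * V else 0) + τ * V / n := by
        split_ifs with hkl
        · rw [hkl, real_inner_self_eq_norm_sq, abs_of_nonneg (by positivity)]
          linarith [h.norm_le l]
        · rw [zero_add, le_div_iff₀ hn']
          linarith [h.inner_noise k l hkl]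
      calc _ ≤ |a k * a l * inner ℝ (ξ k) (ξ l)| := le_abs_self _
        _ = |a k| * |a l| * |inner ℝ (ξ k) (ξ l)| := by rw [abs_mul, abs_mul]
        _ ≤ (Γ / V) * (Γ / V) * ((if k = l then 2 * V else 0) + τ * V / n) := by
            gcongr
            exacts [ha k, ha l]
        _ = _ := by ring
    rw [← real_inner_self_eq_norm_sq, sum_inner]
    simp only [inner_sum, real_inner_smul_left, real_inner_smul_right, ← mul_assoc]
    calc _ ≤ ∑ k : Fin n, ∑ l : Fin n,
          (Γ / V) ^ 2 * ((if k = l then 2 * V else 0) + τ * V / n) :=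
          Finset.sum_le_sum fun k _ => Finset.sum_le_sum fun l _ => by
            have := hentry k l
            rwa [mul_comm (a k) (a l)] at this
      _ = (Γ / V) ^ 2 * (n * (2 * V + τ * V)) := by
          simp only [← Finset.mul_sum, Finset.sum_add_distrib, Finset.sum_ite_eq, Finset.mem_univ,
            if_true, Finset.sum_const, Finset.card_univ, Fintype.card_fin, nsmul_eq_mul]
          field_simp
      _ ≤ (Γ / V) ^ 2 * (n * (2 * V + 2 * V)) := by
          gcongr
          nlinarith
      _ = _ := by field_simp; ring
  have hrt : √((n : ℝ) / d) ^ 2 = n / d := Real.sq_sqrt (by positivity)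
  have hnoise : σ * ‖∑ k, a k • ξ k‖ ≤ √((n : ℝ) / d) * (2 * Γ) := by
    refine le_of_sq_le_sq ?_ (by positivity)
    rw [mul_pow, mul_pow, hrt]
    calc σ ^ 2 * ‖∑ k, a k • ξ k‖ ^ 2 ≤ σ ^ 2 * (4 * (n * Γ ^ 2 / V)) := by gcongr
      _ = _ := by rw [hVdef]; field_simp; ring
  -- All n points may add up in the signal coefficient; σ (n Γ / V) ‖μ‖ equals √(n/d) √κ Γ.
  have hsignal : σ * ‖c • μ‖ ≤ √((n : ℝ) / d) * (√(n * ‖μ‖ ^ 2 / V) * Γ) := by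
    refine le_of_sq_le_sq ?_ (by positivity)
    rw [norm_smul, Real.norm_eq_abs, mul_pow, mul_pow, mul_pow, mul_pow, hrt,
      Real.sq_sqrt (by positivity)]
    calc σ ^ 2 * (|c| ^ 2 * ‖μ‖ ^ 2) ≤ σ ^ 2 * ((n * Γ / V) ^ 2 * ‖μ‖ ^ 2) := by gcongr
      _ = _ := by rw [hVdef]; field_simp
  rw [h1]
  calc _ ≤ σ * (‖W₀ j r‖ + ‖∑ k, a k • ξ k‖ + ‖c • μ‖) := by
        gcongr
        exact norm_add₃_le
    _ ≤ τ * √((n : ℝ) / d) + √((n : ℝ) / d) * (2 * Γ)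
        + √((n : ℝ) / d) * (√(n * ‖μ‖ ^ 2 / V) * Γ) := by
        have := h.init_norm j r
        linarith
    _ = _ := by ring

end

/-! ### Concentration inequalities -/

instance isProbabilityMeasure_gaussianVec (d : ℕ) (σ : ℝ) :
    IsProbabilityMeasure (gaussianVec d σ) :=
  Measure.isProbabilityMeasure_map (by fun_prop)

instance isProbabilityMeasure_rademacher : IsProbabilityMeasure rademacher :=
  isProbabilityMeasure_uniformOn Set.finite_univ Set.univ_nonempty

instance isProbabilityMeasure_labelLaw (n : ℕ) : IsProbabilityMeasure (labelLaw n) := by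
  unfold labelLaw; infer_instance

instance isProbabilityMeasure_noiseLaw (d n : ℕ) (σ : ℝ) :
    IsProbabilityMeasure (noiseLaw d n σ) := by
  unfold noiseLaw; infer_instance

instance isProbabilityMeasure_initLaw (d m : ℕ) (σ : ℝ) :
    IsProbabilityMeasure (initLaw d m σ) := by
  unfold initLaw; infer_instance

lemma gaussianVec_map_inner {d : ℕ} (σ : ℝ) (w : Vec d) :
    (gaussianVec d σ).map (fun x => inner ℝ w x) = gaussianReal 0 (σ ^ 2 * ‖w‖ ^ 2).toNNReal := by
  have h := IsGaussian.map_eq_gaussianReal (μ := stdGaussian (Vec d)) (innerSL ℝ (σ • w))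
  rw [variance_dual_stdGaussian, integral_strongDual_stdGaussian, innerSL_apply_norm, norm_smul,
    mul_pow, Real.norm_eq_abs, sq_abs] at h
  rw [← h, gaussianVec, Measure.map_map (by fun_prop) (by fun_prop)]
  congr 1
  ext x
  simp [inner_smul_right]

/-- Gaussian tail bound. -/
lemma gaussianVec_le_inner {d : ℕ} {σ : ℝ} {w : Vec d} {B t : ℝ} (hB : 0 < B)
    (hw : |σ| * ‖w‖ ≤ B) (ht : 0 ≤ t) :
    gaussianVec d σ {x | t ≤ inner ℝ w x} ≤ ENNReal.ofReal (Real.exp (-(t ^ 2 / (2 * B ^ 2)))) := by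
  have hmap := gaussianVec_map_inner σ w
  have hint : Integrable (fun x => Real.exp (t / B ^ 2 * inner ℝ w x)) (gaussianVec d σ) := by
    have h1 := integrable_exp_mul_gaussianReal (μ := 0) (v := (σ ^ 2 * ‖w‖ ^ 2).toNNReal)
      (t / B ^ 2)
    rw [← hmap, integrable_map_measure (by fun_prop) (by fun_prop)] at h1
    exact h1
  -- The parameter t / B² is optimal for a Gaussian of variance B².
  have h := measure_ge_le_exp_mul_mgf (μ := gaussianVec d σ) (X := fun x => inner ℝ w x) t
    (t := t / B ^ 2) (by positivity) hint
  rw [mgf_gaussianReal hmap, ← Real.exp_add] at h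
  rw [← ofReal_measureReal]
  refine ENNReal.ofReal_le_ofReal (h.trans (Real.exp_le_exp.2 ?_))
  rw [Real.coe_toNNReal _ (by positivity)]
  have h1 : σ ^ 2 * ‖w‖ ^ 2 ≤ B ^ 2 := by
    rw [← sq_abs σ, ← mul_pow]
    exact pow_le_pow_left₀ (by positivity) hw 2
  calc -(t / B ^ 2) * t + (0 * (t / B ^ 2) + σ ^ 2 * ‖w‖ ^ 2 * (t / B ^ 2) ^ 2 / 2)
      ≤ -(t / B ^ 2) * t + (0 * (t / B ^ 2) + B ^ 2 * (t / B ^ 2) ^ 2 / 2) := by gcongr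
    _ = -(t ^ 2 / (2 * B ^ 2)) := by field_simp; ring

lemma gaussianVec_lt_abs_inner {d : ℕ} {σ : ℝ} {w : Vec d} {B t : ℝ} (hB : 0 < B)
    (hw : |σ| * ‖w‖ ≤ B) (ht : 0 ≤ t) :
    gaussianVec d σ {x | t < |inner ℝ w x|}
      ≤ ENNReal.ofReal (2 * Real.exp (-(t ^ 2 / (2 * B ^ 2)))) := by
  have h1 := gaussianVec_le_inner hB hw ht
  have h2 := gaussianVec_le_inner (w := -w) hB (by rwa [norm_neg]) ht
  rw [two_mul, ENNReal.ofReal_add (by positivity) (by positivity)]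
  refine le_trans (measure_mono ?_) ((measure_union_le _ _).trans (add_le_add h1 h2))
  intro x hx
  rw [Set.mem_ofPred_eq] at hx
  rw [Set.mem_union, Set.mem_ofPred_eq, Set.mem_ofPred_eq, inner_neg_left]
  rcases lt_abs.1 hx with h | h
  exacts [Or.inl h.le, Or.inr h.le]

/-- The law of ⟨w, x⟩ is symmetric, so two opposite closed half-spaces have equal mass, and they
cover the space. -/
lemma half_le_gaussianVec_inner_nonneg {d : ℕ} (σ : ℝ) (w : Vec d) :
    1 / 2 ≤ gaussianVec d σ {x | 0 ≤ inner ℝ w x} := by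
  have hmap := gaussianVec_map_inner σ w
  have hmap' := gaussianVec_map_inner σ (-w)
  rw [norm_neg, ← hmap] at hmap'
  have h1 : gaussianVec d σ {x | 0 ≤ inner ℝ w x} = gaussianVec d σ {x | inner ℝ w x ≤ 0} := by
    have h2 := congrArg (fun ν => ν (Set.Ici 0)) hmap'
    rw [Measure.map_apply (by fun_prop) measurableSet_Ici,
      Measure.map_apply (by fun_prop) measurableSet_Ici] at h2
    rw [show {x : Vec d | 0 ≤ inner ℝ w x} = (fun x => inner ℝ w x) ⁻¹' Set.Ici 0 from rfl, ← h2]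
    congr 1
    ext x
    simp
  have h3 : 1 ≤ gaussianVec d σ {x | 0 ≤ inner ℝ w x} + gaussianVec d σ {x | inner ℝ w x ≤ 0} := by
    rw [← measure_univ (μ := gaussianVec d σ)]
    refine le_trans (measure_mono fun x _ => ?_) (measure_union_le _ _)
    rw [Set.mem_union, Set.mem_ofPred_eq, Set.mem_ofPred_eq]
    exact le_total _ _
  rw [← h1, ← two_mul] at h3
  rw [ENNReal.div_le_iff_le_mul (by simp) (by simp), mul_comm]
  exact h3

/-- Chernoff bound for product measures. -/
lemma measure_pi_le_pow {ι X : Type*} [Fintype ι] [MeasurableSpace X] (ν : Measure X)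
    [IsProbabilityMeasure ν] {f : ι → X → ENNReal} (hf : ∀ i, Measurable (f i)) {ρ : ENNReal}
    (hρ : ∀ i, ∫⁻ x, f i x ∂ν ≤ ρ) {S : Set (ι → X)} (hS : ∀ x ∈ S, 1 ≤ ∏ i, f i (x i)) :
    Measure.pi (fun _ : ι => ν) S ≤ ρ ^ Fintype.card ι := by
  have hind : iIndepFun (fun i (x : ι → X) => f i (x i)) (Measure.pi fun _ : ι => ν) :=
    iIndepFun_pi fun i => (hf i).aemeasurable
  have hprod := lintegral_prod_eq_prod_lintegral_of_indepFun Finset.univ _ hind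
    fun i => (hf i).comp (measurable_pi_apply i)
  have hmark := mul_meas_ge_le_lintegral (μ := Measure.pi fun _ : ι => ν)
    (f := fun x => ∏ i, f i (x i))
    (Finset.measurable_fun_prod _ fun i _ => (hf i).comp (measurable_pi_apply i)) 1
  rw [one_mul] at hmark
  refine (measure_mono hS).trans (hmark.trans ?_)
  rw [hprod, ← Finset.card_univ, ← Finset.prod_const]
  refine Finset.prod_le_prod' fun i _ => ?_
  exact ((measurePreserving_eval (fun _ : ι => ν) i).lintegral_comp (hf i)).trans_le (hρ i)

lemma one_le_prod_ofReal_exp {ι : Type*} [Fintype ι] {a : ι → ℝ} (h : 0 ≤ ∑ i, a i) :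
    1 ≤ ∏ i, ENNReal.ofReal (Real.exp (a i)) := by
  rw [← ENNReal.ofReal_prod_of_nonneg fun i _ => (Real.exp_pos _).le, ← Real.exp_sum,
    ENNReal.one_le_ofReal]
  exact Real.one_le_exp h

lemma ofReal_exp_pow (x : ℝ) (k : ℕ) :
    ENNReal.ofReal (Real.exp x) ^ k = ENNReal.ofReal (Real.exp (k * x)) := by
  rw [← ENNReal.ofReal_pow (Real.exp_pos _).le, ← Real.exp_nat_mul]

/-- Few successes among independent trials of success probability at least one half are
exponentially unlikely. -/
lemma measure_pi_card_lt {ι X : Type*} [Fintype ι] [MeasurableSpace X] (ν : Measure X)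
    [IsProbabilityMeasure ν] {A : Set X} (hA : MeasurableSet A) (hν : 1 / 2 ≤ ν A)
    [DecidablePred (· ∈ A)] :
    Measure.pi (fun _ : ι => ν)
        {x | ((Finset.univ.filter fun i => x i ∈ A).card : ℝ) < (Fintype.card ι : ℝ) / 4}
      ≤ ENNReal.ofReal (Real.exp (Fintype.card ι * (-(1 / 20)))) := by
  rw [← ofReal_exp_pow]
  -- With fewer than a quarter of successes the product of the f is at least 1. Its factors have
  -- mean e^{1/4} (1 - (1 - e⁻¹) ν(A)), at most e^{-1/20} since ν(A) ≥ 1/2; the numerical check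
  -- splits e^{1/4} as e^{3/10} e^{-1/20}.
  set f : X → ENNReal := fun x => ENNReal.ofReal (Real.exp (1 / 4 - A.indicator 1 x)) with hf
  have hfm : Measurable f := by
    have : Measurable (A.indicator (1 : X → ℝ)) := measurable_one.indicator hA
    fun_prop
  refine measure_pi_le_pow ν (f := fun _ => f) (fun _ => hfm) (fun _ => ?_) fun x hx => ?_
  · have h1 : ∀ x, f x = A.indicator (fun _ => ENNReal.ofReal (Real.exp (-(3 / 4)))) x
        + Aᶜ.indicator (fun _ => ENNReal.ofReal (Real.exp (1 / 4))) x := fun x => by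
      by_cases hx : x ∈ A
      · simp [hf, hx]; norm_num
      · simp [hf, hx]
    have hν' : (1 : ℝ) / 2 ≤ ν.real A := by
      have := ENNReal.toReal_mono (measure_ne_top ν A) hν
      simpa [Measure.real] using this
    simp_rw [h1]
    rw [lintegral_add_left (measurable_const.indicator hA), lintegral_indicator hA,
      lintegral_indicator hA.compl, setLIntegral_const, setLIntegral_const,
      ← ofReal_measureReal (s := A), ← ofReal_measureReal (s := Aᶜ),
      ← ENNReal.ofReal_mul (Real.exp_pos _).le, ← ENNReal.ofReal_mul (Real.exp_pos _).le,
      ← ENNReal.ofReal_add (by positivity) (by positivity), probReal_compl_eq_one_sub hA]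
    refine ENNReal.ofReal_le_ofReal ?_
    have e1 : Real.exp (-(3 / 4)) = Real.exp (3 / 10) * Real.exp (-1) * Real.exp (-(1 / 20)) := by
      rw [← Real.exp_add, ← Real.exp_add]; norm_num
    have e2 : Real.exp (1 / 4) = Real.exp (3 / 10) * Real.exp (-(1 / 20)) := by
      rw [← Real.exp_add]; norm_num
    have e3 : Real.exp (3 / 10) ≤ 7 / 5 := by
      have h2 : Real.exp (3 / 10) ^ 10 = Real.exp 1 ^ 3 := by
        rw [← Real.exp_nat_mul, ← Real.exp_nat_mul]; norm_num
      refine le_of_pow_le_pow_left₀ (n := 10) (by norm_num) (by norm_num) ?_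
      rw [h2]
      calc Real.exp 1 ^ 3 ≤ 2.7182818286 ^ 3 := by
            gcongr
            exact Real.exp_one_lt_d9.le
        _ ≤ _ := by norm_num
    have e4 : Real.exp (-1) ≤ 0.3678794412 + 0.0001 := by
      linarith [Real.exp_neg_one_lt_d9]
    have e5 : Real.exp (-1) * ν.real A + (1 - ν.real A) ≤ 0.69 := by nlinarith
    have e6 := Real.exp_pos (-(1 / 20))
    have e7 : 0 ≤ Real.exp (-1) * ν.real A + (1 - ν.real A) :=
      add_nonneg (by positivity) (sub_nonneg.2 measureReal_le_one)
    have e8 : Real.exp (3 / 10) * (Real.exp (-1) * ν.real A + (1 - ν.real A)) ≤ 1 :=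
      (mul_le_mul e3 e5 e7 (by norm_num)).trans (by norm_num)
    rw [e1, e2]
    calc _ = Real.exp (3 / 10) * (Real.exp (-1) * ν.real A + (1 - ν.real A))
          * Real.exp (-(1 / 20)) := by ring
      _ ≤ 1 * Real.exp (-(1 / 20)) := by gcongr
      _ = _ := one_mul _
  · refine one_le_prod_ofReal_exp ?_
    have h1 : ∑ i, A.indicator (1 : X → ℝ) (x i)
        = ((Finset.univ.filter fun i => x i ∈ A).card : ℝ) := by
      simp [Set.indicator_apply]
    rw [Finset.sum_sub_distrib, h1]
    simp only [Finset.sum_const, Finset.card_univ, nsmul_eq_mul]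
    have : ((Finset.univ.filter fun i => x i ∈ A).card : ℝ) < (Fintype.card ι : ℝ) / 4 := hx
    linarith

/-- The exponential moment behind both norm tails: a = 1/4 for large norms, a = -1/2 for small ones.
The resulting exponents -1/2 + (log 2)/2 and 1/4 - (log 2)/2 are both below -1/20. -/
lemma lintegral_exp_sq_gaussianReal {a : ℝ} (ha : a < 1 / 2) (c : ℝ) :
    ∫⁻ x, ENNReal.ofReal (Real.exp (c + a * x ^ 2)) ∂gaussianReal 0 1
      = ENNReal.ofReal (Real.exp c * √(1 / (1 - 2 * a))) := by
  have h0 : 0 < 1 / 2 - a := by linarith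
  rw [gaussianReal_of_var_ne_zero 0 one_ne_zero,
    lintegral_withDensity_eq_lintegral_mul _ (measurable_gaussianPDF 0 1) (by fun_prop)]
  have h1 : ∀ x : ℝ, (gaussianPDF 0 1 * fun x => ENNReal.ofReal (Real.exp (c + a * x ^ 2))) x
      = ENNReal.ofReal ((√(2 * Real.pi))⁻¹ * Real.exp c * Real.exp (-(1 / 2 - a) * x ^ 2)) := by
    intro x
    rw [Pi.mul_apply, gaussianPDF, ← ENNReal.ofReal_mul (gaussianPDFReal_nonneg _ _ _),
      gaussianPDFReal]
    congr 1
    simp only [NNReal.coe_one, mul_one, sub_zero]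
    rw [mul_assoc, mul_assoc, ← Real.exp_add, ← Real.exp_add]
    congr 2
    ring
  simp_rw [h1]
  rw [← ofReal_integral_eq_lintegral_ofReal
    ((integrable_exp_neg_mul_sq h0).const_mul _)
    (Filter.Eventually.of_forall fun x => by positivity),
    integral_const_mul, integral_gaussian]
  congr 1
  have h2 : √(Real.pi / (1 / 2 - a)) = √(2 * Real.pi) * √(1 / (1 - 2 * a)) := by
    rw [← Real.sqrt_mul (by positivity)]
    congr 1
    have : 1 - 2 * a ≠ 0 := by linarith
    have : 1 / 2 - a ≠ 0 := h0.ne'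
    field_simp
  rw [h2]
  have : √(2 * Real.pi) ≠ 0 := by positivity
  field_simp

lemma gaussianVec_apply {d : ℕ} (σ : ℝ) {S : Set (Vec d)} (hS : MeasurableSet S) :
    gaussianVec d σ S = Measure.pi (fun _ : Fin d => gaussianReal 0 1)
      {x | σ • (WithLp.toLp 2 x : Vec d) ∈ S} := by
  rw [gaussianVec, Measure.map_apply (by fun_prop) hS, ← map_pi_eq_stdGaussian,
    Measure.map_apply (by fun_prop) (hS.preimage (by fun_prop))]
  rfl

lemma norm_smul_toLp_sq {d : ℕ} (σ : ℝ) (x : Fin d → ℝ) :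
    ‖σ • (WithLp.toLp 2 x : Vec d)‖ ^ 2 = σ ^ 2 * ∑ i, x i ^ 2 := by
  rw [norm_smul, mul_pow, EuclideanSpace.norm_sq_eq]
  simp

lemma sqrt_two_eq_exp : √2 = Real.exp (Real.log 2 / 2) := by
  rw [Real.exp_half, Real.exp_log (by norm_num)]

/-- The squared norm of a Gaussian vector is rarely large. -/
lemma gaussianVec_norm_sq_gt {d : ℕ} {σ : ℝ} :
    gaussianVec d σ {x | 2 * (σ ^ 2 * d) < ‖x‖ ^ 2}
      ≤ ENNReal.ofReal (Real.exp (d * (-(1 / 20)))) := by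
  rw [gaussianVec_apply σ (measurableSet_lt (by fun_prop) (by fun_prop)), ← ofReal_exp_pow]
  have := measure_pi_le_pow (ι := Fin d) (gaussianReal 0 1)
    (f := fun _ x => ENNReal.ofReal (Real.exp (-(1 / 2) + 1 / 4 * x ^ 2)))
    (ρ := ENNReal.ofReal (Real.exp (-(1 / 20)))) (fun _ => by fun_prop) (fun _ => ?_)
    (S := {x | σ • (WithLp.toLp 2 x : Vec d) ∈ {x : Vec d | 2 * (σ ^ 2 * d) < ‖x‖ ^ 2}})
    (fun x hx => one_le_prod_ofReal_exp ?_)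
  · simpa using this
  · rw [lintegral_exp_sq_gaussianReal (by norm_num)]
    refine ENNReal.ofReal_le_ofReal ?_
    rw [show (1 : ℝ) / (1 - 2 * (1 / 4)) = 2 by norm_num, sqrt_two_eq_exp, ← Real.exp_add]
    exact Real.exp_le_exp.2 (by linarith [Real.log_two_lt_d9])
  · have h1 : 2 * (σ ^ 2 * d) < σ ^ 2 * ∑ i, x i ^ 2 := by
      rw [← norm_smul_toLp_sq]
      exact hx
    have h2 : 2 * (d : ℝ) < ∑ i, x i ^ 2 :=
      lt_of_mul_lt_mul_left (by linarith) (sq_nonneg σ)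
    rw [Finset.sum_add_distrib, ← Finset.mul_sum]
    simp only [Finset.sum_const, Finset.card_univ, Fintype.card_fin, nsmul_eq_mul]
    linarith

/-- The squared norm of a Gaussian vector is rarely small. -/
lemma gaussianVec_norm_sq_lt {d : ℕ} {σ : ℝ} :
    gaussianVec d σ {x | ‖x‖ ^ 2 < σ ^ 2 * d / 2}
      ≤ ENNReal.ofReal (Real.exp (d * (-(1 / 20)))) := by
  rw [gaussianVec_apply σ (measurableSet_lt (by fun_prop) (by fun_prop)), ← ofReal_exp_pow]
  have := measure_pi_le_pow (ι := Fin d) (gaussianReal 0 1)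
    (f := fun _ x => ENNReal.ofReal (Real.exp (1 / 4 + -(1 / 2) * x ^ 2)))
    (ρ := ENNReal.ofReal (Real.exp (-(1 / 20)))) (fun _ => by fun_prop) (fun _ => ?_)
    (S := {x | σ • (WithLp.toLp 2 x : Vec d) ∈ {x : Vec d | ‖x‖ ^ 2 < σ ^ 2 * d / 2}})
    (fun x hx => one_le_prod_ofReal_exp ?_)
  · simpa using this
  · rw [lintegral_exp_sq_gaussianReal (by norm_num)]
    refine ENNReal.ofReal_le_ofReal ?_
    rw [show (1 : ℝ) / (1 - 2 * -(1 / 2)) = 2⁻¹ by norm_num, Real.sqrt_inv, sqrt_two_eq_exp,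
      ← Real.exp_neg, ← Real.exp_add]
    exact Real.exp_le_exp.2 (by linarith [Real.log_two_gt_d9])
  · have h1 : σ ^ 2 * ∑ i, x i ^ 2 < σ ^ 2 * d / 2 := by
      rw [← norm_smul_toLp_sq]
      exact hx
    have h2 : ∑ i, x i ^ 2 < (d : ℝ) / 2 :=
      lt_of_mul_lt_mul_left (by linarith) (sq_nonneg σ)
    rw [Finset.sum_add_distrib, ← Finset.mul_sum]
    simp only [Finset.sum_const, Finset.card_univ, Fintype.card_fin, nsmul_eq_mul]
    linarith

/-! ### Typical data are likely -/

lemma measure_exists_le {α ι : Type*} [Fintype ι] [MeasurableSpace α] {ν : Measure α}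
    {S : ι → Set α} {p : ℝ} (h : ∀ i, ν (S i) ≤ ENNReal.ofReal p) :
    ν (⋃ i, S i) ≤ ENNReal.ofReal (Fintype.card ι * p) := by
  refine (measure_iUnion_fintype_le ν S).trans ((Finset.sum_le_sum fun i _ => h i).trans ?_)
  rw [Finset.sum_const, Finset.card_univ, nsmul_eq_mul,
    ENNReal.ofReal_mul (Nat.cast_nonneg _), ENNReal.ofReal_natCast]

lemma prod_le_of_forall_slice {α β : Type*} [MeasurableSpace α] [MeasurableSpace β]
    {ν : Measure α} {ρ : Measure β} [IsProbabilityMeasure ν] [IsProbabilityMeasure ρ]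
    {S : Set (α × β)} (hS : MeasurableSet S) {p : ENNReal} (h : ∀ x, ρ {z | (x, z) ∈ S} ≤ p) :
    ν.prod ρ S ≤ p := by
  rw [Measure.prod_apply hS]
  refine (lintegral_mono (g := fun _ => p) fun x => h x).trans ?_
  simp

section Marginals

variable (d n m : ℕ) (σ σ₀ : ℝ)

lemma measurePreserving_noise (i : Fin n) :
    MeasurePreserving (fun ω : (Fin n → Vec d) × Weights d m => ω.1 i)
      ((noiseLaw d n σ).prod (initLaw d m σ₀)) (gaussianVec d σ) :=
  (measurePreserving_eval (fun _ : Fin n => gaussianVec d σ) i).comp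
    (measurePreserving_fst (μ := noiseLaw d n σ) (ν := initLaw d m σ₀))

lemma measurePreserving_branch (j : Bool) :
    MeasurePreserving (fun W : Weights d m => W j) (initLaw d m σ₀)
      (Measure.pi fun _ : Fin m => gaussianVec d σ₀) :=
  measurePreserving_eval (fun _ : Bool => Measure.pi fun _ : Fin m => gaussianVec d σ₀) j

lemma measurePreserving_neuron (j : Bool) (r : Fin m) :
    MeasurePreserving (fun W : Weights d m => W j r) (initLaw d m σ₀) (gaussianVec d σ₀) :=
  (measurePreserving_eval (fun _ : Fin m => gaussianVec d σ₀) r).comp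
    (measurePreserving_branch d m σ₀ j)

lemma measurePreserving_init (j : Bool) (r : Fin m) :
    MeasurePreserving (fun ω : (Fin n → Vec d) × Weights d m => ω.2 j r)
      ((noiseLaw d n σ).prod (initLaw d m σ₀)) (gaussianVec d σ₀) :=
  (measurePreserving_neuron d m σ₀ j r).comp
    (measurePreserving_snd (μ := noiseLaw d n σ) (ν := initLaw d m σ₀))

lemma measurePreserving_noise_noise {i k : Fin n} (hik : i ≠ k) :
    MeasurePreserving (fun ω : (Fin n → Vec d) × Weights d m => (ω.1 i, ω.1 k))
      ((noiseLaw d n σ).prod (initLaw d m σ₀)) ((gaussianVec d σ).prod (gaussianVec d σ)) := by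
  have hind : iIndepFun (fun i (ξ : Fin n → Vec d) => ξ i) (noiseLaw d n σ) :=
    iIndepFun_pi (X := fun _ x => x) fun i => aemeasurable_id
  have h1 := (indepFun_iff_map_prod_eq_prod_map_map
    (measurable_pi_apply i).aemeasurable (measurable_pi_apply k).aemeasurable).1
    (hind.indepFun hik)
  have h2 : ∀ i, (noiseLaw d n σ).map (fun ξ : Fin n → Vec d => ξ i) = gaussianVec d σ :=
    fun i => (measurePreserving_eval (fun _ : Fin n => gaussianVec d σ) i).map_eq
  rw [h2, h2] at h1
  exact (MeasurePreserving.mk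
    ((measurable_pi_apply i).prodMk (measurable_pi_apply k)) h1).comp
    (measurePreserving_fst (μ := noiseLaw d n σ) (ν := initLaw d m σ₀))

lemma measurePreserving_noise_init (i : Fin n) (j : Bool) (r : Fin m) :
    MeasurePreserving (fun ω : (Fin n → Vec d) × Weights d m => (ω.1 i, ω.2 j r))
      ((noiseLaw d n σ).prod (initLaw d m σ₀)) ((gaussianVec d σ).prod (gaussianVec d σ₀)) :=
  (measurePreserving_eval (fun _ : Fin n => gaussianVec d σ) i).prod
    (measurePreserving_neuron d m σ₀ j r)

lemma measurePreserving_noise_branch (i : Fin n) (j : Bool) :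
    MeasurePreserving (fun ω : (Fin n → Vec d) × Weights d m => (ω.1 i, ω.2 j))
      ((noiseLaw d n σ).prod (initLaw d m σ₀))
      ((gaussianVec d σ).prod (Measure.pi fun _ : Fin m => gaussianVec d σ₀)) :=
  (measurePreserving_eval (fun _ : Fin n => gaussianVec d σ) i).prod
    (measurePreserving_branch d m σ₀ j)

end Marginals

/-- Two independent Gaussian vectors are nearly orthogonal. -/
lemma gaussianVec_prod_lt_abs_inner {d : ℕ} {σ σ₀ A B x : ℝ} (hσ₀ : 0 < σ₀) (hA : 0 < A)
    (hB : σ₀ * √A ≤ B) (hx : 0 ≤ x) :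
    (gaussianVec d σ).prod (gaussianVec d σ₀)
        {p | ‖p.1‖ ^ 2 ≤ A ∧ x * B < |inner ℝ p.1 p.2|}
      ≤ ENNReal.ofReal (2 * Real.exp (-(x ^ 2 / 2))) := by
  have hB0 : 0 < B := lt_of_lt_of_le (by positivity) hB
  refine prod_le_of_forall_slice ?_ fun v => ?_
  · rw [Set.ofPred_and]
    exact (measurableSet_le (by fun_prop) (by fun_prop)).inter
      (measurableSet_lt (by fun_prop) (by fun_prop))
  -- Given the first vector v, the inner product is Gaussian with deviation σ₀‖v‖ ≤ B. Slices at a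
  -- large v are empty, because the norm bound is part of the event.
  · by_cases hv : ‖v‖ ^ 2 ≤ A
    · have h1 : |σ₀| * ‖v‖ ≤ B := by
        rw [abs_of_pos hσ₀]
        refine le_trans ?_ hB
        gcongr
        exact Real.le_sqrt_of_sq_le hv
      have h2 := gaussianVec_lt_abs_inner hB0 h1 (t := x * B) (by positivity)
      have h3 : (x * B) ^ 2 / (2 * B ^ 2) = x ^ 2 / 2 := by field_simp
      rw [h3] at h2
      refine le_trans (measure_mono fun z hz => ?_) h2
      rw [Set.mem_ofPred_eq, Set.mem_ofPred_eq] at hz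
      rw [Set.mem_ofPred_eq]
      exact hz.2
    · have : {z : Vec d | (v, z) ∈ {p : Vec d × Vec d | ‖p.1‖ ^ 2 ≤ A ∧ x * B < |inner ℝ p.1 p.2|}}
          = ∅ := by
        ext z
        simp [hv]
      rw [this]
      simp

/-- A quarter of the neurons is active on a given noise patch. -/
lemma prod_pi_card_active_lt {d m : ℕ} {σ σ₀ : ℝ} :
    (gaussianVec d σ).prod (Measure.pi fun _ : Fin m => gaussianVec d σ₀)
        {p | ((Finset.univ.filter fun r => 0 ≤ inner ℝ (p.2 r) p.1).card : ℝ) < (m : ℝ) / 4}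
      ≤ ENNReal.ofReal (Real.exp (m * (-(1 / 20)))) := by
  refine prod_le_of_forall_slice ?_ fun v => ?_
  · refine measurableSet_lt ?_ measurable_const
    have : (fun p : Vec d × (Fin m → Vec d) =>
        ((Finset.univ.filter fun r => 0 ≤ inner ℝ (p.2 r) p.1).card : ℝ))
        = fun p => ∑ r, if 0 ≤ inner ℝ (p.2 r) p.1 then (1 : ℝ) else 0 := by
      ext p
      simp
    rw [this]
    refine Finset.measurable_fun_sum _ fun r _ => Measurable.ite ?_ measurable_const
      measurable_const
    exact measurableSet_le (by fun_prop) (by fun_prop)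
  -- For a fixed patch the neurons are independent trials with success probability at least 1/2.
  · classical
    have h1 := measure_pi_card_lt (ι := Fin m) (gaussianVec d σ₀)
      (A := {w | 0 ≤ inner ℝ v w}) (measurableSet_le (by fun_prop) (by fun_prop))
      (half_le_gaussianVec_inner_nonneg σ₀ v)
    rw [Fintype.card_fin] at h1
    convert h1 using 4 with x
    simp only [Set.mem_ofPred_eq, real_inner_comm]

/-- Atypical data are unlikely. -/
theorem measure_not_typical_le {d n m : ℕ} {μ : Vec d} {σ σ₀ τ x : ℝ} (hd : 0 < d)
    (hσ : 0 < σ) (hσ₀ : 0 < σ₀) (hμ : μ ≠ 0) (hx : 0 ≤ x)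
    (h_noise : n * (x * (σ * √(2 * (σ ^ 2 * d)))) ≤ τ * (σ ^ 2 * d))
    (h_signal : n * (x * (σ * ‖μ‖)) ≤ τ * (σ ^ 2 * d))
    (h_init_noise : x * (σ₀ * √(2 * (σ ^ 2 * d))) ≤ τ)
    (h_init_signal : x * (σ₀ * ‖μ‖) ≤ τ)
    (h_init_norm : σ * √(2 * (σ₀ ^ 2 * d)) ≤ τ * √((n : ℝ) / d)) :
    ((noiseLaw d n σ).prod (initLaw d m σ₀)) {ω | ¬ Typical μ σ τ ω.1 ω.2}
      ≤ ENNReal.ofReal ((2 * n + 2 * m) * Real.exp (d * (-(1 / 20)))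
        + (n * n + n + 2 * m * n + 2 * m) * (2 * Real.exp (-(x ^ 2 / 2)))
        + 2 * n * Real.exp (m * (-(1 / 20)))) := by
  have hd' : (0 : ℝ) < d := by exact_mod_cast hd
  have hμ' : 0 < ‖μ‖ := norm_pos_iff.2 hμ
  set ν := (noiseLaw d n σ).prod (initLaw d m σ₀) with hν
  set V := σ ^ 2 * (d : ℝ) with hV
  have hV0 : 0 < V := by positivity
  set pd := Real.exp (d * (-(1 / 20)))
  set px := 2 * Real.exp (-(x ^ 2 / 2))
  set pm := Real.exp (m * (-(1 / 20)))
  -- One union bound for each requirement of `Typical`. The inner products involving noise patches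
  -- are bounded only where the patch has norm square at most 2 V; the other case is counted in
  -- `b2`.
  have b1 : ν (⋃ i : Fin n, {ω | ‖ω.1 i‖ ^ 2 < V / 2}) ≤ ENNReal.ofReal (n * pd) := by
    have := measure_exists_le (ν := ν) (S := fun i : Fin n => {ω | ‖ω.1 i‖ ^ 2 < V / 2}) (p := pd)
      fun i => ((measurePreserving_noise d n m σ σ₀ i).measure_preimage
        (measurableSet_lt (by fun_prop) (by fun_prop)).nullMeasurableSet).trans_le
        (gaussianVec_norm_sq_lt (d := d) (σ := σ))
    simpa using this
  have b2 : ν (⋃ i : Fin n, {ω | 2 * V < ‖ω.1 i‖ ^ 2}) ≤ ENNReal.ofReal (n * pd) := by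
    have := measure_exists_le (ν := ν) (S := fun i : Fin n => {ω | 2 * V < ‖ω.1 i‖ ^ 2}) (p := pd)
      fun i => ((measurePreserving_noise d n m σ σ₀ i).measure_preimage
        (measurableSet_lt (by fun_prop) (by fun_prop)).nullMeasurableSet).trans_le
        (gaussianVec_norm_sq_gt (d := d) (σ := σ))
    simpa using this
  have b3 : ν (⋃ k : Bool × Fin m, {ω | 2 * (σ₀ ^ 2 * d) < ‖ω.2 k.1 k.2‖ ^ 2})
      ≤ ENNReal.ofReal (2 * m * pd) := by
    have := measure_exists_le (ν := ν)
      (S := fun k : Bool × Fin m => {ω | 2 * (σ₀ ^ 2 * d) < ‖ω.2 k.1 k.2‖ ^ 2}) (p := pd)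
      fun k => ((measurePreserving_init d n m σ σ₀ k.1 k.2).measure_preimage_le
        {v : Vec d | 2 * (σ₀ ^ 2 * d) < ‖v‖ ^ 2}).trans
        (gaussianVec_norm_sq_gt (d := d) (σ := σ₀))
    simpa using this
  have b4 : ν (⋃ k : Fin n × Fin n, {ω | k.1 ≠ k.2 ∧ (‖ω.1 k.1‖ ^ 2 ≤ 2 * V ∧
      x * (σ * √(2 * V)) < |inner ℝ (ω.1 k.1) (ω.1 k.2)|)}) ≤ ENNReal.ofReal (n * n * px) := by
    have := measure_exists_le (ν := ν)
      (S := fun k : Fin n × Fin n => {ω | k.1 ≠ k.2 ∧ (‖ω.1 k.1‖ ^ 2 ≤ 2 * V ∧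
        x * (σ * √(2 * V)) < |inner ℝ (ω.1 k.1) (ω.1 k.2)|)}) (p := px) fun k => by
        rcases eq_or_ne k.1 k.2 with hk | hk
        · simp [hk]
        · have h1 := (measurePreserving_noise_noise d n m σ σ₀ hk).measure_preimage_le
            {p : Vec d × Vec d | ‖p.1‖ ^ 2 ≤ 2 * V ∧ x * (σ * √(2 * V)) < |inner ℝ p.1 p.2|}
          refine le_trans (measure_mono fun ω hω => ?_) (h1.trans
            (gaussianVec_prod_lt_abs_inner hσ (by positivity) le_rfl hx))
          rw [Set.mem_ofPred_eq] at hω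
          exact hω.2
    simpa using this
  have b5 : ν (⋃ i : Fin n, {ω | x * (σ * ‖μ‖) < |inner ℝ μ (ω.1 i)|})
      ≤ ENNReal.ofReal (n * px) := by
    have h2 := gaussianVec_lt_abs_inner (σ := σ) (w := μ) (B := σ * ‖μ‖) (t := x * (σ * ‖μ‖))
      (by positivity) (by rw [abs_of_pos hσ]) (by positivity)
    have h3 : (x * (σ * ‖μ‖)) ^ 2 / (2 * (σ * ‖μ‖) ^ 2) = x ^ 2 / 2 := by field_simp
    rw [h3] at h2
    have := measure_exists_le (ν := ν)
      (S := fun i : Fin n => {ω | x * (σ * ‖μ‖) < |inner ℝ μ (ω.1 i)|}) (p := px)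
      fun i => ((measurePreserving_noise d n m σ σ₀ i).measure_preimage
        (measurableSet_lt (by fun_prop) (by fun_prop)).nullMeasurableSet).trans_le h2
    simpa using this
  have b6 : ν (⋃ k : (Bool × Fin m) × Fin n, {ω | ‖ω.1 k.2‖ ^ 2 ≤ 2 * V ∧
      x * (σ₀ * √(2 * V)) < |inner ℝ (ω.1 k.2) (ω.2 k.1.1 k.1.2)|})
      ≤ ENNReal.ofReal (2 * m * n * px) := by
    have := measure_exists_le (ν := ν)
      (S := fun k : (Bool × Fin m) × Fin n => {ω | ‖ω.1 k.2‖ ^ 2 ≤ 2 * V ∧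
        x * (σ₀ * √(2 * V)) < |inner ℝ (ω.1 k.2) (ω.2 k.1.1 k.1.2)|}) (p := px)
      fun k => ((measurePreserving_noise_init d n m σ σ₀ k.2 k.1.1 k.1.2).measure_preimage_le
        {p : Vec d × Vec d | ‖p.1‖ ^ 2 ≤ 2 * V ∧
          x * (σ₀ * √(2 * V)) < |inner ℝ p.1 p.2|}).trans
        (gaussianVec_prod_lt_abs_inner hσ₀ (by positivity) le_rfl hx)
    simpa using this
  have b7 : ν (⋃ k : Bool × Fin m, {ω | x * (σ₀ * ‖μ‖) < |inner ℝ μ (ω.2 k.1 k.2)|})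
      ≤ ENNReal.ofReal (2 * m * px) := by
    have h2 := gaussianVec_lt_abs_inner (σ := σ₀) (w := μ) (B := σ₀ * ‖μ‖) (t := x * (σ₀ * ‖μ‖))
      (by positivity) (by rw [abs_of_pos hσ₀]) (by positivity)
    have h3 : (x * (σ₀ * ‖μ‖)) ^ 2 / (2 * (σ₀ * ‖μ‖) ^ 2) = x ^ 2 / 2 := by field_simp
    rw [h3] at h2
    have := measure_exists_le (ν := ν)
      (S := fun k : Bool × Fin m => {ω | x * (σ₀ * ‖μ‖) < |inner ℝ μ (ω.2 k.1 k.2)|}) (p := px)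
      fun k => ((measurePreserving_init d n m σ σ₀ k.1 k.2).measure_preimage
        (measurableSet_lt (by fun_prop) (by fun_prop)).nullMeasurableSet).trans_le h2
    simpa using this
  have b8 : ν (⋃ k : Bool × Fin n, {ω |
      ((Finset.univ.filter fun r => 0 ≤ inner ℝ (ω.2 k.1 r) (ω.1 k.2)).card : ℝ) < (m : ℝ) / 4})
      ≤ ENNReal.ofReal (2 * n * pm) := by
    have := measure_exists_le (ν := ν) (S := fun k : Bool × Fin n => {ω |
      ((Finset.univ.filter fun r => 0 ≤ inner ℝ (ω.2 k.1 r) (ω.1 k.2)).card : ℝ) < (m : ℝ) / 4})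
      (p := pm)
      fun k => ((measurePreserving_noise_branch d n m σ σ₀ k.2 k.1).measure_preimage_le
        {p : Vec d × (Fin m → Vec d) |
          ((Finset.univ.filter fun r => 0 ≤ inner ℝ (p.2 r) p.1).card : ℝ) < (m : ℝ) / 4}).trans
        prod_pi_card_active_lt
    simpa using this
  have hsub : {ω | ¬ Typical μ σ τ ω.1 ω.2} ⊆
      (⋃ i : Fin n, {ω : (Fin n → Vec d) × Weights d m | ‖ω.1 i‖ ^ 2 < V / 2}) ∪
      (⋃ i : Fin n, {ω | 2 * V < ‖ω.1 i‖ ^ 2}) ∪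
      (⋃ k : Bool × Fin m, {ω | 2 * (σ₀ ^ 2 * d) < ‖ω.2 k.1 k.2‖ ^ 2}) ∪
      (⋃ k : Fin n × Fin n, {ω | k.1 ≠ k.2 ∧ (‖ω.1 k.1‖ ^ 2 ≤ 2 * V ∧
        x * (σ * √(2 * V)) < |inner ℝ (ω.1 k.1) (ω.1 k.2)|)}) ∪
      (⋃ i : Fin n, {ω | x * (σ * ‖μ‖) < |inner ℝ μ (ω.1 i)|}) ∪
      (⋃ k : (Bool × Fin m) × Fin n, {ω | ‖ω.1 k.2‖ ^ 2 ≤ 2 * V ∧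
        x * (σ₀ * √(2 * V)) < |inner ℝ (ω.1 k.2) (ω.2 k.1.1 k.1.2)|}) ∪
      (⋃ k : Bool × Fin m, {ω | x * (σ₀ * ‖μ‖) < |inner ℝ μ (ω.2 k.1 k.2)|}) ∪
      (⋃ k : Bool × Fin n, {ω |
        ((Finset.univ.filter fun r => 0 ≤ inner ℝ (ω.2 k.1 r) (ω.1 k.2)).card : ℝ)
          < (m : ℝ) / 4}) := by
    intro ω hω
    by_contra hc
    rw [Set.mem_ofPred_eq] at hω
    apply hω
    simp only [Set.mem_union, Set.mem_iUnion, Set.mem_ofPred_eq, not_or, not_exists, not_and,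
      not_lt, Prod.forall, ne_eq] at hc
    obtain ⟨⟨⟨⟨⟨⟨⟨h1, h2⟩, h3⟩, h4⟩, h5⟩, h6⟩, h7⟩, h8⟩ := hc
    refine ⟨h1, h2, fun i k hik => ?_, fun i => ?_, fun j r i => ?_, fun j r => ?_, fun j r => ?_,
      fun j i => h8 j i⟩
    · exact (mul_le_mul_of_nonneg_left (h4 i k hik (h2 i)) (Nat.cast_nonneg n)).trans h_noise
    · exact (mul_le_mul_of_nonneg_left (h5 i) (Nat.cast_nonneg n)).trans h_signal
    · rw [real_inner_comm]
      exact (h6 j r i (h2 i)).trans h_init_noise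
    · rw [real_inner_comm]
      exact (h7 j r).trans h_init_signal
    · refine le_trans ?_ h_init_norm
      gcongr
      exact Real.le_sqrt_of_sq_le (h3 j r)
  refine (measure_mono hsub).trans ?_
  have hpd : 0 ≤ pd := (Real.exp_pos _).le
  have hpm : 0 ≤ pm := (Real.exp_pos _).le
  have hpx : 0 ≤ px := mul_nonneg zero_le_two (Real.exp_pos _).le
  rw [show (2 * n + 2 * m) * pd + (n * n + n + 2 * m * n + 2 * m) * px + 2 * n * pm
    = n * pd + n * pd + 2 * m * pd + n * n * px + n * px + 2 * m * n * px + 2 * m * px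
      + 2 * n * pm by ring]
  iterate 7 rw [ENNReal.ofReal_add (by positivity) (by positivity)]
  refine (measure_union_le _ _).trans (add_le_add ?_ b8)
  refine (measure_union_le _ _).trans (add_le_add ?_ b7)
  refine (measure_union_le _ _).trans (add_le_add ?_ b6)
  refine (measure_union_le _ _).trans (add_le_add ?_ b5)
  refine (measure_union_le _ _).trans (add_le_add ?_ b4)
  refine (measure_union_le _ _).trans (add_le_add ?_ b3)
  exact (measure_union_le _ _).trans (add_le_add b1 b2)

/-- Random labels have classes of comparable size. -/
lemma labelLaw_card_lt (n : ℕ) (j : Bool) :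
    labelLaw n {y | ((Finset.univ.filter fun i => y i = j).card : ℝ) < (n : ℝ) / 4}
      ≤ ENNReal.ofReal (Real.exp (n * (-(1 / 20)))) := by
  have hj : 1 / 2 ≤ rademacher {j} := by
    rw [rademacher, uniformOn_univ]
    simp
  have h1 := measure_pi_card_lt (ι := Fin n) rademacher (A := {j}) (MeasurableSet.singleton j) hj
  rw [Fintype.card_fin] at h1
  simpa [labelLaw] using h1

/-! ### Test error -/

lemma sgn_mul_network (W : Weights d m) (μ v : Vec d) (y : Bool) :
    sgn y * network W (dataPoint μ y v) = (1 / (m : ℝ)) * ∑ r,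
      (relu (sgn y * inner ℝ (W y r) μ) - relu (-(sgn (!y) * inner ℝ (W (!y) r) μ))
        + (relu (inner ℝ (W y r) v) - relu (inner ℝ (W (!y) r) v))) := by
  unfold network branch dataPoint
  rw [← mul_sub, ← Finset.sum_sub_distrib, mul_left_comm, Finset.mul_sum (a := sgn y)]
  congr 1
  refine Finset.sum_congr rfl fun r _ => ?_
  cases y <;> simp [sgn] <;> ring

/-- The test error is small if the signal correlations exceed the memorized noise by a multiple of
the norm of the weights. -/
lemma testError_le {μ : Vec d} {σ : ℝ} {ξ : Fin n → Vec d} {W : Weights d m} {θ θ₁ B : ℝ}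
    (hn : 0 < n) (hσ : 0 < σ) (hB : 0 < B) (hθ : 0 ≤ θ) (hθ₁ : 0 ≤ θ₁)
    (hP : ∀ j r, θ₁ + θ ≤ sgn j * inner ℝ (W j r) μ)
    (hq : ∀ j r i, inner ℝ (W j r) (ξ i) ≤ θ₁) (hW : ∀ j r, σ * ‖W j r‖ ≤ B) :
    testError μ σ ξ W ≤ ENNReal.ofReal (2 * m * Real.exp (-(θ ^ 2 / (2 * B ^ 2)))) := by
  have : Nonempty (Fin n) := ⟨⟨0, hn⟩⟩
  have : IsProbabilityMeasure (uniformOn (Set.univ : Set (Fin n))) :=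
    isProbabilityMeasure_uniformOn Set.finite_univ Set.univ_nonempty
  set ν := rademacher.prod ((uniformOn (Set.univ : Set (Fin n))).prod (gaussianVec d σ)) with hν
  have hpres : MeasurePreserving (fun p : Bool × Fin n × Vec d => p.2.2) ν (gaussianVec d σ) :=
    (measurePreserving_snd (μ := uniformOn (Set.univ : Set (Fin n))) (ν := gaussianVec d σ)).comp
      (measurePreserving_snd (μ := rademacher)
        (ν := (uniformOn (Set.univ : Set (Fin n))).prod (gaussianVec d σ)))
  have hb := measure_exists_le (ν := ν)
    (S := fun k : Bool × Fin m => {p | θ ≤ inner ℝ (W k.1 k.2) p.2.2})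
    (p := Real.exp (-(θ ^ 2 / (2 * B ^ 2)))) fun k =>
      (hpres.measure_preimage_le {x | θ ≤ inner ℝ (W k.1 k.2) x}).trans
        (gaussianVec_le_inner hB (by rw [abs_of_pos hσ]; exact hW _ _) hθ)
  have hcard : ((Fintype.card (Bool × Fin m) : ℕ) : ℝ) = 2 * m := by simp
  rw [hcard] at hb
  refine le_trans (measure_mono fun p hp => ?_) hb
  by_contra hc
  simp only [Set.mem_iUnion, Set.mem_ofPred_eq, not_exists, not_le, Prod.forall] at hc
  rw [Set.mem_ofPred_eq, sgn_mul_network] at hp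
  refine absurd hp (not_lt.2 (mul_nonneg (by positivity) (Finset.sum_nonneg fun r _ => ?_)))
  -- The margin is nonnegative neuron by neuron: the signal response is at least θ₁ + θ, the
  -- opposite branch is silent on the signal, and its noise response is at most the memorized θ₁
  -- plus a fluctuation below θ. The noise response of the own branch is only helpful.
  have h1 := (hP p.1 r).trans (le_relu _)
  have h2 : relu (-(sgn (!p.1) * inner ℝ (W (!p.1) r) μ)) = 0 :=
    relu_of_nonpos (by linarith [hP (!p.1) r])
  have h3 := relu_nonneg (inner ℝ (W p.1 r) (ξ p.2.1 + p.2.2))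
  have h4 : relu (inner ℝ (W (!p.1) r) (ξ p.2.1 + p.2.2)) ≤ θ₁ + θ := by
    refine max_le (by linarith) ?_
    rw [inner_add_right]
    linarith [hq (!p.1) r p.2.1, hc (!p.1) r]
  linarith

/-! ### The outcome of training on typical data -/

lemma logisticLoss_le (f : ℝ) (y : Bool) : logisticLoss f y ≤ Real.exp (-(sgn y * f)) := by
  unfold logisticLoss
  rw [mul_comm]
  have := Real.log_le_sub_one_of_pos (x := 1 + Real.exp (-(sgn y * f))) (by positivity)
  linarith

lemma trainLoss_le {μ : Vec d} {y : Fin n → Bool} {ξ : Fin n → Vec d} {W : Weights d m} {ε : ℝ}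
    (hn : 0 < n)
    (h : ∀ i, Real.exp (-(sgn (y i) * network W (dataPoint μ (y i) (ξ i)))) ≤ ε) :
    trainLoss μ y ξ W ≤ ε := by
  have hn' : (0 : ℝ) < n := by exact_mod_cast hn
  unfold trainLoss
  rw [one_div, inv_mul_le_iff₀ hn']
  simpa using Finset.sum_le_sum (s := Finset.univ) fun i _ => (logisticLoss_le _ (y i)).trans (h i)

theorem Typical.outcome {μ : Vec d} {σ η τ ε c₁ c₂ b : ℝ} {y : Fin n → Bool} {ξ : Fin n → Vec d}
    {W₀ : Weights d m} {T₁ T₁' Tstar : ℕ} (h : Typical μ σ τ ξ W₀) (hn : 0 < n) (hm : 0 < m)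
    (hd : 0 < d) (hσ : 0 < σ) (hη : 0 < η) (hτ : 0 < τ) (hε : 0 < ε)
    (hy : ∀ j, (n : ℝ) / 4 ≤ (Finset.univ.filter fun i => y i = j).card)
    (hs : Small c₁ b (η * (σ ^ 2 * d) / (n * m)) (n * ‖μ‖ ^ 2 / (σ ^ 2 * d)) τ)
    (hc₂ : n * ‖μ‖ ^ 2 / (σ ^ 2 * d) ≤ c₂) (hm_le : 2 * (m : ℝ) ≤ Real.exp ((d : ℝ) / n))
    (hT₁ : 100 ≤ η * (σ ^ 2 * d) / (n * m) * T₁) (hT : T₁ ≤ T₁') (hT' : T₁' ≤ Tstar)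
    (hT₁ε : 48 / ε ≤ η * (σ ^ 2 * d) / (n * m) * T₁')
    (hT₁b : 2 * b + 2 ≤ η * (σ ^ 2 * d) / (n * m) * T₁')
    (hT₁L : 40 ≤ Real.log (η * (σ ^ 2 * d) / (n * m) * T₁')) :
    Outcome μ σ η ε (10 ^ 12 * c₂) T₁ T₁' Tstar y ξ W₀ := by
  have hn' : (0 : ℝ) < n := by exact_mod_cast hn
  have hm' : (0 : ℝ) < m := by exact_mod_cast hm
  have hd' : (0 : ℝ) < d := by exact_mod_cast hd
  have hR := h.regular hn hm hd hσ hη hτ hy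
  set s := η * (σ ^ 2 * d) / (n * m) with hsdef
  set κ := n * ‖μ‖ ^ 2 / (σ ^ 2 * d) with hκdef
  set D := correlations μ η y ξ W₀ with hD
  have hκ0 := hs.κ_pos
  have hs0 : 0 < s := hR.s_pos
  have hfit : ∀ t : ℕ, T₁ ≤ t → ∀ i,
      0 ≤ sgn (y i) * network (gd μ η y ξ W₀ t) (dataPoint μ (y i) (ξ i)) := by
    intro t ht i
    rw [← margin_correlations, ← Real.one_le_exp_iff]
    -- Since s T₁ ≥ 100, the lower bound 1/2 + s t / 48 exceeds 1.
    have h1 := (hR.invariant hs t).lower i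
    have h2 : s * T₁ ≤ s * t := by gcongr
    linarith
  refine ⟨fun t ht _ i => hfit t ht i, T₁', le_rfl, hT', ?_, hfit T₁' hT, ?_⟩
  · refine trainLoss_le hn fun i => ?_
    rw [← margin_correlations, Real.exp_neg]
    have h1 := (hR.invariant hs T₁').lower i
    refine inv_le_of_inv_le₀ hε ?_
    rw [div_eq_mul_inv] at hT₁ε
    linarith
  · have hexp : (d : ℝ) / n - n * ‖μ‖ ^ 4 / (10 ^ 12 * c₂ * σ ^ 4 * d)
        = d / n * (1 - κ ^ 2 / (10 ^ 12 * c₂)) := by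
      rw [hκdef]
      have : 0 < c₂ := hκ0.trans_le hc₂
      field_simp
    rw [hexp]
    have hc₂0 : 0 < c₂ := hκ0.trans_le hc₂
    -- For a weak signal the exponent is nonnegative and the bound is trivial; otherwise κ ≤ c₂
    -- forces κ ≥ 10¹².
    rcases le_or_gt (κ ^ 2) (10 ^ 12 * c₂) with hsmall | hlarge
    · have h1 : (1 : ℝ) ≤ Real.exp (d / n * (1 - κ ^ 2 / (10 ^ 12 * c₂))) := by
        refine Real.one_le_exp (mul_nonneg (by positivity) (sub_nonneg.2 ?_))
        rw [div_le_one (by positivity)]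
        exact hsmall
      have : Nonempty (Fin n) := ⟨⟨0, hn⟩⟩
      have : IsProbabilityMeasure (uniformOn (Set.univ : Set (Fin n))) :=
        isProbabilityMeasure_uniformOn Set.finite_univ Set.univ_nonempty
      exact (prob_le_one).trans (ENNReal.one_le_ofReal.2 h1)
    · have hκ : 10 ^ 12 ≤ κ := by
        by_contra hlt
        have h1 : κ * κ ≤ 10 ^ 12 * c₂ :=
          mul_le_mul (not_le.1 hlt).le hc₂ hκ0.le (by norm_num)
        rw [← sq] at h1
        linarith
      obtain ⟨hP, hΓ⟩ := hR.late_bounds hs (by linarith) hT₁b hT₁L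
      set L := Real.log (s * T₁') with hL
      -- Hence the memorized noise τ + 3 Γ stays below L / 16, half of the signal bound L / 8; the
      -- other half is left for the fresh perturbation.
      have hΓ' : 10000 * L / κ ≤ L / 100 := by
        rw [div_le_div_iff₀ hκ0 (by norm_num)]
        nlinarith
      have hτ1 : τ ≤ 1 / 40 := by nlinarith [hs.τ_le, hs.b_ge]
      have hrtκ : 0 < √κ := Real.sqrt_pos.2 hκ0
      have hrt : √κ * √κ = κ := Real.mul_self_sqrt hκ0.le
      have hrt2 : 2 ≤ √κ := Real.le_sqrt_of_sq_le (by linarith)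
      have hτκ : τ ≤ 10000 * L / √κ := by
        rw [le_div_iff₀ hrtκ]
        have h1 : √κ ≤ κ := by nlinarith
        have h2 : τ * √κ ≤ τ * κ := by gcongr
        have h3 : τ * κ ≤ τ * b := mul_le_mul_of_nonneg_left (by linarith [hs.κ_le]) hτ.le
        linarith [hs.τ_le]
      have hnd : 0 < √((n : ℝ) / d) := by positivity
      have hWB : ∀ j r, σ * ‖gd μ η y ξ W₀ T₁' j r‖
          ≤ √((n : ℝ) / d) * (30000 * L / √κ) := fun j r => by
        refine (h.norm_gd_le hn hm hd hσ hη (by linarith)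
          (by positivity : 0 ≤ 10000 * L / κ) hΓ j r).trans ?_
        gcongr
        have h1 : (2 + √κ) * (10000 * L / κ) ≤ 2 * √κ * (10000 * L / κ) := by
          gcongr
          linarith
        have h2 : 2 * √κ * (10000 * L / κ) = 20000 * L / √κ := by
          rw [mul_div_assoc', div_eq_div_iff hκ0.ne' hrtκ.ne']
          linear_combination 20000 * L * hrt
        have h3 : 10000 * L / √κ + 20000 * L / √κ = 30000 * L / √κ := by ring
        linarith
      refine (testError_le (θ := L / 16) (θ₁ := L / 16) hn hσ (by positivity) (by positivity)
        (by positivity) (fun j r => ?_) (fun j r i => ?_) hWB).trans ?_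
      · have h1 : L / 8 ≤ sgn j * inner ℝ (gd μ η y ξ W₀ T₁' j r) μ := hP j r
        linarith
      · have h1 : inner ℝ (gd μ η y ξ W₀ T₁' j r) (ξ i) ≤ τ + 3 * D.accGrad s T₁' i :=
          hR.q_le_accGrad hs T₁' j r i
        linarith [hΓ i]
      · refine ENNReal.ofReal_le_ofReal ?_
        have hsq : (√((n : ℝ) / d) * (30000 * L / √κ)) ^ 2 = n / d * ((30000 * L) ^ 2 / κ) := by
          rw [mul_pow, div_pow, Real.sq_sqrt (by positivity), Real.sq_sqrt hκ0.le]
        -- Signal and weight norm both scale with L, which cancels; 460800000000 = 2 · 16² · 30000².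
        have hexp1 : (L / 16) ^ 2 / (2 * (√((n : ℝ) / d) * (30000 * L / √κ)) ^ 2)
            = d / n * (κ / 460800000000) := by
          rw [hsq]
          have : L ≠ 0 := by linarith
          field_simp
          norm_num
        rw [hexp1]
        have hdn : 0 < (d : ℝ) / n := by positivity
        calc 2 * (m : ℝ) * Real.exp (-(d / n * (κ / 460800000000)))
            ≤ Real.exp ((d : ℝ) / n) * Real.exp (-(d / n * (κ / 460800000000))) := by gcongr
          _ = Real.exp (d / n * (1 - κ / 460800000000)) := by
              rw [← Real.exp_add]
              congr 1
              ring
          _ ≤ _ := by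
              refine Real.exp_le_exp.2 (mul_le_mul_of_nonneg_left ?_ hdn.le)
              -- The exponent obtained is linear in κ; κ ≤ c₂ converts it to the quadratic form of
              -- the claim.
              have h1 : κ ^ 2 / (10 ^ 12 * c₂) ≤ κ / 10 ^ 12 := by
                rw [div_le_div_iff₀ (by positivity) (by positivity)]
                have h0 := mul_le_mul_of_nonneg_left hc₂ hκ0.le
                rw [sq]
                linarith
              have h2 : κ / 10 ^ 12 ≤ κ / 460800000000 := by
                gcongr
                norm_num
              linarith

/-! ### Consequences of the standing condition -/

namespace Condition

variable {C c₁ c₂ : ℝ} {Tstar : ℕ} {μ : Vec d} {σ σ₀ η ε δ : ℝ}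

lemma n_pos (h : Condition C c₁ c₂ d n m Tstar μ σ σ₀ η ε δ) : 0 < n :=
  lt_of_lt_of_le two_pos h.two_le_n

lemma two_le_n_real (h : Condition C c₁ c₂ d n m Tstar μ σ σ₀ η ε δ) : (2 : ℝ) ≤ n := by
  exact_mod_cast h.two_le_n

lemma signal_eq (h : Condition C c₁ c₂ d n m Tstar μ σ σ₀ η ε δ) :
    n * SNR μ σ ^ 2 = n * ‖μ‖ ^ 2 / (σ ^ 2 * d) := by
  have := h.σξ_pos
  unfold SNR
  rw [div_pow, mul_pow, Real.sq_sqrt (Nat.cast_nonneg d)]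
  ring

lemma signal_pos (h : Condition C c₁ c₂ d n m Tstar μ σ σ₀ η ε δ) (hc₁ : 0 < c₁) :
    0 < n * ‖μ‖ ^ 2 / (σ ^ 2 * d) := by
  rw [← h.signal_eq]
  exact hc₁.trans_le h.snr_ge

lemma d_pos (h : Condition C c₁ c₂ d n m Tstar μ σ σ₀ η ε δ) (hc₁ : 0 < c₁) : 0 < d := by
  rcases Nat.eq_zero_or_pos d with hd | hd
  · have h1 := h.signal_pos hc₁
    simp [hd] at h1
  · exact hd

lemma μ_ne_zero (h : Condition C c₁ c₂ d n m Tstar μ σ σ₀ η ε δ) (hc₁ : 0 < c₁) : μ ≠ 0 := by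
  rintro rfl
  have h1 := h.signal_pos hc₁
  simp at h1

lemma one_half_le_log (h : Condition C c₁ c₂ d n m Tstar μ σ σ₀ η ε δ) :
    1 / 2 ≤ Real.log (n / δ) := by
  have h1 : (2 : ℝ) ≤ n / δ := by
    rw [le_div_iff₀ h.δ_pos]
    nlinarith [h.two_le_n_real, h.δ_lt_one, h.δ_pos]
  have h2 := Real.log_le_log two_pos h1
  linarith [Real.log_two_gt_d9]

lemma m_ge_mul (h : Condition C c₁ c₂ d n m Tstar μ σ σ₀ η ε δ) (hC : 160 ≤ C) :
    160 * Real.log (n / δ) ≤ m :=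
  (mul_le_mul_of_nonneg_right hC (by linarith [h.one_half_le_log])).trans h.m_ge

lemma four_le_m (h : Condition C c₁ c₂ d n m Tstar μ σ σ₀ η ε δ) (hC : 160 ≤ C) :
    (4 : ℝ) ≤ m := by
  linarith [h.one_half_le_log, h.m_ge_mul hC]

lemma m_pos (h : Condition C c₁ c₂ d n m Tstar μ σ σ₀ η ε δ) (hC : 160 ≤ C) : 0 < m := by
  have : (0 : ℝ) < m := by linarith [h.four_le_m hC]
  exact_mod_cast this

lemma two_mul_m_le (h : Condition C c₁ c₂ d n m Tstar μ σ σ₀ η ε δ) :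
    2 * (m : ℝ) ≤ n * m / δ := by
  rw [le_div_iff₀ h.δ_pos]
  have h1 : 2 * (m : ℝ) * δ ≤ 2 * m * 1 := by
    gcongr
    exact h.δ_lt_one.le
  nlinarith [h.two_le_n_real, (Nat.cast_nonneg m : (0 : ℝ) ≤ m)]

lemma one_le_log (h : Condition C c₁ c₂ d n m Tstar μ σ σ₀ η ε δ) (hC : 160 ≤ C) :
    1 ≤ Real.log (n * m / δ) := by
  rw [Real.le_log_iff_exp_le (by linarith [h.two_mul_m_le, h.four_le_m hC])]
  linarith [h.two_mul_m_le, h.four_le_m hC, Real.exp_one_lt_d9]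

/-- The product s t is therefore time measured in units of the time scale. -/
lemma timeScale_mul (h : Condition C c₁ c₂ d n m Tstar μ σ σ₀ η ε δ) (hc₁ : 0 < c₁)
    (hC : 160 ≤ C) : η * (σ ^ 2 * d) / (n * m) * timeScale d n m σ η = 1 := by
  have h1 := h.σξ_pos
  have h2 := h.η_pos
  have h3 : (0 : ℝ) < n := by exact_mod_cast h.n_pos
  have h4 : (0 : ℝ) < m := by exact_mod_cast h.m_pos hC
  have h5 : (0 : ℝ) < d := by exact_mod_cast h.d_pos hc₁
  unfold timeScale
  field_simp

lemma step_pos (h : Condition C c₁ c₂ d n m Tstar μ σ σ₀ η ε δ) (hc₁ : 0 < c₁)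
    (hC : 160 ≤ C) : 0 < η * (σ ^ 2 * d) / (n * m) := by
  have h1 := h.σξ_pos
  have h2 := h.η_pos
  have h3 : (0 : ℝ) < n := by exact_mod_cast h.n_pos
  have h4 : (0 : ℝ) < m := by exact_mod_cast h.m_pos hC
  have h5 : (0 : ℝ) < d := by exact_mod_cast h.d_pos hc₁
  positivity

lemma step_mul_le_one (h : Condition C c₁ c₂ d n m Tstar μ σ σ₀ η ε δ) (hc₁ : 0 < c₁)
    (hC : 160 ≤ C) : C * (η * (σ ^ 2 * d) / (n * m)) ≤ 1 := by
  have h1 := h.σξ_pos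
  have h2 := h.η_pos
  have h3 : (0 : ℝ) < n := by exact_mod_cast h.n_pos
  have h4 := h.four_le_m hC
  have h5 : (0 : ℝ) < d := by exact_mod_cast h.d_pos hc₁
  have h6 : η ≤ C⁻¹ * ((σ ^ 2)⁻¹ * (d : ℝ)⁻¹ * n) :=
    h.η_le.trans (mul_le_mul_of_nonneg_left (min_le_right _ _) (by positivity))
  calc C * (η * (σ ^ 2 * d) / (n * m))
      ≤ C * (C⁻¹ * ((σ ^ 2)⁻¹ * (d : ℝ)⁻¹ * n) * (σ ^ 2 * d) / (n * m)) := by gcongr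
    _ = 1 / (m : ℝ) := by field_simp
    _ ≤ 1 := by
        rw [div_le_one (by linarith)]
        linarith

lemma timeScale_ge (h : Condition C c₁ c₂ d n m Tstar μ σ σ₀ η ε δ) (hc₁ : 0 < c₁)
    (hC : 160 ≤ C) : C ≤ timeScale d n m σ η := by
  have h1 := h.timeScale_mul hc₁ hC
  have h2 := h.step_pos hc₁ hC
  have h3 := h.step_mul_le_one hc₁ hC
  rw [← h1, mul_comm] at h3
  exact le_of_mul_le_mul_left h3 h2

lemma one_le_inv_ε (h : Condition C c₁ c₂ d n m Tstar μ σ σ₀ η ε δ) : 1 ≤ ε⁻¹ :=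
  (one_le_inv₀ h.ε_pos).2 h.ε_le_one

lemma timeScale_le (h : Condition C c₁ c₂ d n m Tstar μ σ σ₀ η ε δ) (hc₁ : 0 < c₁)
    (hC : 160 ≤ C) : timeScale d n m σ η ≤ ε⁻¹ * timeScale d n m σ η :=
  le_mul_of_one_le_left (by linarith [h.timeScale_ge hc₁ hC]) h.one_le_inv_ε

lemma one_le_log_Tstar (h : Condition C c₁ c₂ d n m Tstar μ σ σ₀ η ε δ) (hc₁ : 0 < c₁)
    (hC : 160 ≤ C) : 1 ≤ Real.log Tstar := by
  have h1 := h.timeScale_ge hc₁ hC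
  have h2 := h.timeScale_le hc₁ hC
  have h3 : (3 : ℝ) ≤ Tstar := by
    refine le_trans ?_ h.Tstar_ge
    nlinarith
  rw [Real.le_log_iff_exp_le (by linarith)]
  linarith [Real.exp_one_lt_d9]

/-- The dimension dominates all logarithmic factors. -/
lemma d_ge_mul (h : Condition C c₁ c₂ d n m Tstar μ σ σ₀ η ε δ) (hc₁ : 0 < c₁)
    (hC : 160 ≤ C) : C * ((n : ℝ) ^ 2 * Real.log (n * m / δ)) ≤ d := by
  have h1 := h.one_le_log hC
  have h2 := h.one_le_log_Tstar hc₁ hC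
  refine le_trans (mul_le_mul_of_nonneg_left ?_ (by linarith)) h.d_ge
  refine le_trans ?_ (le_max_left _ _)
  refine le_mul_of_one_le_right (by positivity) ?_
  nlinarith

lemma two_mul_m_le_exp (h : Condition C c₁ c₂ d n m Tstar μ σ σ₀ η ε δ) (hc₁ : 0 < c₁)
    (hC : 160 ≤ C) : 2 * (m : ℝ) ≤ Real.exp ((d : ℝ) / n) := by
  have h1 := h.one_le_log hC
  have hn := h.two_le_n_real
  have hm := h.four_le_m hC
  refine h.two_mul_m_le.trans ?_
  rw [← Real.log_le_iff_le_exp (by linarith [h.two_mul_m_le]), le_div_iff₀ (by linarith)]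
  refine le_trans ?_ (h.d_ge_mul hc₁ hC)
  have h2 : Real.log (n * m / δ) * n ≤ Real.log (n * m / δ) * n ^ 2 := by
    gcongr
    nlinarith
  nlinarith [mul_nonneg (sq_nonneg (n : ℝ)) (show 0 ≤ Real.log (n * m / δ) by linarith)]

lemma small (h : Condition C c₁ c₂ d n m Tstar μ σ σ₀ η ε δ) (hc₁ : 0 < c₁)
    (hC : 160 ≤ C) {b τ : ℝ} (hb : b = 400 * c₂ + 6) (hCb : 40 * b ≤ C) (hτ0 : 0 < τ)
    (hτ : 3840 * b * τ ≤ 1) (hτ' : 3840 * b * τ ≤ c₁) :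
    Small c₁ b (η * (σ ^ 2 * d) / (n * m)) (n * ‖μ‖ ^ 2 / (σ ^ 2 * d)) τ := by
  have h1 : c₁ ≤ n * ‖μ‖ ^ 2 / (σ ^ 2 * d) := h.signal_eq ▸ h.snr_ge
  have h2 : n * ‖μ‖ ^ 2 / (σ ^ 2 * d) ≤ c₂ := h.signal_eq ▸ h.snr_le
  have hb6 : 6 ≤ b := by linarith
  refine ⟨hc₁, h1, by linarith, by linarith, by nlinarith, ?_⟩
  -- Each of the three terms of `burnIn_le` is at most 1/40. The factor 3840 = 2 · 96 · 20 in the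
  -- hypotheses on τ is the one needed for `τ_le`.
  have h3 : b * (48 * τ / c₁) ≤ 1 / 40 := by
    rw [mul_div_assoc', div_le_div_iff₀ hc₁ (by norm_num)]
    nlinarith
  have h4 : b * (η * (σ ^ 2 * d) / (n * m)) ≤ 1 / 40 := by
    have h5 := h.step_mul_le_one hc₁ hC
    have h6 := mul_le_mul_of_nonneg_right hCb (h.step_pos hc₁ hC).le
    linarith
  have h7 : τ ≤ 1 / 160 := by nlinarith
  linarith

/-- Each exponential is at most the eighth power of δ/(nm) or δ/n, which beats the polynomial number
of events: δ⁸ ≤ δ, and z⁸ ≥ 64 z² for z ≥ 2. The activity events number only 2n, so powers of δ/n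
suffice for them. -/
lemma tail_sum_le (h : Condition C c₁ c₂ d n m Tstar μ σ σ₀ η ε δ) (hc₁ : 0 < c₁)
    (hC : 160 ≤ C) :
    (2 * n + 2 * m) * Real.exp (d * (-(1 / 20)))
        + (n * n + n + 2 * m * n + 2 * m)
          * (2 * Real.exp (-((4 * √(Real.log (n * m / δ))) ^ 2 / 2)))
        + 2 * n * Real.exp (m * (-(1 / 20))) ≤ δ / 2 := by
  have hδ := h.δ_pos
  have hn2 := h.two_le_n_real
  have hm4 := h.four_le_m hC
  have hn : (0 : ℝ) < n := by linarith
  have hm : (0 : ℝ) < m := by linarith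
  have hΛ := h.one_le_log hC
  have hdΛ : 160 * Real.log (n * m / δ) ≤ d := by
    refine le_trans ?_ (h.d_ge_mul hc₁ hC)
    refine mul_le_mul hC ?_ (by linarith) (by linarith)
    exact le_mul_of_one_le_left (by linarith) (by nlinarith)
  have hx2 : (4 * √(Real.log (n * m / δ))) ^ 2 = 16 * Real.log (n * m / δ) := by
    rw [mul_pow, Real.sq_sqrt (by linarith)]
    norm_num
  have hq : ∀ z : ℝ, 0 < z → ∀ u : ℝ, 8 * Real.log (z / δ) ≤ u → Real.exp (-u) ≤ (δ / z) ^ 8 := by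
    intro z hz u hu
    calc Real.exp (-u) ≤ Real.exp ((8 : ℕ) * -Real.log (z / δ)) :=
          Real.exp_le_exp.2 (by push_cast; linarith)
      _ = (δ / z) ^ 8 := by
          rw [Real.exp_nat_mul, Real.exp_neg, Real.exp_log (by positivity), inv_div]
  have e1 : Real.exp (d * (-(1 / 20))) ≤ (δ / (n * m)) ^ 8 := by
    rw [show (d : ℝ) * (-(1 / 20)) = -(d / 20) by ring]
    refine hq _ (by positivity) _ ?_
    linarith
  have e2 : Real.exp (-((4 * √(Real.log (n * m / δ))) ^ 2 / 2)) ≤ (δ / (n * m)) ^ 8 := by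
    refine hq _ (by positivity) _ ?_
    rw [hx2]
    linarith
  have e3 : Real.exp (m * (-(1 / 20))) ≤ (δ / n) ^ 8 := by
    rw [show (m : ℝ) * (-(1 / 20)) = -(m / 20) by ring]
    refine hq _ (by positivity) _ ?_
    linarith [h.m_ge_mul hC]
  have hpow : ∀ z : ℝ, 2 ≤ z → (δ / z) ^ 8 ≤ δ / (64 * z ^ 2) := by
    intro z hz
    rw [div_pow]
    have h1 : δ ^ 8 ≤ δ := by
      simpa using pow_le_pow_of_le_one hδ.le h.δ_lt_one.le (show 1 ≤ 8 by norm_num)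
    have h2 : 64 * z ^ 2 ≤ z ^ 8 := by
      have : (2 : ℝ) ^ 6 ≤ z ^ 6 := by gcongr
      calc 64 * z ^ 2 = 2 ^ 6 * z ^ 2 := by norm_num
        _ ≤ z ^ 6 * z ^ 2 := by gcongr
        _ = z ^ 8 := by ring
    gcongr
  have hnm : 2 ≤ (n : ℝ) * m := by nlinarith
  have p1 := hpow _ hnm
  have p2 := hpow _ hn2
  have hcount : (2 * n + 2 * m) + (n * n + n + 2 * m * n + 2 * m) * 2 ≤ 16 * ((n : ℝ) * m) ^ 2 := by
    have g1 : (n : ℝ) ≤ n * m := le_mul_of_one_le_right hn.le (by linarith)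
    have g2 : (m : ℝ) ≤ n * m := le_mul_of_one_le_left hm.le (by linarith)
    have g3 : (n : ℝ) * m ≤ (n * m) ^ 2 := by nlinarith
    have g4 : (n : ℝ) * n ≤ (n * m) ^ 2 := by nlinarith
    linarith
  calc _ ≤ (2 * n + 2 * m) * (δ / (n * m)) ^ 8
        + (n * n + n + 2 * m * n + 2 * m) * (2 * (δ / (n * m)) ^ 8)
        + 2 * n * (δ / n) ^ 8 := by gcongr
    _ = ((2 * n + 2 * m) + (n * n + n + 2 * m * n + 2 * m) * 2) * (δ / (n * m)) ^ 8
        + 2 * n * (δ / n) ^ 8 := by ring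
    _ ≤ 16 * ((n : ℝ) * m) ^ 2 * (δ / (64 * (n * m) ^ 2)) + 2 * n * (δ / (64 * n ^ 2)) := by gcongr
    _ = δ / 4 + δ / (32 * n) := by field_simp; ring
    _ ≤ δ / 4 + δ / (32 * 1) := by
        gcongr
        linarith
    _ ≤ δ / 2 := by linarith

lemma σ₀_sq_le (h : Condition C c₁ c₂ d n m Tstar μ σ σ₀ η ε δ) (hC : 160 ≤ C) :
    σ₀ ^ 2 ≤ n / (C ^ 2 * σ ^ 2 * d ^ 2) := by
  have hσ₀ := h.σ₀_pos
  have hσ₀le : σ₀ ≤ C⁻¹ * (√(n : ℝ) * σ⁻¹ * (d : ℝ)⁻¹) :=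
    h.σ₀_le.trans (mul_le_mul_of_nonneg_left (min_le_left _ _) (by positivity))
  calc σ₀ ^ 2 ≤ (C⁻¹ * (√(n : ℝ) * σ⁻¹ * (d : ℝ)⁻¹)) ^ 2 := by gcongr
    _ = √(n : ℝ) ^ 2 / (C ^ 2 * σ ^ 2 * d ^ 2) := by field_simp
    _ = _ := by rw [Real.sq_sqrt (Nat.cast_nonneg n)]

/-- Atypical data have small probability. -/
lemma not_typical_le (h : Condition C c₁ c₂ d n m Tstar μ σ σ₀ η ε δ) (hc₁ : 0 < c₁)
    (hC : 160 ≤ C) {τ : ℝ} (hτ0 : 0 < τ) (hCτ : 32 + 16 * c₂ ≤ C * τ ^ 2) :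
    ((noiseLaw d n σ).prod (initLaw d m σ₀)) {ω | ¬ Typical μ σ τ ω.1 ω.2}
      ≤ ENNReal.ofReal (δ / 2) := by
  have hσ := h.σξ_pos
  have hσ₀ := h.σ₀_pos
  have hδ := h.δ_pos
  have hn2 := h.two_le_n_real
  have hm4 := h.four_le_m hC
  have hn : (0 : ℝ) < n := by linarith
  have hm : (0 : ℝ) < m := by linarith
  have hd : (0 : ℝ) < d := by exact_mod_cast h.d_pos hc₁
  have hΛ := h.one_le_log hC
  have hdΛ := h.d_ge_mul hc₁ hC
  set Λ := Real.log (n * m / δ) with hΛdef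
  have hκ0 := h.signal_pos hc₁
  have hκ2 : n * ‖μ‖ ^ 2 / (σ ^ 2 * d) ≤ c₂ := h.signal_eq ▸ h.snr_le
  set κ := n * ‖μ‖ ^ 2 / (σ ^ 2 * d) with hκdef
  have hμ2 : ‖μ‖ ^ 2 = κ * (σ ^ 2 * d) / n := by
    rw [hκdef]
    field_simp
  have hx2 : (4 * √Λ) ^ 2 = 16 * Λ := by
    rw [mul_pow, Real.sq_sqrt (by linarith)]
    norm_num
  have hσ₀2 := h.σ₀_sq_le hC
  -- With x² = 16 Λ, the 32 serves noise patches of norm square at most 2 σ² d, and the 16 c₂ serves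
  -- the signal, where ‖μ‖² = κ σ² d / n with κ ≤ c₂.
  have hτd : (32 + 16 * c₂) * ((n : ℝ) ^ 2 * Λ) ≤ τ ^ 2 * d := by
    calc (32 + 16 * c₂) * ((n : ℝ) ^ 2 * Λ) ≤ C * τ ^ 2 * ((n : ℝ) ^ 2 * Λ) := by gcongr
      _ = τ ^ 2 * (C * ((n : ℝ) ^ 2 * Λ)) := by ring
      _ ≤ _ := by gcongr
  have hc₂0 : 0 < c₂ := hκ0.trans_le hκ2
  have hn2Λ : 0 ≤ (n : ℝ) ^ 2 * Λ := by positivity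
  have hnΛ : (n : ℝ) * Λ ≤ n ^ 2 * Λ := by
    gcongr
    exact le_self_pow₀ (by linarith) two_ne_zero
  have hΛn : Λ ≤ (n : ℝ) ^ 2 * Λ :=
    le_mul_of_one_le_left (by linarith) (one_le_pow₀ (by linarith))
  have hτ1 : 32 * ((n : ℝ) ^ 2 * Λ) ≤ τ ^ 2 * d := by
    linarith [mul_nonneg hc₂0.le hn2Λ]
  have hτ2 : 16 * κ * ((n : ℝ) ^ 2 * Λ) ≤ τ ^ 2 * d := by
    refine le_trans ?_ hτd
    gcongr
    linarith
  have hC2 : 1 ≤ C ^ 2 := one_le_pow₀ (by linarith)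
  have hτC : 2 ≤ τ ^ 2 * C ^ 2 := by
    have h1 : 2 * 1 ≤ C * τ ^ 2 * C :=
      mul_le_mul (by linarith) (by linarith) zero_le_one (by positivity)
    linarith
  have hprob := measure_not_typical_le (d := d) (n := n) (m := m) (μ := μ) (σ := σ) (σ₀ := σ₀)
    (τ := τ) (x := 4 * √Λ) (h.d_pos hc₁) hσ hσ₀ (h.μ_ne_zero hc₁) (by positivity)
    (by
      refine le_of_sq_le_sq ?_ (by positivity)
      rw [mul_pow, mul_pow (4 * √Λ), hx2, mul_pow σ, Real.sq_sqrt (by positivity), mul_pow τ]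
      calc (n : ℝ) ^ 2 * (16 * Λ * (σ ^ 2 * (2 * (σ ^ 2 * d))))
          = 32 * ((n : ℝ) ^ 2 * Λ) * (σ ^ 4 * d) := by ring
        _ ≤ τ ^ 2 * d * (σ ^ 4 * d) := by gcongr
        _ = _ := by ring)
    (by
      refine le_of_sq_le_sq ?_ (by positivity)
      rw [mul_pow, mul_pow (4 * √Λ), hx2, mul_pow σ, hμ2, mul_pow τ]
      calc (n : ℝ) ^ 2 * (16 * Λ * (σ ^ 2 * (κ * (σ ^ 2 * d) / n)))
          = 16 * κ * (n * Λ) * (σ ^ 4 * d) := by field_simp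
        _ ≤ 16 * κ * ((n : ℝ) ^ 2 * Λ) * (σ ^ 4 * d) := by gcongr
        _ ≤ τ ^ 2 * d * (σ ^ 4 * d) := by gcongr
        _ = _ := by ring)
    (by
      refine le_of_sq_le_sq ?_ hτ0.le
      rw [mul_pow, hx2, mul_pow, Real.sq_sqrt (by positivity)]
      calc 16 * Λ * (σ₀ ^ 2 * (2 * (σ ^ 2 * d)))
          ≤ 16 * Λ * (n / (C ^ 2 * σ ^ 2 * d ^ 2) * (2 * (σ ^ 2 * d))) := by gcongr
        _ = 32 * (n * Λ) / (C ^ 2 * d) := by field_simp; ring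
        _ ≤ 32 * ((n : ℝ) ^ 2 * Λ) / (1 * d) := by gcongr
        _ ≤ τ ^ 2 := by
            rw [one_mul, div_le_iff₀ hd]
            exact hτ1)
    (by
      refine le_of_sq_le_sq ?_ hτ0.le
      rw [mul_pow, hx2, mul_pow, hμ2]
      calc 16 * Λ * (σ₀ ^ 2 * (κ * (σ ^ 2 * d) / n))
          ≤ 16 * Λ * (n / (C ^ 2 * σ ^ 2 * d ^ 2) * (κ * (σ ^ 2 * d) / n)) := by gcongr
        _ = 16 * κ * Λ / (C ^ 2 * d) := by field_simp
        _ ≤ 16 * κ * ((n : ℝ) ^ 2 * Λ) / (1 * d) := by gcongr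
        _ ≤ τ ^ 2 := by
            rw [one_mul, div_le_iff₀ hd]
            exact hτ2)
    (by
      refine le_of_sq_le_sq ?_ (by positivity)
      rw [mul_pow, mul_pow, Real.sq_sqrt (by positivity), Real.sq_sqrt (by positivity)]
      calc σ ^ 2 * (2 * (σ₀ ^ 2 * d)) ≤ σ ^ 2 * (2 * (n / (C ^ 2 * σ ^ 2 * d ^ 2) * d)) := by
            gcongr
        _ = 2 / C ^ 2 * (n / d) := by field_simp
        _ ≤ τ ^ 2 * (n / d) := by
            gcongr
            rw [div_le_iff₀ (by positivity)]
            exact hτC)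
  refine hprob.trans (ENNReal.ofReal_le_ofReal ?_)
  exact h.tail_sum_le hc₁ hC

/-- Random labels have unbalanced classes with small probability. -/
lemma labelLaw_unbalanced_le (h : Condition C c₁ c₂ d n m Tstar μ σ σ₀ η ε δ) (hC : 160 ≤ C) :
    labelLaw n {y | ¬ ∀ j, (n : ℝ) / 4 ≤ (Finset.univ.filter fun i => y i = j).card}
      ≤ ENNReal.ofReal (δ / 2) := by
  have hb := measure_exists_le (labelLaw_card_lt n)
  rw [Fintype.card_bool] at hb
  refine le_trans (measure_mono fun y hy => ?_) (hb.trans (ENNReal.ofReal_le_ofReal ?_))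
  · rw [Set.mem_ofPred_eq] at hy
    push Not at hy
    simpa using hy
  · have hδ := h.δ_pos
    have hm4 := h.four_le_m hC
    have h1 : 1 ≤ Real.log (m / δ) := by
      have h2 : (4 : ℝ) ≤ m / δ := by
        rw [le_div_iff₀ hδ]
        nlinarith [h.δ_lt_one]
      rw [Real.le_log_iff_exp_le (by linarith)]
      linarith [Real.exp_one_lt_d9]
    have h3 := (mul_le_mul_of_nonneg_right hC (by linarith)).trans h.n_ge
    have h4 : Real.exp (n * (-(1 / 20))) ≤ δ / m := by
      calc Real.exp (n * (-(1 / 20))) ≤ Real.exp (-Real.log (m / δ)) :=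
            Real.exp_le_exp.2 (by linarith)
        _ = δ / m := by rw [Real.exp_neg, Real.exp_log (by positivity), inv_div]
    have h5 : δ / m ≤ δ / 4 := by gcongr
    push_cast
    linarith

end Condition

lemma Balanced.card_ge {y : Fin n → Bool} (h : Balanced y) (j : Bool) :
    (n : ℝ) / 4 ≤ (Finset.univ.filter fun i => y i = j).card := by
  unfold Balanced at h
  have h1 := Finset.card_filter_add_card_filter_not (s := (Finset.univ : Finset (Fin n)))
    (fun i => y i = true)
  simp only [Bool.not_eq_true, Finset.card_univ, Fintype.card_fin] at h1
  have h2 : 2 * (Finset.univ.filter fun i => y i = j).card = n := by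
    cases j <;> omega
  have h3 : 2 * ((Finset.univ.filter fun i => y i = j).card : ℝ) = n := by exact_mod_cast h2
  linarith [(Nat.cast_nonneg n : (0 : ℝ) ≤ n)]

end FeatureLearning

end

/-! ### Choice of the constants and conclusion -/

theorem theorem4p4 :
    ∃ K : ℝ, 0 < K ∧ ∀ c₁ c₂ : ℝ, 0 < c₁ → c₁ ≤ c₂ →
      ∃ C C_D a b : ℝ, 0 < C ∧ 0 < C_D ∧ C_D ≤ K * c₂ ∧ 0 < a ∧ 0 < b ∧
        ∀ (d n m Tstar : ℕ) (μ : Vec d) (σξ σ₀ η ε δ : ℝ),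
          Condition C c₁ c₂ d n m Tstar μ σξ σ₀ η ε δ →
          ∃ T₁ T₁' : ℕ,
            (a * timeScale d n m σξ η ≤ T₁ ∧ T₁ ≤ b * timeScale d n m σξ η) ∧
            (a * (ε⁻¹ * timeScale d n m σξ η) ≤ T₁' ∧
              T₁' ≤ b * (ε⁻¹ * timeScale d n m σξ η)) ∧
            T₁ ≤ T₁' ∧ T₁' ≤ Tstar ∧
            -- the labels are independent Rademacher variables
            ((labelLaw n).prod ((noiseLaw d n σξ).prod (initLaw d m σ₀)))
                {ω | ¬ Outcome μ σξ η ε C_D T₁ T₁' Tstar ω.1 ω.2.1 ω.2.2} ≤ ENNReal.ofReal δ ∧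
            -- the labels are any given balanced labels
            (∀ y : Fin n → Bool, Balanced y →
              ((noiseLaw d n σξ).prod (initLaw d m σ₀))
                {ω | ¬ Outcome μ σξ η ε C_D T₁ T₁' Tstar y ω.1 ω.2} ≤ ENNReal.ofReal δ) := by
  refine ⟨10 ^ 12, by norm_num, fun c₁ c₂ hc₁ hc => ?_⟩
  have hc₂ : 0 < c₂ := hc₁.trans_le hc
  obtain ⟨b, hb⟩ : ∃ b : ℝ, b = 400 * c₂ + 6 := ⟨_, rfl⟩
  -- A is the late time in units of ε⁻¹ times the time scale: exp 40 makes the logarithm at least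
  -- 40, 2b + 2 meets the threshold of `late_bounds`, and 100 covers both 48 and the comparison with
  -- T₁.
  obtain ⟨A, hA⟩ : ∃ A : ℝ, A = Real.exp 40 + (2 * b + 2) + 100 := ⟨_, rfl⟩
  have hb6 : 6 ≤ b := by linarith
  have he40 := Real.exp_pos 40
  obtain ⟨τ, hτ0, hτ1, hτ2⟩ : ∃ τ : ℝ, 0 < τ ∧ 3840 * b * τ ≤ 1 ∧ 3840 * b * τ ≤ c₁ := by
    refine ⟨min 1 c₁ / (3840 * b), div_pos (lt_min one_pos hc₁) (by linarith), ?_, ?_⟩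
    · rw [mul_div_cancel₀ _ (by linarith)]
      exact min_le_left _ _
    · rw [mul_div_cancel₀ _ (by linarith)]
      exact min_le_right _ _
  have hCτ0 : 0 < (32 + 16 * c₂) / τ ^ 2 := by positivity
  -- The summands of C serve, in turn, the basic numerical and tail estimates, the smallness of the
  -- step size, the inequality T₁' ≤ Tstar and the typicality of the data. The 1 in A + 1 pays for
  -- rounding up.
  refine ⟨160 + 40 * b + (A + 1) + (32 + 16 * c₂) / τ ^ 2, 10 ^ 12 * c₂, 100, A + 1,
    by linarith, by positivity, le_rfl, by norm_num, by linarith, ?_⟩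
  intro d n m Tstar μ σ σ₀ η ε δ h
  obtain ⟨C, hCdef⟩ : ∃ C : ℝ, C = 160 + 40 * b + (A + 1) + (32 + 16 * c₂) / τ ^ 2 := ⟨_, rfl⟩
  rw [← hCdef] at h
  have hC : 160 ≤ C := by linarith
  have hCτ : 32 + 16 * c₂ ≤ C * τ ^ 2 := by
    rw [← div_le_iff₀ (by positivity)]
    linarith
  have hs := h.small hc₁ hC hb (by linarith) hτ0 hτ1 hτ2
  have htyp := h.not_typical_le hc₁ hC hτ0 hCτ
  have hs0 := h.step_pos hc₁ hC
  have hsR := h.timeScale_mul hc₁ hC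
  have hR1 := h.timeScale_ge hc₁ hC
  have hR2 := h.timeScale_le hc₁ hC
  have hTs := h.Tstar_ge
  obtain ⟨R, hR⟩ : ∃ R, R = timeScale d n m σ η := ⟨_, rfl⟩
  rw [← hR] at hsR hR1 hR2 hTs ⊢
  have hεR : 1 ≤ ε⁻¹ * R := by linarith
  have hT1 : 100 * R ≤ (⌈100 * R⌉₊ : ℝ) := Nat.le_ceil _
  have hT1' : A * (ε⁻¹ * R) ≤ (⌈A * (ε⁻¹ * R)⌉₊ : ℝ) := Nat.le_ceil _
  have hT1u : (⌈100 * R⌉₊ : ℝ) < 100 * R + 1 := Nat.ceil_lt_add_one (by linarith)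
  have hT1u' : (⌈A * (ε⁻¹ * R)⌉₊ : ℝ) < A * (ε⁻¹ * R) + 1 :=
    Nat.ceil_lt_add_one (mul_nonneg (by linarith) (by linarith))
  have hA100 : 100 ≤ A := by linarith
  have hAR : 100 * R ≤ A * (ε⁻¹ * R) := mul_le_mul hA100 hR2 (by linarith) (by linarith)
  have hTT : ⌈100 * R⌉₊ ≤ ⌈A * (ε⁻¹ * R)⌉₊ := Nat.ceil_le_ceil hAR
  have hTT' : ⌈A * (ε⁻¹ * R)⌉₊ ≤ Tstar := by
    have h1 : (A + 1) * (ε⁻¹ * R) ≤ C * (ε⁻¹ * R) :=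
      mul_le_mul_of_nonneg_right (by linarith) (by linarith)
    have h2 : (⌈A * (ε⁻¹ * R)⌉₊ : ℝ) ≤ Tstar := by linarith
    exact_mod_cast h2
  have hsT : A * ε⁻¹ ≤ η * (σ ^ 2 * d) / (n * m) * ⌈A * (ε⁻¹ * R)⌉₊ := by
    have h1 := mul_le_mul_of_nonneg_left hT1' hs0.le
    calc A * ε⁻¹ = A * ε⁻¹ * (η * (σ ^ 2 * d) / (n * m) * R) := by rw [hsR, mul_one]
      _ ≤ _ := by linarith
  have hAε : A ≤ A * ε⁻¹ := le_mul_of_one_le_right (by linarith) h.one_le_inv_ε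
  have hout : ∀ (y : Fin n → Bool) (ξ : Fin n → Vec d) (W₀ : Weights d m),
      (∀ j, (n : ℝ) / 4 ≤ (Finset.univ.filter fun i => y i = j).card) → Typical μ σ τ ξ W₀ →
      Outcome μ σ η ε (10 ^ 12 * c₂) ⌈100 * R⌉₊ ⌈A * (ε⁻¹ * R)⌉₊ Tstar y ξ W₀ := by
    intro y ξ W₀ hy ht
    refine ht.outcome h.n_pos (h.m_pos hC) (h.d_pos hc₁) h.σξ_pos h.η_pos hτ0 h.ε_pos hy hs
      (h.signal_eq ▸ h.snr_le) (h.two_mul_m_le_exp hc₁ hC) ?_ hTT hTT' ?_ (by linarith) ?_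
    · have h1 := mul_le_mul_of_nonneg_left hT1 hs0.le
      linarith
    · refine le_trans ?_ hsT
      rw [div_eq_mul_inv]
      exact mul_le_mul_of_nonneg_right (by linarith) (by linarith [h.one_le_inv_ε])
    · rw [Real.le_log_iff_exp_le (by linarith)]
      linarith
  refine ⟨⌈100 * R⌉₊, ⌈A * (ε⁻¹ * R)⌉₊, ⟨hT1, ?_⟩, ⟨?_, ?_⟩, hTT, hTT', ?_, fun y hy => ?_⟩
  · nlinarith
  · exact le_trans (mul_le_mul_of_nonneg_right hA100 (by linarith)) hT1'
  · linarith
  -- Unbalanced labels and atypical data cost δ / 2 each. `measure_preimage_le` holds for arbitrary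
  -- sets, so no measurability of these events is required.
  · have hlab := h.labelLaw_unbalanced_le hC
    have h1 := (MeasureTheory.measurePreserving_fst (μ := labelLaw n)
      (ν := (noiseLaw d n σ).prod (initLaw d m σ₀))).measure_preimage_le
      {y | ¬ ∀ j, (n : ℝ) / 4 ≤ (Finset.univ.filter fun i => y i = j).card}
    have h2 := (MeasureTheory.measurePreserving_snd (μ := labelLaw n)
      (ν := (noiseLaw d n σ).prod (initLaw d m σ₀))).measure_preimage_le
      {ω | ¬ Typical μ σ τ ω.1 ω.2}
    rw [← add_halves δ, ENNReal.ofReal_add (by linarith [h.δ_pos]) (by linarith [h.δ_pos])]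
    refine le_trans (measure_mono fun ω hω => ?_) ((measure_union_le _ _).trans
      (add_le_add (h1.trans hlab) (h2.trans htyp)))
    by_contra hcon
    simp only [Set.mem_union, Set.mem_preimage, Set.mem_ofPred_eq, not_or, not_not] at hcon
    exact hω (hout _ _ _ hcon.1 hcon.2)
  · refine le_trans (measure_mono fun ω hω => ?_)
      (htyp.trans (ENNReal.ofReal_le_ofReal (by linarith [h.δ_pos])))
    exact fun ht => hω (hout _ _ _ hy.card_ge ht)
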